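/- Let $V,H$ be real Hilbert spaces forming a Gelfand triple $V\hookrightarrow H\cong H^*\hookrightarrow V^*$ with $V\hookrightarrow H$ compact and dense, and let $a\colon V\times V\to\mathbb R$ be a continuous bilinear form such that, for some $\alpha_0>0$ and $\omega_0\ge 0$, $a(v,v)+\omega_0\|v\|_H^2\ge\alpha_0\|v\|_V^2$ for all $v\in V$. Let $\langle Ay,v\rangle=a(y,v)$ and $\langle A^*p,v\rangle=a(v,p)$. Let $(\omega,\varrho)$ be a measure space, $B\colon L^2(\omega)\to V^*$ linear and continuous with adjoint $B^*\colon V\to L^2(\omega)$, let $y_0,y_d\in H$, $\delta_0>0$, and $u_a,u_b\in L^\infty(\omega)$ with $u_a<u_b$ a.e. Put $I=(0,1)$ and $$U_{ad}(0,1)=\{u\in L^2(I;L^2(\omega)) : u_a\le u(t)\le u_b \text{ a.e. in }\omega\text{ for a.e. }t\in I\}.$$ For $\nu>0$ and $u\in U_{ad}(0,1)$ let $y=S(\nu,u)\in W(0,1)=L^2(I;V)\cap H^1(I;V^*)$ be the solution of $\partial_t y+\nu Ay=\nu Bu$, $y(0)=y_0$. Set $$\delta(\nu)=\inf_{u\in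 U_{ad}(0,1)}\|S(\nu,u)(1)-y_d\|_H-\delta_0,$$ and let $\bar u(\nu)$ be the set of minimizers. For $u\in\bar u(\nu)$ with $y=S(\nu,u)$ let $p\in W(0,1)$ be the adjoint state, $-\partial_tp+\nu A^*p=0$, $p(1)=(y(1)-y_d)/\|y(1)-y_d\|_H$, and let $$D(\nu,u)=\int_0^1\langle Bu(t)-Ay(t),p(t)\rangle\,dt .$$ Let $\bar\nu>0$ with $\delta(\bar\nu)=0$, and assume: (i) for every $\nu>0$ with $\delta(\nu)>-\delta_0$, the value $D(\nu,u)$ is the same for all $u\in\bar u(\nu)$; (ii) for the adjoint state $p$ belonging to $\bar\nu$ and a minimizer $u\in\bar u(\bar\nu)$ there is $C>0$ such that for all $\varepsilon>0$ $$|\{(t,x)\in I\times\omega : -\varepsilon\le (B^*p)(t,x)\le\varepsilon\}|=\int_0^1\varrho(\{x\in\omega: |(B^*p(t))(x)|\le\varepsilon\})\,dt\le C\varepsilon ;$$ (iii) $B\in\mathcal L(L^1(\omega),H)$, i.e. there is a bounded linear operator from $L^1(\omega)$ to $H$ that coincides with $B$ on $L^1(\omega)\cap L^2(\omega)$; (iv)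 $\delta'(\bar\nu)\ne0$. Then the Newton method $\nu_{n+1}=\nu_n-\delta(\nu_n)\,\delta'(\nu_n)^{-1}$, in which $\delta'(\nu_n)$ is evaluated as $D(\nu_n,u)$ for some $u\in\bar u(\nu_n)$, converges locally q-quadratically to $\bar\nu$. That is, there are $r>0$ and $C'>0$ such that every $\nu$ with $|\nu-\bar\nu|<r$ is positive, $\delta$ is differentiable at $\nu$ with $\delta'(\nu)=D(\nu,u)\neq0$ for all $u\in\bar u(\nu)$, and for every $\nu_0$ with $|\nu_0-\bar\nu|<r$ the Newton method can be carried out for all $n$, and every sequence it generates satisfies $|\nu_n-\bar\nu|<r$, $\nu_n\to\bar\nu$ and $|\nu_{n+1}-\bar\nu|\le C'|\nu_n-\bar\nu|^2$ for all $n$. -/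

import Mathlib

open MeasureTheory Set Filter Topology
open scoped ContDiff ENNReal

/-- Lebesgue measure on the reference time interval `(0,1)`. -/
noncomputable abbrev timeMeasure : Measure ℝ := volume.restrict (Ioo (0 : ℝ) 1)

/-- The data of the control problem together with its standing assumptions:
a Gelfand triple `V ↪ H ≅ H* ↪ V*` of real Hilbert spaces with compact embedding `V ↪ H`,
a continuous bilinear form `a` on `V` satisfying Garding's inequality, a measure space `(Ω, ϱ)`
on which the controls live, a control operator `B : L²(Ω, ϱ) → V*`, the initial state, the desired
state, the radius `δ₀ > 0` of the target ball and the control bounds `uₐ < u_b` in `L^∞(Ω, ϱ)`. -/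
structure ParabolicControl (V H Ω : Type*)
    [NormedAddCommGroup V] [InnerProductSpace ℝ V]
    [NormedAddCommGroup H] [InnerProductSpace ℝ H]
    [MeasurableSpace Ω] (ϱ : Measure Ω) where
  /-- the embedding `V ↪ H` -/
  emb : V →L[ℝ] H
  emb_injective : Function.Injective emb
  emb_denseRange : DenseRange emb
  emb_compact : IsCompactOperator emb
  /-- the bilinear form; `a y`, as an element of `V*`, is `A y` -/
  a : V →L[ℝ] V →L[ℝ] ℝ
  garding : ∃ α₀ > 0, ∃ ω₀ ≥ 0, ∀ v : V, α₀ * ‖v‖ ^ 2 ≤ a v v + ω₀ * ‖emb v‖ ^ 2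
  /-- the control operator -/
  B : Lp ℝ 2 ϱ →L[ℝ] (V →L[ℝ] ℝ)
  /-- the initial state -/
  y₀ : H
  /-- the desired state -/
  yd : H
  /-- the radius of the target ball -/
  δ₀ : ℝ
  δ₀_pos : 0 < δ₀
  /-- lower control bound -/
  ua : Ω → ℝ
  /-- upper control bound -/
  ub : Ω → ℝ
  ua_memLp : MemLp ua ∞ ϱ
  ub_memLp : MemLp ub ∞ ϱ
  ua_lt_ub : ∀ᵐ x ∂ϱ, ua x < ub x

namespace ParabolicControl

variable {V H Ω : Type*}
  [NormedAddCommGroup V] [InnerProductSpace ℝ V]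
  [NormedAddCommGroup H] [InnerProductSpace ℝ H]
  [MeasurableSpace Ω] {ϱ : Measure Ω}

/-- The embedding `H ≅ H* ↪ V*`, `h ↦ (v ↦ (h, v)_H)`. -/
noncomputable def toDualV (P : ParabolicControl V H Ω ϱ) (h : H) : V →L[ℝ] ℝ :=
  (innerSL ℝ h).comp P.emb

/-- The operator `A : V → V*`, `⟨A y, v⟩ = a(y, v)`. -/
noncomputable def A (P : ParabolicControl V H Ω ϱ) : V →L[ℝ] (V →L[ℝ] ℝ) := P.a

/-- The adjoint operator `A* : V → V*`, `⟨A* p, v⟩ = a(v, p)`. -/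
noncomputable def Astar (P : ParabolicControl V H Ω ϱ) : V →L[ℝ] (V →L[ℝ] ℝ) := P.a.flip

/-- The adjoint `B* : V → L²(Ω, ϱ)`, `(B* v, w)_{L²} = ⟨B w, v⟩`, by Riesz representation. -/
noncomputable def Bstar (P : ParabolicControl V H Ω ϱ) (v : V) : Lp ℝ 2 ϱ :=
  (InnerProductSpace.toDual ℝ (Lp ℝ 2 ϱ)).symm (P.B.flip v)

/-- `B ∈ L(L¹(Ω), H)`: there is a bounded operator `L¹(Ω) → H` agreeing with `B` on
`L¹(Ω) ∩ L²(Ω)`. -/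
def BoundedL1H (P : ParabolicControl V H Ω ϱ) : Prop :=
  ∃ B₁ : Lp ℝ 1 ϱ →L[ℝ] H, ∀ (w₁ : Lp ℝ 1 ϱ) (w₂ : Lp ℝ 2 ϱ),
    (w₁ : Ω → ℝ) =ᵐ[ϱ] (w₂ : Ω → ℝ) → P.B w₂ = P.toDualV (B₁ w₁)

/-- `y ∈ W(0,1) = L²((0,1); V) ∩ H¹((0,1); V*)` with weak time derivative `dy`. -/
structure IsW (P : ParabolicControl V H Ω ϱ) (y : ℝ → V) (dy : ℝ → V →L[ℝ] ℝ) : Prop where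
  memLp : MemLp y 2 timeMeasure
  deriv_memLp : MemLp dy 2 timeMeasure
  weak_deriv : ∀ φ : ℝ → ℝ, ContDiff ℝ ∞ φ → HasCompactSupport φ → tsupport φ ⊆ Ioo 0 1 →
    ∫ t in Ioo (0 : ℝ) 1, deriv φ t • P.toDualV (P.emb (y t)) =
      -∫ t in Ioo (0 : ℝ) 1, φ t • dy t

/-- The trace of `y` at time `t ∈ [0,1]` is `h`: the value at `t` of the representative of `y` in
`C([0,1]; H)` is `h`. -/
def HasTrace (P : ParabolicControl V H Ω ϱ) (y : ℝ → V) (t : ℝ) (h : H) : Prop :=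
  ∃ Y : ℝ → H, ContinuousOn Y (Icc 0 1) ∧ (∀ᵐ s ∂timeMeasure, Y s = P.emb (y s)) ∧ Y t = h

/-- The set `U_ad(0,1)` of admissible controls, as functions in
`L²((0,1); L²(Ω)) ≅ L²((0,1) × Ω)`. -/
def Uad (P : ParabolicControl V H Ω ϱ) : Set (ℝ → Lp ℝ 2 ϱ) :=
  {u | MemLp u 2 timeMeasure ∧
    ∀ᵐ t ∂timeMeasure, ∀ᵐ x ∂ϱ, P.ua x ≤ u t x ∧ u t x ≤ P.ub x}

/-- `y = S(ν, u)`: `y ∈ W(0,1)` solves `∂ₜ y + ν A y = ν B u`, `y(0) = y₀`. -/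
def IsState (P : ParabolicControl V H Ω ϱ) (ν : ℝ) (u : ℝ → Lp ℝ 2 ϱ) (y : ℝ → V) : Prop :=
  ∃ dy : ℝ → V →L[ℝ] ℝ, P.IsW y dy ∧
    (∀ᵐ t ∂timeMeasure, dy t + ν • P.A (y t) = ν • P.B (u t)) ∧ P.HasTrace y 0 P.y₀

/-- `h = i₁ S(ν, u)` is the terminal state reached by the control `u`. -/
def IsTerminal (P : ParabolicControl V H Ω ϱ) (ν : ℝ) (u : ℝ → Lp ℝ 2 ϱ) (h : H) : Prop :=
  ∃ y : ℝ → V, P.IsState ν u y ∧ P.HasTrace y 1 h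

/-- The minimal distance value function
`δ(ν) = inf {‖i₁ S(ν, u) - y_d‖ - δ₀ | u ∈ U_ad(0,1)}`. -/
noncomputable def delta (P : ParabolicControl V H Ω ϱ) (ν : ℝ) : ℝ :=
  sInf {r : ℝ | ∃ u ∈ P.Uad, ∃ h : H, P.IsTerminal ν u h ∧ r = ‖h - P.yd‖ - P.δ₀}

/-- `u ∈ ū(ν)`: the control `u` minimizes `‖i₁ S(ν, ·) - y_d‖` over `U_ad(0,1)`. -/
def IsMinimizer (P : ParabolicControl V H Ω ϱ) (ν : ℝ) (u : ℝ → Lp ℝ 2 ϱ) : Prop :=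
  u ∈ P.Uad ∧ ∃ h : H, P.IsTerminal ν u h ∧
    ∀ u' ∈ P.Uad, ∀ h' : H, P.IsTerminal ν u' h' → ‖h - P.yd‖ ≤ ‖h' - P.yd‖

/-- `p ∈ W(0,1)` is the adjoint state belonging to `ν` and the state `y`:
`-∂ₜ p + ν A* p = 0`, `p(1) = (y(1) - y_d) / ‖y(1) - y_d‖`. -/
def IsAdjointState (P : ParabolicControl V H Ω ϱ) (ν : ℝ) (y p : ℝ → V) : Prop :=
  ∃ dp : ℝ → V →L[ℝ] ℝ, P.IsW p dp ∧
    (∀ᵐ t ∂timeMeasure, -dp t + ν • P.Astar (p t) = 0) ∧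
    ∃ h : H, P.HasTrace y 1 h ∧ P.HasTrace p 1 (‖h - P.yd‖⁻¹ • (h - P.yd))

/-- A minimizer `u ∈ ū(ν)` with its state `y = S(ν, u)` and its adjoint state `p`. -/
structure IsOptimalTriple (P : ParabolicControl V H Ω ϱ) (ν : ℝ) (u : ℝ → Lp ℝ 2 ϱ)
    (y p : ℝ → V) : Prop where
  minimizer : P.IsMinimizer ν u
  state : P.IsState ν u y
  adjoint : P.IsAdjointState ν y p

/-- The derivative expression `∫₀¹ ⟨B u(t) - A y(t), p(t)⟩ dt`. -/
noncomputable def derivExpr (P : ParabolicControl V H Ω ϱ) (u : ℝ → Lp ℝ 2 ϱ)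
    (y p : ℝ → V) : ℝ :=
  ∫ t in Ioo (0 : ℝ) 1, (P.B (u t) - P.A (y t)) (p t)

/-- The derivative expression is independent of the minimizer `u ∈ ū(ν)`, for every `ν > 0` with
`δ(ν) > -δ₀`. -/
def MinimizerIndependent (P : ParabolicControl V H Ω ϱ) : Prop :=
  ∀ ν : ℝ, 0 < ν → -P.δ₀ < P.delta ν →
    ∀ (u₁ u₂ : ℝ → Lp ℝ 2 ϱ) (y₁ y₂ p₁ p₂ : ℝ → V),
      P.IsOptimalTriple ν u₁ y₁ p₁ → P.IsOptimalTriple ν u₂ y₂ p₂ →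
        P.derivExpr u₁ y₁ p₁ = P.derivExpr u₂ y₂ p₂

/-- The structural assumption at `ū(ν)`: for some constant `C > 0`,
`|{(t,x) ∈ (0,1) × Ω | -ε ≤ (B* p)(t,x) ≤ ε}| ≤ C ε` for all `ε > 0`.
The product measure of the set is written as the integral over `t` of the measures of its slices,
which depend only on the class of `B* p` in `L²((0,1); L²(Ω))`. -/
def StructuralAssumption (P : ParabolicControl V H Ω ϱ) (ν : ℝ) : Prop :=
  ∃ (u : ℝ → Lp ℝ 2 ϱ) (y p : ℝ → V), P.IsOptimalTriple ν u y p ∧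
    ∃ C > 0, ∀ ε > 0,
      ∫⁻ t in Ioo (0 : ℝ) 1, ϱ {x | -ε ≤ P.Bstar (p t) x ∧ P.Bstar (p t) x ≤ ε} ≤
        ENNReal.ofReal (C * ε)

/-- One step `ν ↦ ν⁺ = ν - δ(ν) δ'(ν)⁻¹` of the Newton method: pick `u ∈ ū(ν)`, compute its state
and adjoint state, and evaluate `δ'(ν)` by the derivative expression, which has to be nonzero. -/
def NewtonStep (P : ParabolicControl V H Ω ϱ) (ν ν' : ℝ) : Prop :=
  0 < ν ∧ ∃ (u : ℝ → Lp ℝ 2 ϱ) (y p : ℝ → V), P.IsOptimalTriple ν u y p ∧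
    P.derivExpr u y p ≠ 0 ∧ ν' = ν - P.delta ν * (P.derivExpr u y p)⁻¹

/-- The sequences that the Newton method can generate from the initial value `ν₀`. -/
def IsNewtonSequence (P : ParabolicControl V H Ω ϱ) (ν₀ : ℝ) (ν : ℕ → ℝ) : Prop :=
  ν 0 = ν₀ ∧ ∀ n, P.NewtonStep (ν n) (ν (n + 1))

end ParabolicControl

/-! Write `h(ν,u)` for the terminal state, `F(ν,u) = ‖h(ν,u) - y_d‖` and `m(ν)` for the minimum of
`F(ν,·)` over the admissible controls. Then `δ = m - δ₀` for `ν > 0`, and `m(ν̄) = δ₀ > 0`, so near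
`ν̄` the norm is only evaluated away from its singularity.

Differentiability is an envelope argument. For fixed `u`, `F(·,u)` has the derivative `D(ν,u)`, with
a quadratic remainder uniform in `u`. Comparing minimizers of two parameters squeezes the difference
quotient of `m` between values of `D` at a minimizer and at a near-minimizer. Near-minimizers have
`D` close to its common value at the minimizers; otherwise they would accumulate, by weak
compactness in a closed half-space, at a minimizer with another value
(`DistanceProblem.exists_abs_D_sub_le`, `DistanceProblem.hasDerivAt_m`).

For the quadratic rate no Lipschitz bound for `δ'` near `ν̄` is needed: calmness `|D(ν,u) -
D(ν̄,u₀)| ≤ C|ν - ν̄|` for minimizers `u` of `ν` is enough. The optimality condition makes `u₀`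
bang-bang with switching function `B*p`. The structural assumption turns this into growth `F(ν̄,u) -
F(ν̄,u₀) ≥ c‖u - u₀‖²` in the norm of `L¹((0,1) × Ω)` (`exists_quadratic_growth`,
`ParabolicControl.exists_growth`). Since `F(ν̄,·)` is perturbed by `(ν - ν̄) D(ν̄,·)` up to second
order, and `D(ν̄,·)` is Lipschitz for the `L¹` distance, growth forces `‖u - u₀‖_{L¹} ≤ C|ν - ν̄|`,
hence calmness (`DistanceProblem.exists_newton_estimate`). The `L¹` Lipschitz bound is where `B ∈
L(L¹,H)` enters: by duality the state is controlled by the `L¹(0,1;H)` norm of the right-hand side,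
because adjoint states are bounded in `C([0,1];H)`.

The parabolic theory is built inside `L²(0,1;V)`, with `V*` identified with `V` by Riesz. The
equation is integrated once in time, so that only the Volterra operator `K w = ∫₀ᵗ w` and bounded
operators acting pointwise in time occur. Energy estimates, applied to the equation and to its
transpose, give existence, uniqueness and duality (`GardingTriple.exists_solver`). The lemma of du
Bois-Reymond identifies these solutions with the weak ones in `W(0,1)`. -/

set_option linter.unusedSectionVars false

/-! ### Primitives, the Volterra operator and time reversal on `L²((0,1); E)` -/

noncomputable section

namespace Parabolic

/-- Square integrable functions on the time interval `(0,1)` with values in `E`. -/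
abbrev TimeL2 (E : Type*) [NormedAddCommGroup E] : Type _ := Lp E 2 timeMeasure

section Volterra

variable {E F : Type*} [NormedAddCommGroup E] [InnerProductSpace ℝ E]
  [NormedAddCommGroup F] [InnerProductSpace ℝ F]

instance : IsProbabilityMeasure timeMeasure := ⟨by simp [timeMeasure]⟩

theorem integrable_of_memLp_two {w : ℝ → E} (h : MemLp w 2 timeMeasure) :
    Integrable w timeMeasure := h.integrable one_le_two

theorem integrable_timeL2 (w : TimeL2 E) : Integrable w timeMeasure :=
  integrable_of_memLp_two (Lp.memLp w)

/-- The primitive `t ↦ ∫₀ᵗ w` of a function on `(0,1)`, extended by constants. -/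
def prim (w : ℝ → E) (t : ℝ) : E := ∫ s in (0 : ℝ)..t, w s ∂timeMeasure

theorem prim_zero (w : ℝ → E) : prim w 0 = 0 := by simp [prim]

theorem intervalIntegrable_time {w : ℝ → E} (h : Integrable w timeMeasure) (a b : ℝ) :
    IntervalIntegrable w timeMeasure a b := h.intervalIntegrable

theorem continuous_prim {w : ℝ → E} (h : Integrable w timeMeasure) : Continuous (prim w) :=
  intervalIntegral.continuous_primitive (intervalIntegrable_time h) 0

theorem norm_prim_le {w : ℝ → E} (h : Integrable w timeMeasure) (t : ℝ) :
    ‖prim w t‖ ≤ ∫ s, ‖w s‖ ∂timeMeasure :=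
  (intervalIntegral.norm_integral_le_integral_norm_uIoc).trans
    (setIntegral_le_integral h.norm (Eventually.of_forall fun _ => norm_nonneg _))

theorem prim_congr {w w' : ℝ → E} (h : w =ᵐ[timeMeasure] w') : prim w = prim w' := by
  funext t
  exact intervalIntegral.integral_congr_ae (h.mono fun _ hx _ => hx)

theorem prim_add {w w' : ℝ → E} (h : Integrable w timeMeasure) (h' : Integrable w' timeMeasure)
    (t : ℝ) : prim (fun s => w s + w' s) t = prim w t + prim w' t :=
  intervalIntegral.integral_add (intervalIntegrable_time h _ _) (intervalIntegrable_time h' _ _)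

theorem prim_smul (c : ℝ) (w : ℝ → E) (t : ℝ) : prim (fun s => c • w s) t = c • prim w t :=
  intervalIntegral.integral_smul c w

theorem prim_one (w : ℝ → E) : prim w 1 = ∫ s, w s ∂timeMeasure := by
  rw [prim, intervalIntegral.integral_of_le zero_le_one, timeMeasure,
    Measure.restrict_restrict measurableSet_Ioc]
  congr 2
  exact inter_eq_right.2 Ioo_subset_Ioc_self

theorem restrict_timeMeasure_uIoc {a b : ℝ} (ha : a ∈ Icc (0 : ℝ) 1) (hb : b ∈ Icc (0 : ℝ) 1) :
    timeMeasure.restrict (uIoc a b) = volume.restrict (uIoc a b) := by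
  rw [timeMeasure, Measure.restrict_restrict measurableSet_uIoc]
  refine Measure.restrict_congr_set ?_
  have h1 : (uIoc a b ∩ Ioo (0 : ℝ) 1 : Set ℝ) =ᵐ[volume] (uIoc a b ∩ Ioc 0 1 : Set ℝ) :=
    (ae_eq_refl _).inter Ioo_ae_eq_Ioc
  refine h1.trans ?_
  refine (inter_eq_left.2 fun x hx => ?_).eventuallyEq
  rw [mem_uIoc] at hx
  rcases hx with hx | hx
  · exact ⟨ha.1.trans_lt hx.1, hx.2.trans hb.2⟩
  · exact ⟨hb.1.trans_lt hx.1, hx.2.trans ha.2⟩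

theorem intervalIntegral_timeMeasure (w : ℝ → E) {a b : ℝ} (ha : a ∈ Icc (0 : ℝ) 1)
    (hb : b ∈ Icc (0 : ℝ) 1) : ∫ s in a..b, w s ∂timeMeasure = ∫ s in a..b, w s := by
  rw [intervalIntegral.intervalIntegral_eq_integral_uIoc,
    intervalIntegral.intervalIntegral_eq_integral_uIoc, restrict_timeMeasure_uIoc ha hb]

theorem prim_eq (w : ℝ → E) {t : ℝ} (ht : t ∈ Icc (0 : ℝ) 1) :
    prim w t = ∫ s in (0 : ℝ)..t, w s :=
  intervalIntegral_timeMeasure w ⟨le_rfl, zero_le_one⟩ ht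

theorem prim_sub_prim {w : ℝ → E} (h : Integrable w timeMeasure) (s t : ℝ) :
    prim w t - prim w s = ∫ r in s..t, w r ∂timeMeasure :=
  intervalIntegral.integral_interval_sub_left (intervalIntegrable_time h _ _)
    (intervalIntegrable_time h _ _)

theorem integral_timeMeasure_eq_interval (w : ℝ → E) :
    ∫ s, w s ∂timeMeasure = ∫ s in (0 : ℝ)..1, w s := by
  rw [← prim_one, prim_eq w ⟨zero_le_one, le_rfl⟩]

theorem continuous_integrable {w : ℝ → E} (h : Continuous w) : Integrable w timeMeasure :=
  (h.integrableOn_Icc (a := 0) (b := 1)).mono_set Ioo_subset_Icc_self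

theorem hasDerivAt_prim [CompleteSpace E] {w : ℝ → E} (h : Continuous w) {t : ℝ}
    (ht : t ∈ Ioo (0 : ℝ) 1) : HasDerivAt (prim w) (w t) t := by
  have h1 : HasDerivAt (fun u => ∫ s in (0 : ℝ)..u, w s) (w t) t :=
    intervalIntegral.integral_hasDerivAt_right (h.intervalIntegrable _ _)
      (h.stronglyMeasurableAtFilter _ _) h.continuousAt
  refine h1.congr_of_eventuallyEq ?_
  filter_upwards [isOpen_Ioo.mem_nhds ht] with u hu
  exact prim_eq w (Ioo_subset_Icc_self hu)

theorem memLp_of_continuous {w : ℝ → E} (h : Continuous w) : MemLp w 2 timeMeasure := by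
  obtain ⟨C, hC⟩ := (isCompact_Icc (a := (0 : ℝ)) (b := 1)).exists_bound_of_continuousOn
    h.continuousOn
  have : IsFiniteMeasure timeMeasure := inferInstance
  refine MemLp.of_bound (continuous_integrable h).aestronglyMeasurable C ?_
  filter_upwards [ae_restrict_mem measurableSet_Ioo] with x hx
  exact hC x (Ioo_subset_Icc_self hx)

theorem ContinuousLinearMap.prim_comp [CompleteSpace E] [CompleteSpace F] (L : E →L[ℝ] F)
    {w : ℝ → E} (h : Integrable w timeMeasure) (t : ℝ) :
    prim (fun s => L (w s)) t = L (prim w t) :=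
  L.intervalIntegral_comp_comm (intervalIntegrable_time h _ _)

theorem integral_norm_le (w : TimeL2 E) : ∫ s, ‖w s‖ ∂timeMeasure ≤ ‖w‖ := by
  have h1 : ∫ s, ‖w s‖ ∂timeMeasure = (eLpNorm w 1 timeMeasure).toReal := by
    rw [integral_norm_eq_lintegral_enorm (Lp.aestronglyMeasurable w), eLpNorm_one_eq_lintegral_enorm]
  rw [h1, Lp.norm_def]
  exact ENNReal.toReal_mono (Lp.eLpNorm_ne_top w)
    (eLpNorm_le_eLpNorm_of_exponent_le one_le_two (Lp.aestronglyMeasurable w))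

/-- The primitive as a bounded continuous function. -/
def primB (E : Type*) [NormedAddCommGroup E] [InnerProductSpace ℝ E] :
    TimeL2 E →L[ℝ] BoundedContinuousFunction ℝ E :=
  LinearMap.mkContinuous
    { toFun := fun w => BoundedContinuousFunction.ofNormedAddCommGroup (prim w)
        (continuous_prim (integrable_timeL2 w)) ‖w‖
        (fun t => (norm_prim_le (integrable_timeL2 w) t).trans (integral_norm_le w))
      map_add' := fun w w' => by
        ext t
        simp only [BoundedContinuousFunction.coe_ofNormedAddCommGroup,
          BoundedContinuousFunction.coe_add, Pi.add_apply]
        rw [prim_congr (Lp.coeFn_add w w')]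
        exact prim_add (integrable_timeL2 w) (integrable_timeL2 w') t
      map_smul' := fun c w => by
        ext t
        simp only [BoundedContinuousFunction.coe_ofNormedAddCommGroup, RingHom.id_apply,
          BoundedContinuousFunction.coe_smul]
        rw [prim_congr (Lp.coeFn_smul c w)]
        exact prim_smul c w t }
    1 (fun w => by
      rw [one_mul]
      exact BoundedContinuousFunction.norm_ofNormedAddCommGroup_le (f := prim w) _ (norm_nonneg _)
        (fun t => (norm_prim_le (integrable_timeL2 w) t).trans (integral_norm_le w)))

/-- Bounded continuous functions as elements of `L²((0,1); E)`. -/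
def bcfL2 (E : Type*) [NormedAddCommGroup E] [InnerProductSpace ℝ E] :
    BoundedContinuousFunction ℝ E →L[ℝ] TimeL2 E :=
  BoundedContinuousFunction.toLp 2 timeMeasure ℝ

theorem coeFn_bcfL2 (f : BoundedContinuousFunction ℝ E) : bcfL2 E f =ᵐ[timeMeasure] f :=
  BoundedContinuousFunction.coeFn_toLp 2 timeMeasure ℝ f

theorem denseRange_bcfL2 : DenseRange (bcfL2 E) :=
  BoundedContinuousFunction.toLp_denseRange E timeMeasure ℝ (by simp)

/-- The Volterra operator `w ↦ ∫₀ᵗ w` on `L²((0,1); E)`. -/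
def volterra (E : Type*) [NormedAddCommGroup E] [InnerProductSpace ℝ E] :
    TimeL2 E →L[ℝ] TimeL2 E := (bcfL2 E).comp (primB E)

theorem coeFn_volterra (w : TimeL2 E) : volterra E w =ᵐ[timeMeasure] prim w :=
  coeFn_bcfL2 (primB E w)

/-- The mean value `w ↦ ∫₀¹ w`. -/
def timeMean (E : Type*) [NormedAddCommGroup E] [InnerProductSpace ℝ E] :
    TimeL2 E →L[ℝ] E := (BoundedContinuousFunction.evalCLM ℝ (1 : ℝ)).comp (primB E)

theorem timeMean_apply (w : TimeL2 E) : timeMean E w = prim w 1 := rfl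

theorem timeMean_eq (w : TimeL2 E) : timeMean E w = ∫ s, w s ∂timeMeasure := prim_one _

/-- Constant functions in `L²((0,1); E)`. -/
def constT (E : Type*) [NormedAddCommGroup E] [InnerProductSpace ℝ E] : E →L[ℝ] TimeL2 E :=
  Lp.constL 2 timeMeasure ℝ

theorem coeFn_constT (c : E) : constT E c =ᵐ[timeMeasure] fun _ => c :=
  Lp.coeFn_const 2 timeMeasure c

theorem inner_timeL2 (u w : TimeL2 E) :
    inner ℝ u w = ∫ t, inner ℝ (u t) (w t) ∂timeMeasure := L2.inner_def u w

theorem inner_constT [CompleteSpace E] (c : E) (w : TimeL2 E) :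
    inner ℝ (constT E c) w = inner ℝ c (timeMean E w) := by
  rw [inner_timeL2, timeMean_eq, ← integral_inner (integrable_timeL2 w)]
  refine integral_congr_ae ?_
  filter_upwards [coeFn_constT c] with t ht
  rw [ht]

theorem integral_inner_prim_add [CompleteSpace E] {u w : ℝ → E} (hu : Continuous u)
    (hw : Continuous w) :
    ∫ t, (inner ℝ (prim u t) (w t) + inner ℝ (u t) (prim w t)) ∂timeMeasure =
      inner ℝ (prim u 1) (prim w 1) := by
  have hcu := continuous_prim (continuous_integrable hu)
  have hcw := continuous_prim (continuous_integrable hw)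
  rw [integral_timeMeasure_eq_interval,
    intervalIntegral.integral_eq_sub_of_hasDerivAt_of_le zero_le_one
      (f := fun t => inner ℝ (prim u t) (prim w t)) (by fun_prop)
      (fun t ht => (hasDerivAt_prim hu ht).inner ℝ (hasDerivAt_prim hw ht))
      (Continuous.intervalIntegrable (by fun_prop) _ _)]
  simp [prim_zero]

/-- Integration by parts. It follows from the fundamental theorem of calculus for continuous
functions, and both sides are continuous in the `L²` norm. -/
theorem inner_volterra_add [CompleteSpace E] (u w : TimeL2 E) :
    inner ℝ (volterra E u) w + inner ℝ u (volterra E w) =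
      inner ℝ (timeMean E u) (timeMean E w) := by
  refine denseRange_bcfL2.induction_on₂ (p := fun u w => inner ℝ (volterra E u) w +
    inner ℝ u (volterra E w) = inner ℝ (timeMean E u) (timeMean E w))
    (isClosed_eq (by fun_prop) (by fun_prop)) ?_ u w
  intro f g
  have hf : prim (bcfL2 E f) = prim f := prim_congr (coeFn_bcfL2 f)
  have hg : prim (bcfL2 E g) = prim g := prim_congr (coeFn_bcfL2 g)
  rw [timeMean_apply, timeMean_apply, hf, hg, ← integral_inner_prim_add f.continuous g.continuous,
    inner_timeL2, inner_timeL2, ← integral_add (L2.integrable_inner _ _) (L2.integrable_inner _ _)]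
  refine integral_congr_ae ?_
  filter_upwards [coeFn_bcfL2 f, coeFn_bcfL2 g, coeFn_volterra (bcfL2 E f),
    coeFn_volterra (bcfL2 E g)] with t h1 h2 h3 h4
  rw [h1, h2, h3, h4, hf, hg]

theorem measurePreserving_reflect : MeasurePreserving (fun t : ℝ => 1 - t) timeMeasure
    timeMeasure := by
  have h := ((volume : Measure ℝ).measurePreserving_sub_left (1 : ℝ)).restrict_preimage
    (measurableSet_Ioo (a := (0 : ℝ)) (b := 1))
  have : (fun t : ℝ => 1 - t) ⁻¹' Ioo 0 1 = Ioo 0 1 := by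
    ext x; simp only [mem_preimage, mem_Ioo]; constructor <;> rintro ⟨h1, h2⟩ <;>
      constructor <;> linarith
  rwa [this] at h

/-- Time reversal on `L²((0,1); E)`. -/
def reflect (E : Type*) [NormedAddCommGroup E] [InnerProductSpace ℝ E] :
    TimeL2 E →L[ℝ] TimeL2 E :=
  (Lp.compMeasurePreservingₗᵢ ℝ (fun t : ℝ => 1 - t) measurePreserving_reflect).toContinuousLinearMap

theorem coeFn_reflect (w : TimeL2 E) : reflect E w =ᵐ[timeMeasure] fun t => w (1 - t) :=
  Lp.coeFn_compMeasurePreserving w measurePreserving_reflect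

theorem norm_reflect (w : TimeL2 E) : ‖reflect E w‖ = ‖w‖ :=
  Lp.norm_compMeasurePreserving w measurePreserving_reflect

theorem reflect_reflect (w : TimeL2 E) : reflect E (reflect E w) = w := by
  refine Lp.ext ?_
  filter_upwards [coeFn_reflect (reflect E w),
    measurePreserving_reflect.quasiMeasurePreserving.ae (coeFn_reflect w)] with t h1 h2
  rw [h1, h2, sub_sub_cancel]

theorem prim_reflect (w : ℝ → E) (hw : Integrable w timeMeasure) {t : ℝ} (ht : t ∈ Icc (0 : ℝ) 1) :
    prim (fun s => w (1 - s)) t = prim w 1 - prim w (1 - t) := by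
  have ht' : 1 - t ∈ Icc (0 : ℝ) 1 := ⟨by linarith [ht.2], by linarith [ht.1]⟩
  rw [prim_sub_prim hw, prim_eq _ ht, intervalIntegral_timeMeasure _ ht' ⟨zero_le_one, le_rfl⟩,
    intervalIntegral.integral_comp_sub_left (fun s => w s) 1, sub_zero]

theorem volterra_add_reflect (w : TimeL2 E) :
    volterra E w + reflect E (volterra E (reflect E w)) = constT E (timeMean E w) := by
  refine Lp.ext ?_
  filter_upwards [Lp.coeFn_add (volterra E w) (reflect E (volterra E (reflect E w))),
    coeFn_constT (timeMean E w), coeFn_reflect (volterra E (reflect E w)), coeFn_volterra w,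
    measurePreserving_reflect.quasiMeasurePreserving.ae (coeFn_volterra (reflect E w)),
    ae_restrict_mem measurableSet_Ioo] with t h1 h2 h3 h4 h5 ht
  have ht' : 1 - t ∈ Icc (0 : ℝ) 1 := ⟨by linarith [ht.2], by linarith [ht.1]⟩
  rw [h1, h2, Pi.add_apply, h3, h4, h5, prim_congr (coeFn_reflect w),
    prim_reflect w (integrable_timeL2 w) ht', timeMean_apply, sub_sub_cancel]
  abel

/-- The adjoint of `∫₀ᵗ` is `∫ₜ¹`, that is, the Volterra operator conjugated by time reversal. This
form lets backward equations be treated as forward equations of the transposed system. -/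
theorem inner_volterra [CompleteSpace E] (u w : TimeL2 E) :
    inner ℝ (volterra E u) w = inner ℝ u (reflect E (volterra E (reflect E w))) := by
  have h1 := inner_volterra_add u w
  have h2 : reflect E (volterra E (reflect E w)) = constT E (timeMean E w) - volterra E w := by
    rw [← volterra_add_reflect]; abel
  rw [h2, inner_sub_right, real_inner_comm (constT E _), inner_constT,
    real_inner_comm (timeMean E u)]
  linarith

/-- A bounded operator acting pointwise in time. -/
def lift (L : E →L[ℝ] F) : TimeL2 E →L[ℝ] TimeL2 F := L.compLpL 2 timeMeasure

theorem coeFn_lift (L : E →L[ℝ] F) (w : TimeL2 E) :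
    lift L w =ᵐ[timeMeasure] fun t => L (w t) := L.coeFn_compLpL w

theorem norm_lift_le (L : E →L[ℝ] F) (w : TimeL2 E) : ‖lift L w‖ ≤ ‖L‖ * ‖w‖ :=
  L.norm_compLp_le w

theorem volterra_lift [CompleteSpace E] [CompleteSpace F] (L : E →L[ℝ] F) (w : TimeL2 E) :
    volterra F (lift L w) = lift L (volterra E w) := by
  refine Lp.ext ?_
  filter_upwards [coeFn_volterra (lift L w), coeFn_lift L (volterra E w), coeFn_volterra w]
    with t h1 h2 h3
  rw [h1, h2, h3, prim_congr (coeFn_lift L w), ContinuousLinearMap.prim_comp L (integrable_timeL2 w)]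

theorem reflect_lift (L : E →L[ℝ] F) (w : TimeL2 E) :
    reflect F (lift L w) = lift L (reflect E w) := by
  refine Lp.ext ?_
  filter_upwards [coeFn_reflect (lift L w), coeFn_lift L (reflect E w), coeFn_reflect w,
    measurePreserving_reflect.quasiMeasurePreserving.ae (coeFn_lift L w)]
    with t h1 h2 h3 h4
  rw [h1, h2, h3, h4]

theorem lift_constT (L : E →L[ℝ] F) (c : E) : lift L (constT E c) = constT F (L c) := by
  refine Lp.ext ?_
  filter_upwards [coeFn_lift L (constT E c), coeFn_constT c, coeFn_constT (L c)] with t h1 h2 h3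
  rw [h1, h2, h3]

theorem reflect_constT (c : E) : reflect E (constT E c) = constT E c := by
  refine Lp.ext ?_
  filter_upwards [coeFn_reflect (constT E c), coeFn_constT c,
    measurePreserving_reflect.quasiMeasurePreserving.ae (coeFn_constT c)] with t h1 h2 h3
  rw [h1, h2, h3]

theorem inner_lift [CompleteSpace E] [CompleteSpace F] (L : E →L[ℝ] F) (u : TimeL2 E)
    (w : TimeL2 F) : inner ℝ (lift L u) w = inner ℝ u (lift (ContinuousLinearMap.adjoint L) w) := by
  rw [inner_timeL2, inner_timeL2]
  refine integral_congr_ae ?_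
  filter_upwards [coeFn_lift L u, coeFn_lift (ContinuousLinearMap.adjoint L) w] with t h1 h2
  rw [h1, h2, ContinuousLinearMap.adjoint_inner_right]

/-- Integration by parts: the weak derivative of `∫₀ᵗ w` is `w`. -/
theorem integral_deriv_smul_prim [CompleteSpace E] {w : ℝ → E} (hw : MemLp w 2 timeMeasure)
    {φ : ℝ → ℝ} (hφ : ContDiff ℝ ∞ φ) (hs : tsupport φ ⊆ Ioo 0 1) :
    ∫ t, deriv φ t • prim w t ∂timeMeasure = -∫ t, φ t • w t ∂timeMeasure := by
  have h0 : ∀ t ∉ Ioo (0 : ℝ) 1, φ t = 0 := fun t ht =>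
    image_eq_zero_of_notMem_tsupport fun h => ht (hs h)
  have hcφ : Continuous φ := hφ.continuous
  have hcd : Continuous (deriv φ) := hφ.continuous_deriv (by simp)
  have hprim : ∀ (v : E), ∀ t ∈ Icc (0 : ℝ) 1, prim (fun s => deriv φ s • v) t = φ t • v := by
    intro v t ht
    rw [prim_eq _ ht, intervalIntegral.integral_smul_const, intervalIntegral.integral_deriv_eq_sub
      (fun x _ => (hφ.differentiable (by simp)).differentiableAt) (hcd.intervalIntegrable _ _),
      h0 0 (by simp), sub_zero]
  have hi1 : Integrable (fun t => deriv φ t • prim w t) timeMeasure :=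
    continuous_integrable (hcd.smul (continuous_prim (integrable_of_memLp_two hw)))
  have hi2 : Integrable (fun t => φ t • w t) timeMeasure := by
    obtain ⟨C, hC⟩ := (isCompact_Icc (a := (0 : ℝ)) (b := 1)).exists_bound_of_continuousOn
      hcφ.continuousOn
    refine (integrable_of_memLp_two hw).bdd_smul C hcφ.aestronglyMeasurable ?_
    filter_upwards [ae_restrict_mem measurableSet_Ioo] with x hx using hC x (Ioo_subset_Icc_self hx)
  refine ext_inner_right ℝ fun v => ?_
  have hd : MemLp (fun s => deriv φ s • v) 2 timeMeasure := memLp_of_continuous (by fun_prop)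
  -- Tested with a vector `v`, the claim is integration by parts of `w` against `φ' v`, whose
  -- primitive is `φ v`; the boundary term vanishes because `φ(1) = 0`.
  have h := inner_volterra_add (hw.toLp w) (hd.toLp _)
  have hm : timeMean E (hd.toLp _) = 0 := by
    rw [timeMean_apply, prim_congr hd.coeFn_toLp, hprim v 1 ⟨zero_le_one, le_rfl⟩,
      h0 1 (by simp), zero_smul]
  rw [hm, inner_zero_right] at h
  rw [inner_neg_left, real_inner_comm, ← integral_inner hi1, real_inner_comm, ← integral_inner hi2]
  have e1 : inner ℝ (volterra E (hw.toLp w)) (hd.toLp _) =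
      ∫ t, inner ℝ v (deriv φ t • prim w t) ∂timeMeasure := by
    rw [inner_timeL2]
    refine integral_congr_ae ?_
    filter_upwards [coeFn_volterra (hw.toLp w), hd.coeFn_toLp] with t h1 h2
    rw [h1, h2, prim_congr hw.coeFn_toLp, real_inner_smul_right, real_inner_smul_right,
      real_inner_comm]
  have e2 : inner ℝ (hw.toLp w) (volterra E (hd.toLp _)) =
      ∫ t, inner ℝ v (φ t • w t) ∂timeMeasure := by
    rw [inner_timeL2]
    refine integral_congr_ae ?_
    filter_upwards [coeFn_volterra (hd.toLp _), hw.coeFn_toLp, ae_restrict_mem measurableSet_Ioo]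
      with t h1 h2 ht
    rw [h1, h2, prim_congr hd.coeFn_toLp, hprim v t (Ioo_subset_Icc_self ht),
      real_inner_smul_right, real_inner_smul_right, real_inner_comm]
  rw [e1, e2] at h
  linarith

theorem ae_eq_zero_of_integral_smul_eq_zero [CompleteSpace E] {w : ℝ → E}
    (hw : Integrable w timeMeasure)
    (h : ∀ φ : ℝ → ℝ, ContDiff ℝ ∞ φ → HasCompactSupport φ → tsupport φ ⊆ Ioo 0 1 →
      ∫ t, φ t • w t ∂timeMeasure = 0) : w =ᵐ[timeMeasure] 0 := by
  have h1 := isOpen_Ioo.ae_eq_zero_of_integral_contDiff_smul_eq_zero (μ := volume) (f := w)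
    (U := Ioo (0 : ℝ) 1) (IntegrableOn.locallyIntegrableOn hw) ?_
  · rw [Filter.EventuallyEq, ae_restrict_iff' measurableSet_Ioo]
    exact h1
  · intro φ hφ hc hs
    rw [← h φ hφ hc hs, timeMeasure, setIntegral_eq_integral_of_forall_compl_eq_zero]
    intro t ht
    rw [image_eq_zero_of_notMem_tsupport fun h => ht (hs h), zero_smul]

theorem volterra_injective [CompleteSpace E] : Function.Injective (volterra E) := by
  rw [injective_iff_map_eq_zero]
  intro w hw
  refine (Lp.eq_zero_iff_ae_eq_zero).2 ?_
  refine ae_eq_zero_of_integral_smul_eq_zero (integrable_timeL2 w) fun φ hφ hc hs => ?_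
  have h := integral_deriv_smul_prim (Lp.memLp w) hφ hs
  have h0 : ∫ t, deriv φ t • prim w t ∂timeMeasure = 0 := by
    refine (integral_congr_ae ?_).trans (integral_zero _ _)
    filter_upwards [coeFn_volterra w, (Lp.eq_zero_iff_ae_eq_zero).1 hw] with t h1 h2
    rw [← h1, h2]; simp
  rw [h0] at h
  simpa using h.symm

/-- The adjoint is injective, being conjugate to `volterra` itself by time reversal. -/
theorem denseRange_volterra [CompleteSpace E] : DenseRange (volterra E) := by
  have h : (LinearMap.range (volterra E).toLinearMap).topologicalClosure = ⊤ := by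
    rw [Submodule.topologicalClosure_eq_top_iff, Submodule.eq_bot_iff]
    intro w hw
    rw [Submodule.mem_orthogonal] at hw
    have h0 : reflect E (volterra E (reflect E w)) = 0 := by
      rw [← inner_self_eq_zero (𝕜 := ℝ), ← inner_volterra]
      exact hw _ ⟨_, rfl⟩
    have h1 : volterra E (reflect E w) = 0 := by
      rw [← reflect_reflect (volterra E (reflect E w)), h0, map_zero]
    have h2 : reflect E w = 0 := volterra_injective (by rw [h1, map_zero])
    rw [← reflect_reflect w, h2, map_zero]
  intro x
  have := Submodule.mem_top (R := ℝ) (x := x)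
  rw [← h] at this
  exact this

end Volterra

end Parabolic

end

/-! ### Energy estimates and the operator of the parabolic equation -/

noncomputable section

namespace Parabolic

/-- A dense embedding `V → H` of Hilbert spaces together with an operator on `V` satisfying
Garding's inequality; `V*` is identified with `V` by Riesz representation. -/
structure GardingTriple (V H : Type*)
    [NormedAddCommGroup V] [InnerProductSpace ℝ V]
    [NormedAddCommGroup H] [InnerProductSpace ℝ H] where
  emb : V →L[ℝ] H
  emb_denseRange : DenseRange emb
  A : V →L[ℝ] V
  α₀ : ℝ
  ω₀ : ℝ
  α₀_pos : 0 < α₀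
  ω₀_nonneg : 0 ≤ ω₀
  garding : ∀ v : V, α₀ * ‖v‖ ^ 2 ≤ inner ℝ (A v) v + ω₀ * ‖emb v‖ ^ 2

theorem prim_eq_of_one_le {E : Type*} [NormedAddCommGroup E] [InnerProductSpace ℝ E] (w : ℝ → E)
    (hw : Integrable w timeMeasure) {t : ℝ} (ht : 1 ≤ t) : prim w t = prim w 1 := by
  rw [← sub_eq_zero, prim_sub_prim hw, intervalIntegral.integral_of_le ht]
  have : (timeMeasure.restrict (Ioc 1 t)) = 0 := by
    rw [timeMeasure, Measure.restrict_restrict measurableSet_Ioc]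
    have : Ioc (1 : ℝ) t ∩ Ioo 0 1 = ∅ := by
      ext x; simp only [mem_inter_iff, mem_Ioc, mem_Ioo, mem_empty_iff_false, iff_false]
      intro hx; linarith [hx.1.1, hx.2.2]
    simp [this]
  rw [this, integral_zero_measure]

theorem prim_eq_of_nonpos {E : Type*} [NormedAddCommGroup E] [InnerProductSpace ℝ E] (w : ℝ → E)
    (hw : Integrable w timeMeasure) {t : ℝ} (ht : t ≤ 0) : prim w t = prim w 0 := by
  rw [← sub_eq_zero, prim_sub_prim hw, intervalIntegral.integral_of_ge ht]
  have : (timeMeasure.restrict (Ioc t 0)) = 0 := by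
    rw [timeMeasure, Measure.restrict_restrict measurableSet_Ioc]
    have : Ioc t 0 ∩ Ioo (0 : ℝ) 1 = ∅ := by
      ext x; simp only [mem_inter_iff, mem_Ioc, mem_Ioo, mem_empty_iff_false, iff_false]
      intro hx; linarith [hx.1.2, hx.2.1]
    simp [this]
  rw [this, integral_zero_measure, neg_zero]

theorem integral_norm_mul_norm_le {E : Type*} [NormedAddCommGroup E] [InnerProductSpace ℝ E]
    (f g : TimeL2 E) : ∫ t, ‖f t‖ * ‖g t‖ ∂timeMeasure ≤ ‖f‖ * ‖g‖ := by
  have hf := (Lp.memLp f).norm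
  have hg := (Lp.memLp g).norm
  have h := real_inner_le_norm (hf.toLp _) (hg.toLp _)
  rw [Lp.norm_toLp, Lp.norm_toLp, eLpNorm_norm, eLpNorm_norm, ← Lp.norm_def, ← Lp.norm_def] at h
  refine le_trans (le_of_eq ?_) h
  rw [inner_timeL2]
  refine integral_congr_ae ?_
  filter_upwards [hf.coeFn_toLp, hg.coeFn_toLp] with t h1 h2
  rw [h1, h2]; simp [mul_comm]

theorem norm_sq_timeL2 {E : Type*} [NormedAddCommGroup E] [InnerProductSpace ℝ E]
    (f : TimeL2 E) : ‖f‖ ^ 2 = ∫ t, ‖f t‖ ^ 2 ∂timeMeasure := by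
  rw [← real_inner_self_eq_norm_sq, inner_timeL2]
  simp_rw [real_inner_self_eq_norm_sq]

variable {V H : Type*}
  [NormedAddCommGroup V] [InnerProductSpace ℝ V] [CompleteSpace V]
  [NormedAddCommGroup H] [InnerProductSpace ℝ H] [CompleteSpace H]

namespace GardingTriple

/-- The Riesz representation `H → V` of the embedding `H → V*`. -/
def embAdj (T : GardingTriple V H) : H →L[ℝ] V := ContinuousLinearMap.adjoint T.emb

/-- The Riesz representation of `V → H ≅ H* → V*`. -/
def gram (T : GardingTriple V H) : V →L[ℝ] V := T.embAdj.comp T.emb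

theorem inner_embAdj (T : GardingTriple V H) (h : H) (v : V) :
    inner ℝ (T.embAdj h) v = inner ℝ h (T.emb v) :=
  ContinuousLinearMap.adjoint_inner_left _ _ _

theorem inner_gram (T : GardingTriple V H) (u v : V) :
    inner ℝ (T.gram u) v = inner ℝ (T.emb u) (T.emb v) := T.inner_embAdj _ _

/-- The transposed system. -/
def adj (T : GardingTriple V H) : GardingTriple V H where
  emb := T.emb
  emb_denseRange := T.emb_denseRange
  A := ContinuousLinearMap.adjoint T.A
  α₀ := T.α₀
  ω₀ := T.ω₀
  α₀_pos := T.α₀_pos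
  ω₀_nonneg := T.ω₀_nonneg
  garding := fun v => by
    rw [ContinuousLinearMap.adjoint_inner_left, real_inner_comm]
    exact T.garding v

/-- `κ` dominates the constants in the energy estimates. -/
structure Dominates (T : GardingTriple V H) (ν κ : ℝ) : Prop where
  pos : 0 < ν
  one_le : 1 ≤ κ
  exp_le : Real.exp (2 * (ν * T.ω₀)) ≤ κ
  exp_le_mul : Real.exp (2 * (ν * T.ω₀)) ≤ κ * (ν * T.α₀)

/-- One `κ` serves a whole compact parameter interval; all later bounds that are uniform in `ν` rest
on this. -/
theorem exists_dominates (T : GardingTriple V H) {a b : ℝ} (ha : 0 < a) :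
    ∃ κ, ∀ ν ∈ Icc a b, T.Dominates ν κ := by
  refine ⟨max (max 1 (Real.exp (2 * (b * T.ω₀)))) (Real.exp (2 * (b * T.ω₀)) / (a * T.α₀)),
    fun ν hν => ⟨ha.trans_le hν.1, ?_, ?_, ?_⟩⟩
  · exact (le_max_left _ _).trans (le_max_left _ _)
  · refine le_trans ?_ ((le_max_right _ _).trans (le_max_left _ _))
    have := mul_le_mul_of_nonneg_right hν.2 T.ω₀_nonneg
    exact Real.exp_le_exp.2 (by linarith)
  · have h1 := mul_le_mul_of_nonneg_right hν.2 T.ω₀_nonneg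
    have h2 : Real.exp (2 * (ν * T.ω₀)) ≤ Real.exp (2 * (b * T.ω₀)) :=
      Real.exp_le_exp.2 (by linarith)
    have h3 : 0 < a * T.α₀ := mul_pos ha T.α₀_pos
    have h4 : a * T.α₀ ≤ ν * T.α₀ := mul_le_mul_of_nonneg_right hν.1 T.α₀_pos.le
    calc Real.exp (2 * (ν * T.ω₀)) ≤ Real.exp (2 * (b * T.ω₀)) := h2
      _ = Real.exp (2 * (b * T.ω₀)) / (a * T.α₀) * (a * T.α₀) := (div_mul_cancel₀ _ h3.ne').symm
      _ ≤ _ := mul_le_mul (le_max_right _ _) h4 h3.le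
        (le_trans zero_le_one ((le_max_left _ _).trans (le_max_left _ _)))

/-- Differentiate `exp(-k t) ‖y(t)‖²_H` with `k = 2νω₀`: the derivative of the weight cancels the
lower order term of Garding's inequality, so no separate Gronwall argument is needed. -/
theorem energy_inequality (T : GardingTriple V H) {ν : ℝ} (hν : 0 ≤ ν) {y w : ℝ → V}
    (hy : Continuous y) (hw : Continuous w) (hd : ∀ t ∈ Ioo (0 : ℝ) 1, HasDerivAt y (w t) t)
    {t : ℝ} (ht : t ∈ Icc (0 : ℝ) 1) :
    Real.exp (-(2 * (ν * T.ω₀)) * t) * ‖T.emb (y t)‖ ^ 2 +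
        2 * (ν * T.α₀) * ∫ s in (0 : ℝ)..t, Real.exp (-(2 * (ν * T.ω₀)) * s) * ‖y s‖ ^ 2 ≤
      ‖T.emb (y 0)‖ ^ 2 + 2 * ∫ s in (0 : ℝ)..t, Real.exp (-(2 * (ν * T.ω₀)) * s) *
        inner ℝ (T.gram (w s) + ν • T.A (y s)) (y s) := by
  set k := 2 * (ν * T.ω₀) with hk
  set θ : ℝ → ℝ := fun s => Real.exp (-k * s) * ‖T.emb (y s)‖ ^ 2 with hθ
  set θ' : ℝ → ℝ := fun s => Real.exp (-k * s) * (-k) * ‖T.emb (y s)‖ ^ 2 +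
    Real.exp (-k * s) * (2 * inner ℝ (T.emb (y s)) (T.emb (w s))) with hθ'
  have hcθ' : Continuous θ' := by fun_prop
  have hder : ∀ s ∈ Ioo (0 : ℝ) t, HasDerivAt θ (θ' s) s := by
    intro s hs
    have h1 : HasDerivAt (fun s => Real.exp (-k * s)) (Real.exp (-k * s) * (-k)) s := by
      simpa using ((hasDerivAt_id s).const_mul (-k)).exp
    have h2 : HasDerivAt (fun s => T.emb (y s)) (T.emb (w s)) s :=
      T.emb.hasFDerivAt.comp_hasDerivAt s (hd s ⟨hs.1, hs.2.trans_le ht.2⟩)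
    exact h1.mul h2.norm_sq
  have hint : ∫ s in (0 : ℝ)..t, θ' s = θ t - θ 0 :=
    intervalIntegral.integral_eq_sub_of_hasDerivAt_of_le ht.1 (by fun_prop) hder
      (hcθ'.intervalIntegrable _ _)
  have hle : ∫ s in (0 : ℝ)..t, θ' s ≤ ∫ s in (0 : ℝ)..t, (2 * (Real.exp (-k * s) *
      inner ℝ (T.gram (w s) + ν • T.A (y s)) (y s)) -
        2 * (ν * T.α₀) * (Real.exp (-k * s) * ‖y s‖ ^ 2)) := by
    refine intervalIntegral.integral_mono_on ht.1 (hcθ'.intervalIntegrable _ _)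
      (Continuous.intervalIntegrable (by fun_prop) _ _) fun s _ => ?_
    have hg := mul_le_mul_of_nonneg_left (T.garding (y s)) hν
    have he := Real.exp_pos (-k * s)
    rw [inner_add_left, T.inner_gram, real_inner_smul_left, real_inner_comm (T.emb (y s))]
    simp only [hθ']
    have : 0 ≤ 2 * Real.exp (-k * s) * (ν * (inner ℝ (T.A (y s)) (y s) +
      T.ω₀ * ‖T.emb (y s)‖ ^ 2) - ν * (T.α₀ * ‖y s‖ ^ 2)) := by
      have := sub_nonneg.2 hg
      positivity
    generalize Real.exp (-k * s) = E at *
    rw [hk]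
    linarith
  rw [hint, intervalIntegral.integral_sub (Continuous.intervalIntegrable (by fun_prop) _ _)
    (Continuous.intervalIntegrable (by fun_prop) _ _), intervalIntegral.integral_const_mul,
    intervalIntegral.integral_const_mul] at hle
  simp only [hθ, mul_zero, Real.exp_zero, one_mul] at hle
  linarith

theorem energy_bounds (T : GardingTriple V H) {ν κ : ℝ} (hκ : T.Dominates ν κ) {y w : ℝ → V}
    (hy : Continuous y) (hw : Continuous w) (hd : ∀ t ∈ Ioo (0 : ℝ) 1, HasDerivAt y (w t) t)
    {f z : TimeL2 V} (hf : f =ᵐ[timeMeasure] fun t => T.gram (w t) + ν • T.A (y t))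
    (hz : z =ᵐ[timeMeasure] y) :
    ‖z‖ ≤ 2 * κ * (‖T.emb (y 0)‖ + ‖f‖) ∧
      ∀ t ∈ Icc (0 : ℝ) 1, ‖T.emb (y t)‖ ≤ 2 * κ * (‖T.emb (y 0)‖ + ‖f‖) := by
  set k := 2 * (ν * T.ω₀) with hk
  have hk0 : 0 ≤ k := by
    have := mul_nonneg hκ.pos.le T.ω₀_nonneg
    linarith
  set c := ‖T.emb (y 0)‖
  have hc0 : 0 ≤ c := norm_nonneg _
  set b : ℝ → ℝ := fun s => inner ℝ (T.gram (w s) + ν • T.A (y s)) (y s) with hb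
  have hbc : Continuous b := by fun_prop
  have hrhs : ∀ t ∈ Icc (0 : ℝ) 1, ∫ s in (0 : ℝ)..t, Real.exp (-k * s) * b s ≤ ‖f‖ * ‖z‖ := by
    intro t ht
    refine le_trans ?_ (integral_norm_mul_norm_le f z)
    have h1 : ∫ s, ‖f s‖ * ‖z s‖ ∂timeMeasure =
        ∫ s, ‖T.gram (w s) + ν • T.A (y s)‖ * ‖y s‖ ∂timeMeasure := by
      refine integral_congr_ae ?_
      filter_upwards [hf, hz] with s h1 h2
      rw [h1, h2]
    rw [h1, integral_timeMeasure_eq_interval]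
    have hcont : Continuous fun s => ‖T.gram (w s) + ν • T.A (y s)‖ * ‖y s‖ := by fun_prop
    refine (intervalIntegral.integral_mono_on (g := fun s =>
      ‖T.gram (w s) + ν • T.A (y s)‖ * ‖y s‖) ht.1
      (Continuous.intervalIntegrable (by fun_prop) _ _) (hcont.intervalIntegrable _ _) ?_).trans ?_
    · intro s hs
      have h2 : Real.exp (-k * s) ≤ 1 := by
        rw [Real.exp_le_one_iff]
        have := mul_nonneg hk0 hs.1
        linarith
      have h3 : b s ≤ ‖T.gram (w s) + ν • T.A (y s)‖ * ‖y s‖ := real_inner_le_norm _ _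
      calc Real.exp (-k * s) * b s ≤ Real.exp (-k * s) * (‖T.gram (w s) + ν • T.A (y s)‖ * ‖y s‖) :=
            mul_le_mul_of_nonneg_left h3 (Real.exp_pos _).le
        _ ≤ 1 * (‖T.gram (w s) + ν • T.A (y s)‖ * ‖y s‖) :=
            mul_le_mul_of_nonneg_right h2 (by positivity)
        _ = _ := one_mul _
    · refine intervalIntegral.integral_mono_interval le_rfl ht.1 ht.2
        (Eventually.of_forall fun s => by positivity) (hcont.intervalIntegrable _ _)
  have hexp1 : ∀ s ∈ Icc (0 : ℝ) 1, 1 ≤ Real.exp k * Real.exp (-k * s) := by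
    intro s hs
    rw [← Real.exp_add, Real.one_le_exp_iff]
    have := mul_le_mul_of_nonneg_left hs.2 hk0
    linarith
  have hz2 : ‖z‖ ^ 2 = ∫ s in (0 : ℝ)..1, ‖y s‖ ^ 2 := by
    rw [norm_sq_timeL2, ← integral_timeMeasure_eq_interval]
    refine integral_congr_ae ?_
    filter_upwards [hz] with s h
    rw [h]
  have hE := Real.exp_pos k
  have hαν : 0 < ν * T.α₀ := mul_pos hκ.pos T.α₀_pos
  have hκ0 : 0 < κ := one_pos.trans_le hκ.one_le
  have hI : 2 * (ν * T.α₀) * ‖z‖ ^ 2 ≤ Real.exp k * (c ^ 2 + 2 * (‖f‖ * ‖z‖)) := by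
    have h1 := T.energy_inequality hκ.pos.le hy hw hd (t := 1) ⟨zero_le_one, le_rfl⟩
    have h2 := hrhs 1 ⟨zero_le_one, le_rfl⟩
    have h3 : ‖z‖ ^ 2 ≤ Real.exp k * ∫ s in (0 : ℝ)..1, Real.exp (-k * s) * ‖y s‖ ^ 2 := by
      rw [hz2, ← intervalIntegral.integral_const_mul]
      refine intervalIntegral.integral_mono_on zero_le_one
        (Continuous.intervalIntegrable (by fun_prop) _ _)
        (Continuous.intervalIntegrable (by fun_prop) _ _) fun s hs => ?_
      rw [← mul_assoc]
      exact le_mul_of_one_le_left (by positivity) (hexp1 s hs)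
    have h4 : 0 ≤ Real.exp (-k * 1) * ‖T.emb (y 1)‖ ^ 2 := by positivity
    have h5 : 2 * (ν * T.α₀) * (∫ s in (0 : ℝ)..1, Real.exp (-k * s) * ‖y s‖ ^ 2) ≤
        c ^ 2 + 2 * (‖f‖ * ‖z‖) := by linarith
    calc 2 * (ν * T.α₀) * ‖z‖ ^ 2 ≤ 2 * (ν * T.α₀) *
          (Real.exp k * ∫ s in (0 : ℝ)..1, Real.exp (-k * s) * ‖y s‖ ^ 2) :=
          mul_le_mul_of_nonneg_left h3 (by positivity)
      _ = Real.exp k * (2 * (ν * T.α₀) *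
          ∫ s in (0 : ℝ)..1, Real.exp (-k * s) * ‖y s‖ ^ 2) := by ring
      _ ≤ _ := mul_le_mul_of_nonneg_left h5 hE.le
  have hf0 := norm_nonneg f
  have hz0 := norm_nonneg z
  have hI2 : 2 * ‖z‖ ^ 2 ≤ κ * (c ^ 2 + 2 * (‖f‖ * ‖z‖)) := by
    have h1 : Real.exp k * (c ^ 2 + 2 * (‖f‖ * ‖z‖)) ≤
        κ * (ν * T.α₀) * (c ^ 2 + 2 * (‖f‖ * ‖z‖)) :=
      mul_le_mul_of_nonneg_right hκ.exp_le_mul (by positivity)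
    refine le_of_mul_le_mul_left (a := ν * T.α₀) ?_ hαν
    linarith
  -- If this failed, then `c ≤ ‖z‖`, and `2‖z‖² ≤ κ(c² + 2‖f‖‖z‖) ≤ 2κ(c + ‖f‖)‖z‖` would bound
  -- `‖z‖` by half of the claimed value.
  have hfirst : ‖z‖ ≤ 2 * κ * (c + ‖f‖) := by
    by_contra! hlt
    have hcz : c ≤ ‖z‖ := by nlinarith [hκ.one_le]
    have h1 : c ^ 2 ≤ c * ‖z‖ := by nlinarith
    have h2 : κ * (c ^ 2 + 2 * (‖f‖ * ‖z‖)) ≤ κ * (2 * (c + ‖f‖)) * ‖z‖ := by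
      have : c ^ 2 + 2 * (‖f‖ * ‖z‖) ≤ 2 * (c + ‖f‖) * ‖z‖ := by nlinarith
      nlinarith
    have hzpos : 0 < ‖z‖ := lt_of_le_of_lt (by positivity) hlt
    nlinarith
  refine ⟨hfirst, fun t ht => ?_⟩
  have h1 := T.energy_inequality hκ.pos.le hy hw hd ht
  have h2 := hrhs t ht
  have h3 : 0 ≤ ∫ s in (0 : ℝ)..t, Real.exp (-k * s) * ‖y s‖ ^ 2 :=
    intervalIntegral.integral_nonneg ht.1 fun s _ => by positivity
  have h4 : Real.exp (-k * t) * ‖T.emb (y t)‖ ^ 2 ≤ c ^ 2 + 2 * (‖f‖ * ‖z‖) := by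
    have := mul_nonneg (mul_nonneg zero_le_two hαν.le) h3
    linarith
  have h5 : ‖T.emb (y t)‖ ^ 2 ≤ κ * (c ^ 2 + 2 * (‖f‖ * ‖z‖)) := by
    calc ‖T.emb (y t)‖ ^ 2 ≤ (Real.exp k * Real.exp (-k * t)) * ‖T.emb (y t)‖ ^ 2 :=
          le_mul_of_one_le_left (by positivity) (hexp1 t ht)
      _ = Real.exp k * (Real.exp (-k * t) * ‖T.emb (y t)‖ ^ 2) := by ring
      _ ≤ Real.exp k * (c ^ 2 + 2 * (‖f‖ * ‖z‖)) := mul_le_mul_of_nonneg_left h4 hE.le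
      _ ≤ _ := mul_le_mul_of_nonneg_right hκ.exp_le (by positivity)
  have h6 : c ^ 2 + 2 * (‖f‖ * ‖z‖) ≤ 4 * κ * (c + ‖f‖) ^ 2 := by
    have : ‖f‖ * ‖z‖ ≤ ‖f‖ * (2 * κ * (c + ‖f‖)) := mul_le_mul_of_nonneg_left hfirst hf0
    nlinarith [hκ.one_le, mul_nonneg hc0 hf0, mul_nonneg hκ0.le (mul_nonneg hc0 hf0),
      mul_nonneg hκ0.le (sq_nonneg c), mul_nonneg (sub_nonneg.2 hκ.one_le) (sq_nonneg c)]
  refine abs_le_of_sq_le_sq' ?_ (by positivity) |>.2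
  calc ‖T.emb (y t)‖ ^ 2 ≤ κ * (4 * κ * (c + ‖f‖) ^ 2) :=
        h5.trans (mul_le_mul_of_nonneg_left h6 hκ0.le)
    _ = (2 * κ * (c + ‖f‖)) ^ 2 := by ring

/-- The operator `y' ↦ y' + ν A y` for `y = ∫₀ᵗ y'`. -/
def paraOp (T : GardingTriple V H) (ν : ℝ) : TimeL2 V →L[ℝ] TimeL2 V :=
  lift T.gram + ν • (lift T.A).comp (volterra V)

theorem paraOp_apply (T : GardingTriple V H) (ν : ℝ) (w : TimeL2 V) :
    T.paraOp ν w = lift T.gram w + ν • lift T.A (volterra V w) := rfl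

theorem coeFn_paraOp (T : GardingTriple V H) (ν : ℝ) (w : TimeL2 V) :
    T.paraOp ν w =ᵐ[timeMeasure] fun t => T.gram (w t) + ν • T.A (prim w t) := by
  rw [paraOp_apply]
  filter_upwards [Lp.coeFn_add (lift T.gram w) (ν • lift T.A (volterra V w)), coeFn_lift T.gram w,
    Lp.coeFn_smul ν (lift T.A (volterra V w)), coeFn_lift T.A (volterra V w), coeFn_volterra w]
    with t h1 h2 h3 h4 h5
  rw [h1, Pi.add_apply, h2, h3, Pi.smul_apply, h4, h5]

/-- This gives `paraOp` a second role. Applied to `y` instead of `y'`, it expresses the equation `y'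
+ ν A y = f`, `y(0) = c` integrated once, namely `paraOp ν y = K f + embAdj c`, in which no time
derivative occurs. -/
theorem volterra_paraOp (T : GardingTriple V H) (ν : ℝ) (w : TimeL2 V) :
    volterra V (T.paraOp ν w) = T.paraOp ν (volterra V w) := by
  simp only [paraOp_apply, map_add, map_smul, volterra_lift]

/-- The energy estimate controls `y = K w` and not `y' = w`. It applies to continuous `w`, which are
dense. -/
theorem norm_volterra_le (T : GardingTriple V H) {ν κ : ℝ} (hκ : T.Dominates ν κ) (w : TimeL2 V) :
    ‖volterra V w‖ ≤ 2 * κ * ‖T.paraOp ν w‖ := by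
  refine denseRange_bcfL2.induction_on (p := fun w : TimeL2 V =>
    ‖volterra V w‖ ≤ 2 * κ * ‖T.paraOp ν w‖) w (isClosed_le (by fun_prop) (by fun_prop)) ?_
  intro f
  have hp : prim (bcfL2 V f) = prim f := prim_congr (coeFn_bcfL2 f)
  have h := (T.energy_bounds hκ (y := prim f) (w := f)
    (continuous_prim (continuous_integrable f.continuous)) f.continuous
    (fun t ht => hasDerivAt_prim f.continuous ht) (f := T.paraOp ν (bcfL2 V f))
    (z := volterra V (bcfL2 V f)) ?_ ?_).1
  · simpa [prim_zero] using h
  · filter_upwards [T.coeFn_paraOp ν (bcfL2 V f), coeFn_bcfL2 f] with t h1 h2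
    rw [h1, h2, hp]
  · rw [← hp]; exact coeFn_volterra _

theorem paraOp_injective (T : GardingTriple V H) {ν : ℝ} (hν : 0 < ν) :
    Function.Injective (T.paraOp ν) := by
  obtain ⟨κ, hκ⟩ := T.exists_dominates (b := ν) hν
  rw [injective_iff_map_eq_zero]
  intro w hw
  have h := T.norm_volterra_le (hκ ν ⟨le_rfl, le_rfl⟩) w
  rw [hw, norm_zero, mul_zero] at h
  exact volterra_injective (by rw [map_zero]; exact norm_le_zero_iff.1 h)

/-- The transpose of `paraOp`. -/
def paraOpAdj (T : GardingTriple V H) (ν : ℝ) : TimeL2 V →L[ℝ] TimeL2 V :=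
  (reflect V).comp ((T.adj.paraOp ν).comp (reflect V))

theorem paraOpAdj_apply (T : GardingTriple V H) (ν : ℝ) (w : TimeL2 V) :
    T.paraOpAdj ν w = reflect V (T.adj.paraOp ν (reflect V w)) := rfl

theorem inner_paraOp (T : GardingTriple V H) (ν : ℝ) (u w : TimeL2 V) :
    inner ℝ (T.paraOp ν u) w = inner ℝ u (T.paraOpAdj ν w) := by
  have hg : ContinuousLinearMap.adjoint T.gram = T.gram := by
    simp [gram, embAdj, ContinuousLinearMap.adjoint_comp]
  rw [paraOpAdj_apply, paraOp_apply, paraOp_apply, inner_add_left, real_inner_smul_left, map_add,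
    map_smul, inner_add_right, real_inner_smul_right, inner_lift, inner_lift, inner_volterra, hg]
  have h1 : reflect V (lift T.adj.gram (reflect V w)) = lift T.gram w := by
    rw [reflect_lift, reflect_reflect]; rfl
  have h2 : reflect V (lift T.adj.A (volterra V (reflect V w))) =
      reflect V (volterra V (reflect V (lift (ContinuousLinearMap.adjoint T.A) w))) := by
    rw [reflect_lift (ContinuousLinearMap.adjoint T.A), volterra_lift]; rfl
  rw [h1, h2]

theorem denseRange_paraOpAdj (T : GardingTriple V H) {ν : ℝ} (hν : 0 < ν) :
    DenseRange (T.paraOpAdj ν) := by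
  have h : (LinearMap.range (T.paraOpAdj ν).toLinearMap).topologicalClosure = ⊤ := by
    rw [Submodule.topologicalClosure_eq_top_iff, Submodule.eq_bot_iff]
    intro w hw
    rw [Submodule.mem_orthogonal'] at hw
    refine T.paraOp_injective hν ?_
    rw [map_zero, ← inner_self_eq_zero (𝕜 := ℝ), inner_paraOp]
    exact hw _ ⟨_, rfl⟩
  intro x
  have := Submodule.mem_top (R := ℝ) (x := x)
  rw [← h] at this
  exact this

/-- Existence by duality. The energy estimate for the transposed system reads `‖K* w‖ ≤ 2κ ‖paraOp*
w‖`, so `paraOp* w ↦ K* w` is well defined and extends boundedly from a dense subspace. The adjoint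
of this extension is `G`. -/
theorem exists_rightInverse (T : GardingTriple V H) {ν : ℝ} (hν : 0 < ν) :
    ∃ G : TimeL2 V →L[ℝ] TimeL2 V, ∀ g, T.paraOp ν (G g) = volterra V g := by
  obtain ⟨κ, hκ⟩ := T.adj.exists_dominates (b := ν) hν
  set Kt : TimeL2 V →L[ℝ] TimeL2 V := (reflect V).comp ((volterra V).comp (reflect V)) with hKt
  have hb : ∀ w, ‖Kt w‖ ≤ 2 * κ * ‖T.paraOpAdj ν w‖ := by
    intro w
    have := T.adj.norm_volterra_le (hκ ν ⟨le_rfl, le_rfl⟩) (reflect V w)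
    rw [paraOpAdj_apply, norm_reflect]
    simpa [hKt, norm_reflect] using this
  refine ⟨ContinuousLinearMap.adjoint
    (Kt.toLinearMap.extendOfNorm (T.paraOpAdj ν).toLinearMap), fun g => ?_⟩
  refine ext_inner_right ℝ fun u => ?_
  rw [inner_paraOp, ContinuousLinearMap.adjoint_inner_left, inner_volterra]
  congr 1
  exact LinearMap.extendOfNorm_eq (f := Kt.toLinearMap) (e := (T.paraOpAdj ν).toLinearMap)
    (T.denseRange_paraOpAdj hν) ⟨_, hb⟩ u

end GardingTriple
end Parabolic

end

/-! ### The solution operator, its duality with the backward equation and its dependence on `ν` -/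

noncomputable section

namespace Parabolic

variable {V H : Type*}
  [NormedAddCommGroup V] [InnerProductSpace ℝ V] [CompleteSpace V]
  [NormedAddCommGroup H] [InnerProductSpace ℝ H] [CompleteSpace H]

/-- Constant functions as bounded continuous functions. -/
def constB (E : Type*) [NormedAddCommGroup E] [InnerProductSpace ℝ E] :
    E →L[ℝ] BoundedContinuousFunction ℝ E :=
  LinearMap.mkContinuous
    { toFun := fun c => BoundedContinuousFunction.const ℝ c
      map_add' := fun _ _ => rfl
      map_smul' := fun _ _ => rfl } 1
    (fun c => by rw [one_mul]; exact BoundedContinuousFunction.norm_const_le c)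

namespace GardingTriple

/-- The defining properties of the solution operator of `y' + ν A y = f`, `y(0) = c`, which maps
`(f, c)` to `y`, as an element of `L²((0,1); V)` and as a continuous function with values in `H`. -/
structure IsSolver (T : GardingTriple V H) (ν : ℝ)
    (S : TimeL2 V × H →L[ℝ] TimeL2 V × BoundedContinuousFunction ℝ H) : Prop where
  paraOp_eq : ∀ f c, T.paraOp ν (S (f, c)).1 = volterra V f + constT V (T.embAdj c)
  lift_emb : ∀ x, lift T.emb (S x).1 = bcfL2 H (S x).2
  apply_zero : ∀ f c, (S (f, c)).2 0 = c
  norm_le : ∀ κ, T.Dominates ν κ → ∀ x, ‖S x‖ ≤ 4 * κ * ‖x‖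
  duality : ∀ f q p₁ p, T.paraOpAdj ν p =
      constT V (T.embAdj p₁) + reflect V (volterra V (reflect V q)) →
    inner ℝ ((S (f, 0)).2 1) p₁ + inner ℝ q (S (f, 0)).1 = inner ℝ f p

theorem inner_emb_right (T : GardingTriple V H) (v : V) (h : H) :
    inner ℝ (T.emb v) h = inner ℝ v (T.embAdj h) :=
  (ContinuousLinearMap.adjoint_inner_right _ _ _).symm

theorem exists_solver (T : GardingTriple V H) {ν : ℝ} (hν : 0 < ν) :
    ∃ S, T.IsSolver ν S := by
  obtain ⟨G, hG⟩ := T.exists_rightInverse hν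
  -- Regular solutions: `y = v + K K G g` has the continuous derivative `K G g`, so the energy
  -- estimate applies to it. It solves the equation with `f = K K g + ν A v` and `y(0) = v`, and
  -- such data are dense. The solution operator is the bounded extension of data to solution.
  set data : TimeL2 V × V →L[ℝ] TimeL2 V × H :=
    (((volterra V).comp ((volterra V).comp (ContinuousLinearMap.fst ℝ _ _))) +
      ν • (lift T.A).comp ((constT V).comp (ContinuousLinearMap.snd ℝ _ _))).prod
    (T.emb.comp (ContinuousLinearMap.snd ℝ _ _)) with hdata
  have data_apply : ∀ g v, data (g, v) =
      (volterra V (volterra V g) + ν • lift T.A (constT V v), T.emb v) := fun g v => rfl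
  set sol : TimeL2 V × V →L[ℝ] TimeL2 V × BoundedContinuousFunction ℝ H :=
    ((constT V).comp (ContinuousLinearMap.snd ℝ _ _) +
      (volterra V).comp ((volterra V).comp (G.comp (ContinuousLinearMap.fst ℝ _ _)))).prod
    ((T.emb.compLeftContinuousBounded ℝ).comp
      ((constB V).comp (ContinuousLinearMap.snd ℝ _ _) +
        (primB V).comp ((volterra V).comp (G.comp (ContinuousLinearMap.fst ℝ _ _))))) with hsol
  have sol_fst : ∀ g v, (sol (g, v)).1 = constT V v + volterra V (volterra V (G g)) :=
    fun g v => rfl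
  have sol_snd : ∀ g v t, (sol (g, v)).2 t = T.emb (v + prim (volterra V (G g)) t) :=
    fun g v t => rfl
  have hdense : DenseRange data := by
    have hKK : DenseRange (fun g => volterra V (volterra V g)) :=
      (denseRange_volterra (E := V)).comp denseRange_volterra (volterra V).continuous
    rw [DenseRange, dense_iff_closure_eq, eq_univ_iff_forall]
    rintro ⟨f, c⟩
    have h1 : ∀ v : V, ∀ f : TimeL2 V, (f, T.emb v) ∈ closure (range data) := by
      intro v f
      have h2 := hKK (f - ν • lift T.A (constT V v))
      have h3 : Continuous fun x : TimeL2 V => (x + ν • lift T.A (constT V v), T.emb v) := by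
        fun_prop
      have h4 := map_mem_closure h3 h2 (t := range data) ?_
      · simpa using h4
      · rintro _ ⟨g, rfl⟩
        exact ⟨(g, v), data_apply g v⟩
    have h5 : Continuous fun c : H => (f, c) := by fun_prop
    have h6 := map_mem_closure h5 (T.emb_denseRange c) (t := closure (range data)) ?_
    · rwa [closure_closure] at h6
    · rintro _ ⟨v, rfl⟩
      exact h1 v f
  have hdata1 : ∀ g v, (data (g, v)).1 = T.paraOp ν (volterra V (G g)) +
      ν • lift T.A (constT V v) := by
    intro g v
    rw [data_apply, ← volterra_paraOp, hG]
  have hbound : ∀ κ, T.Dominates ν κ → ∀ x, ‖sol x‖ ≤ 4 * κ * ‖data x‖ := by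
    rintro κ hκ ⟨g, v⟩
    have hint : Integrable (volterra V (G g)) timeMeasure := integrable_timeL2 _
    have hpp : prim (volterra V (G g)) = prim (prim (G g)) := prim_congr (coeFn_volterra (G g))
    have hw : Continuous (prim (G g)) := continuous_prim (integrable_timeL2 _)
    have hEB := T.energy_bounds hκ (y := fun t => v + prim (volterra V (G g)) t)
      (w := prim (G g)) (continuous_const.add (continuous_prim hint)) hw
      (fun t ht => by rw [hpp]; exact (hasDerivAt_prim hw ht).const_add v)
      (f := (data (g, v)).1) (z := (sol (g, v)).1) ?_ ?_
    · obtain ⟨h1, h2⟩ := hEB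
      have h3 : ‖T.emb (v + prim (volterra V (G g)) 0)‖ + ‖(data (g, v)).1‖ ≤
          2 * ‖data (g, v)‖ := by
        have h4 : ‖T.emb v‖ ≤ ‖data (g, v)‖ := norm_snd_le (data (g, v))
        have h5 := norm_fst_le (data (g, v))
        rw [prim_zero, add_zero]
        linarith
      have hκ0 : 0 < κ := one_pos.trans_le hκ.one_le
      have h6 : 2 * κ * (‖T.emb (v + prim (volterra V (G g)) 0)‖ + ‖(data (g, v)).1‖) ≤
          4 * κ * ‖data (g, v)‖ := by nlinarith
      refine max_le (h1.trans h6) ?_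
      rw [BoundedContinuousFunction.norm_le (by positivity)]
      intro t
      rw [sol_snd]
      rcases le_total t 0 with ht | ht
      · rw [prim_eq_of_nonpos _ hint ht]
        exact (h2 0 ⟨le_rfl, zero_le_one⟩).trans h6
      · rcases le_total t 1 with ht1 | ht1
        · exact (h2 t ⟨ht, ht1⟩).trans h6
        · rw [prim_eq_of_one_le _ hint ht1]
          exact (h2 1 ⟨zero_le_one, le_rfl⟩).trans h6
    · rw [hdata1]
      filter_upwards [Lp.coeFn_add (T.paraOp ν (volterra V (G g))) (ν • lift T.A (constT V v)),
        T.coeFn_paraOp ν (volterra V (G g)), Lp.coeFn_smul ν (lift T.A (constT V v)),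
        coeFn_lift T.A (constT V v), coeFn_constT v, coeFn_volterra (G g)] with t h1 h2 h3 h4 h5 h6
      rw [h1, Pi.add_apply, h2, h3, Pi.smul_apply, h4, h5, h6, map_add, smul_add]
      abel
    · rw [sol_fst]
      filter_upwards [Lp.coeFn_add (constT V v) (volterra V (volterra V (G g))),
        coeFn_constT v, coeFn_volterra (volterra V (G g))] with t h1 h2 h3
      rw [h1, Pi.add_apply, h2, h3]
  obtain ⟨κ₀, hκ₀⟩ := T.exists_dominates (b := ν) hν
  replace hκ₀ := hκ₀ ν ⟨le_rfl, le_rfl⟩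
  set S := sol.toLinearMap.extendOfNorm data.toLinearMap with hS
  have hSd : ∀ x, S (data x) = sol x := fun x =>
    LinearMap.extendOfNorm_eq (f := sol.toLinearMap) (e := data.toLinearMap) hdense
      ⟨_, hbound κ₀ hκ₀⟩ x
  -- Closed properties only need to be checked on the regular solutions.
  have ind : ∀ P : TimeL2 V × H → Prop, IsClosed {x | P x} → (∀ g v, P (data (g, v))) → ∀ x, P x :=
    fun P hP h x => hdense.induction_on x hP fun a => h a.1 a.2
  refine ⟨S, ⟨fun f c => ?_, ind _ (isClosed_eq (by fun_prop) (by fun_prop)) fun g v => ?_,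
    fun f c => ?_, fun κ hκ x => ?_, fun f q p₁ p hp => ?_⟩⟩
  · refine ind (fun x => T.paraOp ν (S x).1 = volterra V x.1 + constT V (T.embAdj x.2))
      (isClosed_eq (by fun_prop) (by fun_prop)) (fun g v => ?_) (f, c)
    rw [hSd, sol_fst, map_add, ← volterra_paraOp, ← volterra_paraOp, hG, data_apply, map_add,
      map_smul, volterra_lift, paraOp_apply, lift_constT]
    simp only [gram, ContinuousLinearMap.comp_apply]
    abel
  · rw [hSd, sol_fst]
    refine Lp.ext ?_
    filter_upwards [coeFn_lift T.emb (constT V v + volterra V (volterra V (G g))),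
      Lp.coeFn_add (constT V v) (volterra V (volterra V (G g))),
      coeFn_constT v, coeFn_volterra (volterra V (G g)), coeFn_bcfL2 (sol (g, v)).2]
      with t h1 h2 h3 h4 h5
    rw [h1, h2, Pi.add_apply, h3, h4, h5, sol_snd]
  · refine ind (fun x => (S x).2 0 = x.2) (isClosed_eq ?_ (by fun_prop)) (fun g v => ?_) (f, c)
    · exact (BoundedContinuousFunction.evalCLM ℝ (0 : ℝ)).continuous.comp
        (continuous_snd.comp S.continuous)
    · rw [hSd, sol_snd, prim_zero, add_zero, data_apply]
  · exact LinearMap.norm_extendOfNorm_apply_le hdense _ (hbound κ hκ) x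
  · have hKK : DenseRange (fun g => volterra V (volterra V g)) :=
      (denseRange_volterra (E := V)).comp denseRange_volterra (volterra V).continuous
    refine hKK.induction_on (p := fun f => inner ℝ ((S (f, 0)).2 1) p₁ +
      inner ℝ q (S (f, 0)).1 = inner ℝ f p) f (isClosed_eq ?_ (by fun_prop)) fun g => ?_
    · have : Continuous fun f : TimeL2 V => (S (f, 0)).2 1 :=
        (BoundedContinuousFunction.evalCLM ℝ (1 : ℝ)).continuous.comp
        (continuous_snd.comp (S.continuous.comp (by fun_prop)))
      fun_prop
    -- With `y' = K G g` and `y(0) = 0`, the left side is `(y', embAdj p₁ + K* q)`. By the equation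
    -- for `p` this is `(y', paraOp* p) = (paraOp y', p) = (f, p)`.
    · have h0 : (volterra V (volterra V g), (0 : H)) = data (g, 0) := by
        rw [data_apply]; simp
      rw [h0, hSd, sol_fst, sol_snd, map_zero, zero_add, zero_add, T.inner_emb_right,
        ← timeMean_apply, real_inner_comm, ← inner_constT, real_inner_comm, real_inner_comm _ q,
        inner_volterra _ q, ← inner_add_right, ← hp, ← inner_paraOp, ← volterra_paraOp, hG]

/-- The solution operator of `y' + ν A y = f`, `y(0) = c`. -/
def solver (T : GardingTriple V H) (ν : ℝ) :
    TimeL2 V × H →L[ℝ] TimeL2 V × BoundedContinuousFunction ℝ H :=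
  if h : 0 < ν then (T.exists_solver h).choose else 0

theorem isSolver_solver (T : GardingTriple V H) {ν : ℝ} (hν : 0 < ν) :
    T.IsSolver ν (T.solver ν) := by
  rw [solver, dif_pos hν]
  exact (T.exists_solver hν).choose_spec

theorem solver_fst_eq_iff (T : GardingTriple V H) {ν : ℝ} (hν : 0 < ν) (f : TimeL2 V) (c : H)
    (y : TimeL2 V) :
    y = (T.solver ν (f, c)).1 ↔ T.paraOp ν y = volterra V f + constT V (T.embAdj c) := by
  rw [← (T.isSolver_solver hν).paraOp_eq f c]
  exact (T.paraOp_injective hν).eq_iff.symm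

/-- The solution `p` of `-p' + ν A* p = q`, `p(1) = p₁`, in `L²((0,1); V)`. -/
def adjSol (T : GardingTriple V H) (ν : ℝ) (q : TimeL2 V) (p₁ : H) : TimeL2 V :=
  reflect V (T.adj.solver ν (reflect V q, p₁)).1

theorem paraOpAdj_adjSol (T : GardingTriple V H) {ν : ℝ} (hν : 0 < ν) (q : TimeL2 V) (p₁ : H) :
    T.paraOpAdj ν (T.adjSol ν q p₁) =
      constT V (T.embAdj p₁) + reflect V (volterra V (reflect V q)) := by
  rw [paraOpAdj_apply, adjSol, reflect_reflect, (T.adj.isSolver_solver hν).paraOp_eq, map_add,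
    reflect_constT, add_comm]
  rfl

theorem duality (T : GardingTriple V H) {ν : ℝ} (hν : 0 < ν) (f q : TimeL2 V) (p₁ : H) :
    inner ℝ ((T.solver ν (f, 0)).2 1) p₁ + inner ℝ q (T.solver ν (f, 0)).1 =
      inner ℝ f (T.adjSol ν q p₁) :=
  (T.isSolver_solver hν).duality f q p₁ _ (T.paraOpAdj_adjSol hν q p₁)

theorem adj_dominates (T : GardingTriple V H) {ν κ : ℝ} (h : T.Dominates ν κ) :
    T.adj.Dominates ν κ := ⟨h.pos, h.one_le, h.exp_le, h.exp_le_mul⟩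

/-- The pairing equals `∫ (h, p)_H`, and the backward solution `p` is bounded in `H` uniformly in
time. Hence only the `L¹(0,1;H)` norm of `h` enters. -/
theorem abs_inner_lift_embAdj_adjSol_le (T : GardingTriple V H) {ν κ : ℝ} (hκ : T.Dominates ν κ)
    (h : TimeL2 H) (q : TimeL2 V) (p₁ : H) :
    |inner ℝ (lift T.embAdj h) (T.adjSol ν q p₁)| ≤
      (∫ t, ‖h t‖ ∂timeMeasure) * (4 * κ * max ‖q‖ ‖p₁‖) := by
  have hS := T.adj.isSolver_solver hκ.pos
  set x := T.adj.solver ν (reflect V q, p₁) with hx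
  have hn : ‖x.2‖ ≤ 4 * κ * max ‖q‖ ‖p₁‖ := by
    refine (norm_snd_le x).trans ((hS.norm_le κ (T.adj_dominates hκ) _).trans ?_)
    rw [Prod.norm_def, norm_reflect]
  have he : ContinuousLinearMap.adjoint T.embAdj = T.emb := by simp [embAdj]
  rw [inner_lift, he, adjSol, ← reflect_lift]
  have h1 : lift T.emb (T.adj.solver ν (reflect V q, p₁)).1 = bcfL2 H x.2 := hS.lift_emb _
  rw [h1, inner_timeL2, ← integral_mul_const]
  refine (norm_integral_le_integral_norm _).trans (integral_mono_ae
    (L2.integrable_inner (𝕜 := ℝ) _ _).norm ((integrable_timeL2 h).norm.mul_const _) ?_)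
  filter_upwards [coeFn_reflect (bcfL2 H x.2),
    measurePreserving_reflect.quasiMeasurePreserving.ae (coeFn_bcfL2 x.2)] with t h2 h3
  rw [h2, h3]
  refine (norm_inner_le_norm _ _).trans (mul_le_mul_of_nonneg_left ?_ (norm_nonneg _))
  exact (x.2.norm_coe_le_norm _).trans hn

/-- Duality with the terminal value itself as final datum of the backward equation. The estimate in
the weak norm `L¹(0,1;H)` is what makes terminal states Lipschitz in the `L¹` distance of controls.
-/
theorem norm_solver_embAdj_terminal_le (T : GardingTriple V H) {ν κ : ℝ} (hκ : T.Dominates ν κ)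
    (h : TimeL2 H) :
    ‖(T.solver ν (lift T.embAdj h, 0)).2 1‖ ≤ 4 * κ * ∫ t, ‖h t‖ ∂timeMeasure := by
  set z := (T.solver ν (lift T.embAdj h, 0)).2 1
  have h1 := T.duality hκ.pos (lift T.embAdj h) 0 z
  have h2 := T.abs_inner_lift_embAdj_adjSol_le hκ h 0 z
  rw [← h1, inner_zero_left, add_zero, real_inner_self_eq_norm_sq, norm_zero,
    max_eq_right (norm_nonneg _), abs_of_nonneg (sq_nonneg _)] at h2
  rcases (norm_nonneg z).eq_or_lt with h0 | h0
  · rw [← h0]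
    have := one_pos.trans_le hκ.one_le
    positivity
  · refine le_of_mul_le_mul_right ?_ h0
    nlinarith

/-- Duality again, now with the solution itself as source of the backward equation. -/
theorem norm_solver_embAdj_fst_le (T : GardingTriple V H) {ν κ : ℝ} (hκ : T.Dominates ν κ)
    (h : TimeL2 H) :
    ‖(T.solver ν (lift T.embAdj h, 0)).1‖ ≤ 4 * κ * ∫ t, ‖h t‖ ∂timeMeasure := by
  set z := (T.solver ν (lift T.embAdj h, 0)).1
  have h1 := T.duality hκ.pos (lift T.embAdj h) z 0
  have h2 := T.abs_inner_lift_embAdj_adjSol_le hκ h z 0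
  rw [← h1, inner_zero_right, zero_add, real_inner_self_eq_norm_sq, norm_zero,
    max_eq_left (norm_nonneg _), abs_of_nonneg (sq_nonneg _)] at h2
  rcases (norm_nonneg z).eq_or_lt with h0 | h0
  · rw [← h0]
    have := one_pos.trans_le hκ.one_le
    positivity
  · refine le_of_mul_le_mul_right ?_ h0
    nlinarith

theorem eqOn_of_bcfL2_eq {Y Y' : BoundedContinuousFunction ℝ H} (h : bcfL2 H Y = bcfL2 H Y') :
    EqOn Y Y' (Icc 0 1) := by
  refine Measure.eqOn_Icc_of_ae_eq (μ := volume) zero_ne_one ?_ Y.continuous.continuousOn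
    Y'.continuous.continuousOn
  rw [Measure.restrict_congr_set Ioo_ae_eq_Icc.symm]
  filter_upwards [coeFn_bcfL2 Y, coeFn_bcfL2 Y'] with t h1 h2
  rw [← h1, ← h2, h]

/-- The resolvent identity for the solution operators. -/
theorem solver_sub_solver (T : GardingTriple V H) {μ ν : ℝ} (hμ : 0 < μ) (hν : 0 < ν)
    (f : TimeL2 V) (c : H) :
    (T.solver μ (f, c)).1 = (T.solver ν (f, c)).1 -
        (μ - ν) • (T.solver μ (lift T.A (T.solver ν (f, c)).1, 0)).1 ∧
      (T.solver μ (f, c)).2 1 = (T.solver ν (f, c)).2 1 -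
        (μ - ν) • (T.solver μ (lift T.A (T.solver ν (f, c)).1, 0)).2 1 := by
  have hSμ := T.isSolver_solver hμ
  have hSν := T.isSolver_solver hν
  have h1 : (T.solver μ (f, c)).1 = (T.solver ν (f, c)).1 -
        (μ - ν) • (T.solver μ (lift T.A (T.solver ν (f, c)).1, 0)).1 := by
    symm
    rw [T.solver_fst_eq_iff hμ, map_sub, map_smul, hSμ.paraOp_eq, map_zero, map_zero, add_zero]
    have h2 := hSν.paraOp_eq f c
    rw [← h2, paraOp_apply, paraOp_apply, volterra_lift, sub_smul]
    abel
  refine ⟨h1, ?_⟩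
  -- The identity in `L²(0,1;V)` passes to the continuous representatives in `H`, hence to the
  -- endpoint `1`.
  have h2 := eqOn_of_bcfL2_eq (Y := (T.solver μ (f, c)).2) (Y' := (T.solver ν (f, c)).2 -
    (μ - ν) • (T.solver μ (lift T.A (T.solver ν (f, c)).1, 0)).2) ?_
    (⟨zero_le_one, le_rfl⟩ : (1 : ℝ) ∈ Icc 0 1)
  · simpa using h2
  · rw [map_sub, map_smul, ← hSμ.lift_emb, ← hSν.lift_emb, ← hSμ.lift_emb, ← map_smul, ← map_sub,
      ← h1]

end GardingTriple
end Parabolic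

end

/-! ### The lemma of du Bois-Reymond and the Riesz map -/

noncomputable section

namespace Parabolic

section DuBoisReymond

variable {E : Type*} [NormedAddCommGroup E] [InnerProductSpace ℝ E]

theorem integrable_smul_of_continuous {φ : ℝ → ℝ} (hφ : Continuous φ) {w : ℝ → E}
    (hw : Integrable w timeMeasure) : Integrable (fun t => φ t • w t) timeMeasure := by
  obtain ⟨C, hC⟩ := (isCompact_Icc (a := (0 : ℝ)) (b := 1)).exists_bound_of_continuousOn
    hφ.continuousOn
  refine hw.bdd_smul C hφ.aestronglyMeasurable ?_
  filter_upwards [ae_restrict_mem measurableSet_Ioo] with x hx using hC x (Ioo_subset_Icc_self hx)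

theorem exists_primitive_of_integral_eq_zero {η : ℝ → ℝ} (hη : ContDiff ℝ ∞ η)
    (hc : HasCompactSupport η) (hs : tsupport η ⊆ Ioo 0 1)
    (h0 : ∫ t in (0 : ℝ)..1, η t = 0) :
    ∃ φ : ℝ → ℝ, ContDiff ℝ ∞ φ ∧ HasCompactSupport φ ∧ tsupport φ ⊆ Ioo 0 1 ∧ deriv φ = η := by
  obtain ⟨a, b, ha, hb, hab⟩ : ∃ a b : ℝ, 0 < a ∧ b < 1 ∧ tsupport η ⊆ Icc a b := by
    rcases (tsupport η).eq_empty_or_nonempty with h | h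
    · exact ⟨1 / 2, 1 / 2, by norm_num, by norm_num, by simp [h]⟩
    · obtain ⟨a, ha1, ha2⟩ := hc.isCompact.exists_isLeast h
      obtain ⟨b, hb1, hb2⟩ := hc.isCompact.exists_isGreatest h
      exact ⟨a, b, (hs ha1).1, (hs hb1).2, fun x hx => ⟨ha2 hx, hb2 hx⟩⟩
  have hz : ∀ t ∉ Icc a b, η t = 0 := fun t ht =>
    image_eq_zero_of_notMem_tsupport fun h => ht (hab h)
  have hcη := hη.continuous
  have hii : ∀ s t : ℝ, IntervalIntegrable η volume s t := fun s t => hcη.intervalIntegrable _ _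
  set φ : ℝ → ℝ := fun t => ∫ s in (0 : ℝ)..t, η s with hφ
  have hder : ∀ t, HasDerivAt φ (η t) t := fun t =>
    intervalIntegral.integral_hasDerivAt_right (hii _ _) (hcη.stronglyMeasurableAtFilter _ _)
      hcη.continuousAt
  have hderiv : deriv φ = η := funext fun t => (hder t).deriv
  have hφz : ∀ t ∉ Icc a b, φ t = 0 := by
    intro t ht
    rcases lt_or_ge t a with h | h
    · simp only [hφ]
      rw [intervalIntegral.integral_congr (g := fun _ => (0 : ℝ)), intervalIntegral.integral_zero]
      intro s hs'
      refine hz s fun hs'' => ?_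
      have := hs'.2.trans (max_le ha.le h.le |>.trans_eq rfl)
      rcases max_choice (0 : ℝ) t with h3 | h3
      · have := hs'.2; rw [h3] at this; linarith [hs''.1]
      · have := hs'.2; rw [h3] at this; linarith [hs''.1]
    · have hbt : b < t := by
        by_contra! h'
        exact ht ⟨h, h'⟩
      have h2 : ∫ s in (1 : ℝ)..t, η s = 0 := by
        rw [intervalIntegral.integral_congr (g := fun _ => (0 : ℝ)), intervalIntegral.integral_zero]
        intro s hs'
        refine hz s fun hs'' => ?_
        have h4 := hs'.1
        rcases min_choice (1 : ℝ) t with h3 | h3 <;> rw [h3] at h4 <;> linarith [hs''.2]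
      simp only [hφ]
      rw [← intervalIntegral.integral_add_adjacent_intervals (hii 0 1) (hii 1 t), h0, h2, add_zero]
  have hts : tsupport φ ⊆ Icc a b := by
    refine closure_minimal (fun t ht => ?_) isClosed_Icc
    by_contra h
    exact ht (hφz t h)
  refine ⟨φ, ?_, HasCompactSupport.intro isCompact_Icc fun t ht => hφz t ht,
    hts.trans (Icc_subset_Ioo ha hb), hderiv⟩
  rw [contDiff_infty_iff_deriv, hderiv]
  exact ⟨fun t => (hder t).differentiableAt, hη⟩

/-- The lemma of du Bois-Reymond. -/
theorem ae_eq_const_of_integral_deriv_smul_eq_zero [CompleteSpace E] {G : ℝ → E}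
    (hG : Integrable G timeMeasure)
    (h : ∀ φ : ℝ → ℝ, ContDiff ℝ ∞ φ → HasCompactSupport φ → tsupport φ ⊆ Ioo 0 1 →
      ∫ t, deriv φ t • G t ∂timeMeasure = 0) : ∃ c, ∀ᵐ t ∂timeMeasure, G t = c := by
  obtain ⟨θ, hθ, hθc, hθs, hθ1⟩ : ∃ θ : ℝ → ℝ, ContDiff ℝ ∞ θ ∧ HasCompactSupport θ ∧
      tsupport θ ⊆ Ioo 0 1 ∧ ∫ t in (0 : ℝ)..1, θ t = 1 := by
    let f : ContDiffBump (1 / 2 : ℝ) := ⟨1 / 8, 1 / 4, by norm_num, by norm_num⟩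
    have hs : tsupport (f.normed volume) ⊆ Ioo 0 1 := by
      rw [f.tsupport_normed_eq, Real.closedBall_eq_Icc]
      refine Icc_subset_Ioo ?_ ?_ <;> norm_num [f]
    refine ⟨f.normed volume, f.contDiff_normed, f.hasCompactSupport_normed, hs, ?_⟩
    rw [← integral_timeMeasure_eq_interval, timeMeasure,
      setIntegral_eq_integral_of_forall_compl_eq_zero, f.integral_normed]
    intro t ht
    exact image_eq_zero_of_notMem_tsupport fun h => ht (hs h)
  refine ⟨∫ t, θ t • G t ∂timeMeasure, ?_⟩
  set c := ∫ t, θ t • G t ∂timeMeasure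
  have hz := ae_eq_zero_of_integral_smul_eq_zero (w := fun t => G t - c)
    (hG.sub (integrable_const c)) fun ψ hψ hψc hψs => ?_
  · filter_upwards [hz] with t ht
    exact sub_eq_zero.1 ht
  -- The function `ψ - m θ` has mean zero, so it is the derivative of a test function and is
  -- annihilated by `G`. This gives `∫ ψ G = m c = ∫ ψ c`.
  · set m := ∫ t in (0 : ℝ)..1, ψ t with hm
    have hts : tsupport (fun t => ψ t - m * θ t) ⊆ tsupport ψ ∪ tsupport θ := by
      refine closure_minimal (fun t ht => ?_) ((isClosed_tsupport _).union (isClosed_tsupport _))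
      by_contra hn
      rw [mem_union, not_or] at hn
      refine ht ?_
      simp [image_eq_zero_of_notMem_tsupport hn.1, image_eq_zero_of_notMem_tsupport hn.2]
    obtain ⟨φ, hφ, hφc, hφs, hd⟩ := exists_primitive_of_integral_eq_zero
      (η := fun t => ψ t - m * θ t) (hψ.sub (contDiff_const.mul hθ))
      (HasCompactSupport.intro (hψc.isCompact.union hθc.isCompact) fun t ht =>
        image_eq_zero_of_notMem_tsupport (f := fun t => ψ t - m * θ t) fun h' => ht (hts h'))
      (hts.trans (union_subset hψs hθs)) (by
        rw [intervalIntegral.integral_sub (hψ.continuous.intervalIntegrable _ _)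
          ((hθ.continuous.intervalIntegrable _ _).const_mul _),
          intervalIntegral.integral_const_mul, hθ1, mul_one, sub_self])
    have h1 := h φ hφ hφc hφs
    rw [hd] at h1
    have i1 := integrable_smul_of_continuous hψ.continuous hG
    have i2 := integrable_smul_of_continuous hθ.continuous hG
    have h2 : ∫ t, ψ t • G t ∂timeMeasure = m • c := by
      simp_rw [sub_smul, mul_smul] at h1
      have i3 : Integrable (fun t => m • θ t • G t) timeMeasure := i2.smul m
      rw [integral_sub i1 i3, integral_smul, sub_eq_zero] at h1
      exact h1
    have h3 : ∫ t, ψ t • c ∂timeMeasure = m • c := by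
      rw [integral_smul_const, integral_timeMeasure_eq_interval]
    simp_rw [smul_sub]
    rw [integral_sub i1 (integrable_smul_of_continuous hψ.continuous (integrable_const c)), h2, h3,
      sub_self]

theorem integral_deriv_eq_zero {φ : ℝ → ℝ} (hφ : ContDiff ℝ ∞ φ) (hs : tsupport φ ⊆ Ioo 0 1) :
    ∫ t, deriv φ t ∂timeMeasure = 0 := by
  have h0 : ∀ t ∉ Ioo (0 : ℝ) 1, φ t = 0 := fun t ht =>
    image_eq_zero_of_notMem_tsupport fun h => ht (hs h)
  rw [integral_timeMeasure_eq_interval, intervalIntegral.integral_deriv_eq_sub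
    (fun x _ => (hφ.differentiable (by simp)).differentiableAt)
    ((hφ.continuous_deriv (by simp)).intervalIntegrable _ _), h0 0 (by simp), h0 1 (by simp),
    sub_self]

end DuBoisReymond

section Riesz

variable (V : Type*) [NormedAddCommGroup V] [InnerProductSpace ℝ V]

/-- The map `V → V*`, `v ↦ (v, ·)`. -/
def dualMap : V →L[ℝ] V →L[ℝ] ℝ :=
  LinearMap.mkContinuous
    { toFun := fun v => innerSL ℝ v
      map_add' := fun u v => map_add _ u v
      map_smul' := fun c v => by ext w; simp } 1
    (fun v => by simp)

@[simp] theorem dualMap_apply (v w : V) : dualMap V v w = inner ℝ v w := rfl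

variable [CompleteSpace V]

/-- The Riesz isomorphism `V* → V`. -/
def riesz : (V →L[ℝ] ℝ) →L[ℝ] V :=
  LinearMap.mkContinuous
    { toFun := fun f => (InnerProductSpace.toDual ℝ V).symm f
      map_add' := fun f g => map_add _ f g
      map_smul' := fun c f => by
        refine ext_inner_right ℝ fun v => ?_
        simp } 1
    (fun f => by simp)

variable {V}

@[simp] theorem inner_riesz (f : V →L[ℝ] ℝ) (v : V) : inner ℝ (riesz V f) v = f v :=
  InnerProductSpace.toDual_symm_apply

@[simp] theorem riesz_dualMap (v : V) : riesz V (dualMap V v) = v :=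
  ext_inner_right ℝ fun w => by simp

@[simp] theorem dualMap_riesz (f : V →L[ℝ] ℝ) : dualMap V (riesz V f) = f := by
  ext w; simp

end Riesz

end Parabolic

/-! ### Weak states and adjoint states are the solutions given by the solution operator -/

namespace ParabolicControl

open Parabolic

variable {V H Ω : Type*}
  [NormedAddCommGroup V] [InnerProductSpace ℝ V] [CompleteSpace V]
  [NormedAddCommGroup H] [InnerProductSpace ℝ H] [CompleteSpace H]
  [MeasurableSpace Ω] {ϱ : Measure Ω}

/-- The Hilbert space data of the control problem. -/
def triple (P : ParabolicControl V H Ω ϱ) : GardingTriple V H where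
  emb := P.emb
  emb_denseRange := P.emb_denseRange
  A := (riesz V).comp P.a
  α₀ := P.garding.choose
  ω₀ := P.garding.choose_spec.2.choose
  α₀_pos := P.garding.choose_spec.1
  ω₀_nonneg := P.garding.choose_spec.2.choose_spec.1
  garding := fun v => by
    simpa using P.garding.choose_spec.2.choose_spec.2 v

theorem riesz_toDualV (P : ParabolicControl V H Ω ϱ) (h : H) :
    riesz V (P.toDualV h) = P.triple.embAdj h :=
  ext_inner_right ℝ fun v => by
    rw [inner_riesz, GardingTriple.inner_embAdj]; rfl

theorem toDualV_emb (P : ParabolicControl V H Ω ϱ) (v : V) :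
    P.toDualV (P.emb v) = dualMap V (P.triple.gram v) := by
  ext w
  rw [dualMap_apply, GardingTriple.inner_gram]; rfl

theorem riesz_A (P : ParabolicControl V H Ω ϱ) (v : V) : riesz V (P.A v) = P.triple.A v := rfl

theorem riesz_Astar (P : ParabolicControl V H Ω ϱ) (v : V) :
    riesz V (P.Astar v) = P.triple.adj.A v :=
  ext_inner_right ℝ fun w => by
    rw [inner_riesz, GardingTriple.adj, ContinuousLinearMap.adjoint_inner_left, real_inner_comm]
    exact (inner_riesz (P.a w) v).symm

theorem HasTrace.eq {P : ParabolicControl V H Ω ϱ} {y : ℝ → V} {t : ℝ} (ht : t ∈ Icc (0 : ℝ) 1)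
    {Y : ℝ → H} (hY : ContinuousOn Y (Icc 0 1)) (hy : ∀ᵐ s ∂timeMeasure, Y s = P.emb (y s))
    {h : H} (hh : P.HasTrace y t h) : h = Y t := by
  obtain ⟨Y', hc, hy', rfl⟩ := hh
  refine Measure.eqOn_Icc_of_ae_eq (μ := volume) zero_ne_one ?_ hc hY ht
  rw [Measure.restrict_congr_set Ioo_ae_eq_Icc.symm]
  filter_upwards [hy, hy'] with s h1 h2
  rw [h1, h2]

theorem IsW.memLp_riesz {P : ParabolicControl V H Ω ϱ} {y : ℝ → V} {dy : ℝ → V →L[ℝ] ℝ}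
    (hW : P.IsW y dy) : MemLp (fun t => riesz V (dy t)) 2 timeMeasure :=
  (riesz V).comp_memLp' hW.deriv_memLp

/-- Functions in `W(0,1)` are primitives of their weak derivatives. -/
theorem IsW.gram_eq {P : ParabolicControl V H Ω ϱ} {y : ℝ → V} {dy : ℝ → V →L[ℝ] ℝ}
    (hW : P.IsW y dy) {t₀ : ℝ} (ht₀ : t₀ ∈ Icc (0 : ℝ) 1) {c : H} (hc : P.HasTrace y t₀ c) :
    ∀ᵐ t ∂timeMeasure, P.triple.gram (y t) = P.triple.embAdj c +
      (prim (fun s => riesz V (dy s)) t - prim (fun s => riesz V (dy s)) t₀) := by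
  set g : ℝ → V := fun s => riesz V (dy s) with hg
  have hgm : MemLp g 2 timeMeasure := hW.memLp_riesz
  have hym : MemLp (fun t => P.triple.gram (y t)) 2 timeMeasure :=
    P.triple.gram.comp_memLp' hW.memLp
  have hpc : Continuous (prim g) := continuous_prim (integrable_of_memLp_two hgm)
  obtain ⟨d, hd⟩ := ae_eq_const_of_integral_deriv_smul_eq_zero
    (G := fun t => P.triple.gram (y t) - prim g t)
    ((integrable_of_memLp_two hym).sub (continuous_integrable hpc)) (fun φ hφ hφc hφs => by
      have hcd : Continuous (deriv φ) := hφ.continuous_deriv (by simp)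
      have h1 := congrArg (riesz V) (hW.weak_deriv φ hφ hφc hφs)
      have i1 := integrable_smul_of_continuous hcd (integrable_of_memLp_two hym)
      have i2 : Integrable (fun t => φ t • dy t) timeMeasure := by
        have i3 := integrable_smul_of_continuous hφ.continuous (integrable_of_memLp_two hgm)
        have := (dualMap V).integrable_comp i3
        simpa [hg] using this
      have i3 : Integrable (fun t => deriv φ t • P.toDualV (P.emb (y t))) timeMeasure := by
        have := (dualMap V).integrable_comp i1
        simpa [toDualV_emb] using this
      rw [map_neg, ← (riesz V).integral_comp_comm i2, ← (riesz V).integral_comp_comm i3] at h1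
      simp only [map_smul, toDualV_emb, riesz_dualMap] at h1
      simp_rw [smul_sub]
      rw [integral_sub i1 (integrable_smul_of_continuous hcd (continuous_integrable hpc)), h1,
        integral_deriv_smul_prim hgm hφ hφs]
      simp [hg])
  obtain ⟨Y, hY, hYy, rfl⟩ := hc
  have heq : EqOn (fun t => P.triple.embAdj (Y t)) (fun t => d + prim g t) (Icc 0 1) := by
    refine Measure.eqOn_Icc_of_ae_eq (μ := volume) zero_ne_one ?_
      (P.triple.embAdj.continuous.comp_continuousOn hY) (by fun_prop)
    rw [Measure.restrict_congr_set Ioo_ae_eq_Icc.symm]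
    filter_upwards [hd, hYy] with s h1 h2
    rw [← h1, h2]
    simp [GardingTriple.gram, triple]
  filter_upwards [hd] with t ht
  have h1 := heq ht₀
  simp only at h1
  rw [h1, ← ht]
  abel

/-- Converse to `IsW.gram_eq`: the integrated identity alone produces the weak derivative, so
existence of states and adjoint states reduces to it. -/
theorem isW_of_lift_gram_eq (P : ParabolicControl V H Ω ϱ) {y g : TimeL2 V} {c : V}
    (h : lift P.triple.gram y = constT V c + volterra V g) :
    P.IsW y (fun t => dualMap V (g t)) := by
  refine ⟨Lp.memLp y, (dualMap V).comp_memLp' (Lp.memLp g), fun φ hφ hφc hφs => ?_⟩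
  have hcd : Continuous (deriv φ) := hφ.continuous_deriv (by simp)
  have hpc : Continuous (prim g) := continuous_prim (integrable_timeL2 g)
  have hae : ∀ᵐ t ∂timeMeasure, P.triple.gram (y t) = c + prim g t := by
    have h' := coeFn_lift P.triple.gram y
    rw [h] at h'
    filter_upwards [h', Lp.coeFn_add (constT V c) (volterra V g), coeFn_constT c,
      coeFn_volterra g] with t h1 h2 h3 h4
    rw [← h1, h2, Pi.add_apply, h3, h4]
  have i1 : Integrable (fun t => deriv φ t • (c + prim g t)) timeMeasure :=
    continuous_integrable (by fun_prop)
  have i2 := integrable_smul_of_continuous hφ.continuous (integrable_timeL2 g)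
  have h1 : ∫ t in Ioo (0 : ℝ) 1, deriv φ t • P.toDualV (P.emb (y t)) =
      dualMap V (∫ t, deriv φ t • (c + prim g t) ∂timeMeasure) := by
    rw [← (dualMap V).integral_comp_comm i1]
    refine integral_congr_ae ?_
    filter_upwards [hae] with t ht
    rw [toDualV_emb, ht, map_smul]
  have h2 : ∫ t in Ioo (0 : ℝ) 1, φ t • dualMap V (g t) =
      dualMap V (∫ t, φ t • g t ∂timeMeasure) := by
    rw [← (dualMap V).integral_comp_comm i2]
    simp only [map_smul]
  rw [h1, h2, ← map_neg, ← integral_deriv_smul_prim (Lp.memLp g) hφ hφs]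
  congr 1
  simp_rw [smul_add]
  rw [integral_add (continuous_integrable (by fun_prop)) (continuous_integrable (by fun_prop)),
    integral_smul_const, integral_deriv_eq_zero hφ hφs, zero_smul, zero_add]

/-- The Riesz representation of the control operator. -/
def controlOp (P : ParabolicControl V H Ω ϱ) : Lp ℝ 2 ϱ →L[ℝ] V := (riesz V).comp P.B

/-- The solution of the state equation as an element of `L²((0,1); V)` and as a continuous function
with values in `H`. -/
def stateSol (P : ParabolicControl V H Ω ϱ) (ν : ℝ) (u : TimeL2 (Lp ℝ 2 ϱ)) :
    TimeL2 V × BoundedContinuousFunction ℝ H :=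
  P.triple.solver ν (ν • lift P.controlOp u, P.y₀)

/-- Uniqueness of the state: the weak equation integrates to `paraOp ν y = K f + embAdj y₀`, and
`paraOp ν` is injective. -/
theorem IsState.toLp_eq {P : ParabolicControl V H Ω ϱ} {ν : ℝ} (hν : 0 < ν)
    {u : ℝ → Lp ℝ 2 ϱ} (hu : MemLp u 2 timeMeasure) {y : ℝ → V} (h : P.IsState ν u y) :
    y =ᵐ[timeMeasure] (P.stateSol ν (hu.toLp u)).1 := by
  obtain ⟨dy, hW, heq, htr⟩ := h
  have hy := hW.memLp
  suffices hs : hy.toLp y = (P.stateSol ν (hu.toLp u)).1 by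
    rw [← hs]; exact hy.coeFn_toLp.symm
  have hg := hW.memLp_riesz
  have hgL : hg.toLp _ = ν • lift P.controlOp (hu.toLp u) - ν • lift P.triple.A (hy.toLp y) := by
    refine Lp.ext ?_
    filter_upwards [hg.coeFn_toLp, Lp.coeFn_sub (ν • lift P.controlOp (hu.toLp u))
      (ν • lift P.triple.A (hy.toLp y)), Lp.coeFn_smul ν (lift P.controlOp (hu.toLp u)),
      Lp.coeFn_smul ν (lift P.triple.A (hy.toLp y)), coeFn_lift P.controlOp (hu.toLp u),
      coeFn_lift P.triple.A (hy.toLp y), hy.coeFn_toLp, hu.coeFn_toLp, heq]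
      with t h1 h2 h3 h4 h5 h6 h7 h8 h9
    rw [h1, h2, Pi.sub_apply, h3, h4, Pi.smul_apply, Pi.smul_apply, h5, h6, h7, h8,
      eq_sub_of_add_eq h9, map_sub, map_smul, map_smul, riesz_A]
    rfl
  rw [stateSol, P.triple.solver_fst_eq_iff hν]
  have hgram : lift P.triple.gram (hy.toLp y) =
      constT V (P.triple.embAdj P.y₀) + volterra V (hg.toLp _) := by
    refine Lp.ext ?_
    filter_upwards [coeFn_lift P.triple.gram (hy.toLp y), hy.coeFn_toLp,
      Lp.coeFn_add (constT V (P.triple.embAdj P.y₀)) (volterra V (hg.toLp _)),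
      coeFn_constT (P.triple.embAdj P.y₀), coeFn_volterra (hg.toLp _),
      hW.gram_eq ⟨le_rfl, zero_le_one⟩ htr] with t h1 h2 h3 h4 h5 h6
    rw [h1, h2, h3, Pi.add_apply, h4, h5, h6, prim_zero, sub_zero, prim_congr hg.coeFn_toLp]
  rw [GardingTriple.paraOp_apply, hgram, hgL, map_sub, map_smul _ ν (lift P.triple.A _),
    volterra_lift]
  abel

theorem ae_stateSol (P : ParabolicControl V H Ω ϱ) {ν : ℝ} (hν : 0 < ν)
    (u : TimeL2 (Lp ℝ 2 ϱ)) :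
    ∀ᵐ t ∂timeMeasure, (P.stateSol ν u).2 t = P.emb ((P.stateSol ν u).1 t) := by
  have h := (P.triple.isSolver_solver hν).lift_emb (ν • lift P.controlOp u, P.y₀)
  filter_upwards [coeFn_lift P.emb (P.stateSol ν u).1, coeFn_bcfL2 (P.stateSol ν u).2]
    with t h1 h2
  rw [← h1, ← h2]
  exact (congrArg (fun f : TimeL2 H => f t) h).symm

theorem IsState.terminal_eq {P : ParabolicControl V H Ω ϱ} {ν : ℝ} (hν : 0 < ν)
    {u : ℝ → Lp ℝ 2 ϱ} (hu : MemLp u 2 timeMeasure) {y : ℝ → V} (h : P.IsState ν u y) {c : H}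
    (hc : P.HasTrace y 1 c) : c = (P.stateSol ν (hu.toLp u)).2 1 := by
  refine hc.eq ⟨zero_le_one, le_rfl⟩ (P.stateSol ν (hu.toLp u)).2.continuous.continuousOn ?_
  filter_upwards [P.ae_stateSol hν (hu.toLp u), h.toLp_eq hν hu] with t h1 h2
  rw [h1, h2]

theorem isState_stateSol (P : ParabolicControl V H Ω ϱ) {ν : ℝ} (hν : 0 < ν)
    {u : ℝ → Lp ℝ 2 ϱ} (hu : MemLp u 2 timeMeasure) :
    P.IsState ν u (P.stateSol ν (hu.toLp u)).1 := by
  set x := P.stateSol ν (hu.toLp u) with hx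
  set g := ν • lift P.controlOp (hu.toLp u) - ν • lift P.triple.A x.1 with hg
  refine ⟨fun t => dualMap V (g t), P.isW_of_lift_gram_eq (c := P.triple.embAdj P.y₀) ?_, ?_,
    x.2, x.2.continuous.continuousOn, P.ae_stateSol hν _,
    (P.triple.isSolver_solver hν).apply_zero _ _⟩
  · have h1 : P.triple.paraOp ν x.1 = _ := (P.triple.isSolver_solver hν).paraOp_eq _ _
    rw [GardingTriple.paraOp_apply] at h1
    rw [eq_sub_of_add_eq h1, hg, map_sub, map_smul _ ν (lift P.triple.A _), volterra_lift]
    abel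
  · filter_upwards [Lp.coeFn_sub (ν • lift P.controlOp (hu.toLp u))
      (ν • lift P.triple.A x.1), Lp.coeFn_smul ν (lift P.controlOp (hu.toLp u)),
      Lp.coeFn_smul ν (lift P.triple.A x.1), coeFn_lift P.controlOp (hu.toLp u),
      coeFn_lift P.triple.A x.1, hu.coeFn_toLp] with t h2 h3 h4 h5 h6 h8
    rw [hg, h2, Pi.sub_apply, h3, h4, Pi.smul_apply, Pi.smul_apply, h5, h6, h8, ← riesz_A,
      map_sub, map_smul, map_smul, dualMap_riesz, controlOp, ContinuousLinearMap.comp_apply,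
      dualMap_riesz, sub_add_cancel]

theorem hasTrace_stateSol (P : ParabolicControl V H Ω ϱ) {ν : ℝ} (hν : 0 < ν)
    (u : TimeL2 (Lp ℝ 2 ϱ)) (t : ℝ) :
    P.HasTrace (P.stateSol ν u).1 t ((P.stateSol ν u).2 t) :=
  ⟨_, (P.stateSol ν u).2.continuous.continuousOn, P.ae_stateSol hν u, rfl⟩

theorem isTerminal_iff (P : ParabolicControl V H Ω ϱ) {ν : ℝ} (hν : 0 < ν)
    {u : ℝ → Lp ℝ 2 ϱ} (hu : MemLp u 2 timeMeasure) (h : H) :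
    P.IsTerminal ν u h ↔ h = (P.stateSol ν (hu.toLp u)).2 1 := by
  constructor
  · rintro ⟨y, hy, hh⟩
    exact hy.terminal_eq hν hu hh
  · rintro rfl
    exact ⟨_, P.isState_stateSol hν hu, P.hasTrace_stateSol hν _ 1⟩

/-- Uniqueness of the adjoint state: integrating from the final time and reversing time leads to the
injective operator of the transposed system. -/
theorem adjoint_eq {P : ParabolicControl V H Ω ϱ} {ν : ℝ} (hν : 0 < ν) {p : ℝ → V}
    {dp : ℝ → V →L[ℝ] ℝ} (hW : P.IsW p dp)
    (heq : ∀ᵐ t ∂timeMeasure, -dp t + ν • P.Astar (p t) = 0) {p₁ : H}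
    (htr : P.HasTrace p 1 p₁) : p =ᵐ[timeMeasure] P.triple.adjSol ν 0 p₁ := by
  have hp := hW.memLp
  suffices hs : hp.toLp p = P.triple.adjSol ν 0 p₁ by
    rw [← hs]; exact hp.coeFn_toLp.symm
  have hg := hW.memLp_riesz
  have hgL : hg.toLp _ = ν • lift P.triple.adj.A (hp.toLp p) := by
    refine Lp.ext ?_
    filter_upwards [hg.coeFn_toLp, Lp.coeFn_smul ν (lift P.triple.adj.A (hp.toLp p)),
      coeFn_lift P.triple.adj.A (hp.toLp p), hp.coeFn_toLp, heq] with t h1 h4 h6 h7 h9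
    rw [h1, h4, Pi.smul_apply, h6, h7, ← riesz_Astar, ← map_smul, neg_add_eq_zero.1 h9]
  have hgram : lift P.triple.gram (hp.toLp p) = constT V (P.triple.embAdj p₁) +
      (volterra V (hg.toLp _) - constT V (timeMean V (hg.toLp _))) := by
    refine Lp.ext ?_
    filter_upwards [coeFn_lift P.triple.gram (hp.toLp p), hp.coeFn_toLp,
      Lp.coeFn_add (constT V (P.triple.embAdj p₁))
        (volterra V (hg.toLp _) - constT V (timeMean V (hg.toLp _))),
      Lp.coeFn_sub (volterra V (hg.toLp _)) (constT V (timeMean V (hg.toLp _))),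
      coeFn_constT (P.triple.embAdj p₁), coeFn_constT (timeMean V (hg.toLp _)),
      coeFn_volterra (hg.toLp _), hW.gram_eq ⟨zero_le_one, le_rfl⟩ htr]
      with t h1 h2 h3 h3' h4 h4' h5 h6
    rw [h1, h2, h3, Pi.add_apply, h3', Pi.sub_apply, h4, h4', h5, h6, timeMean_apply,
      prim_congr hg.coeFn_toLp]
  rw [← volterra_add_reflect, hgL] at hgram
  have h1 : P.triple.paraOpAdj ν (hp.toLp p) = P.triple.paraOpAdj ν (P.triple.adjSol ν 0 p₁) := by
    rw [P.triple.paraOpAdj_adjSol hν, P.triple.paraOpAdj_apply, GardingTriple.paraOp_apply,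
      map_add, map_smul, reflect_lift, reflect_reflect]
    have h2 : lift P.triple.adj.gram (hp.toLp p) = lift P.triple.gram (hp.toLp p) := rfl
    rw [h2, hgram, ← volterra_lift, ← reflect_lift]
    simp only [map_smul, map_zero]
    abel
  rw [P.triple.paraOpAdj_apply, P.triple.paraOpAdj_apply] at h1
  have h2 := congrArg (reflect V) h1
  rw [reflect_reflect, reflect_reflect] at h2
  have h3 := congrArg (reflect V) (P.triple.adj.paraOp_injective hν h2)
  rwa [reflect_reflect, reflect_reflect] at h3

theorem exists_isW_adjSol (P : ParabolicControl V H Ω ϱ) {ν : ℝ} (hν : 0 < ν) (p₁ : H) :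
    ∃ dp : ℝ → V →L[ℝ] ℝ, P.IsW (P.triple.adjSol ν 0 p₁) dp ∧
      (∀ᵐ t ∂timeMeasure, -dp t + ν • P.Astar (P.triple.adjSol ν 0 p₁ t) = 0) ∧
      P.HasTrace (P.triple.adjSol ν 0 p₁) 1 p₁ := by
  set p := P.triple.adjSol ν 0 p₁ with hp
  set g := ν • lift P.triple.adj.A p with hg
  refine ⟨fun t => dualMap V (g t), P.isW_of_lift_gram_eq
    (c := P.triple.embAdj p₁ - timeMean V g) ?_, ?_, ?_⟩
  · have h1 := P.triple.paraOpAdj_adjSol hν 0 p₁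
    rw [P.triple.paraOpAdj_apply, GardingTriple.paraOp_apply,
      map_add, map_smul, reflect_lift, reflect_reflect, ← hp, ← volterra_lift,
      ← reflect_lift, map_zero, map_zero, map_zero, add_zero] at h1
    have h2 : lift P.triple.adj.gram p = lift P.triple.gram p := rfl
    have h3 := volterra_add_reflect g
    rw [h2] at h1
    rw [map_sub, ← h3, ← h1, hg]
    simp only [map_smul]
    abel
  · filter_upwards [Lp.coeFn_smul ν (lift P.triple.adj.A p), coeFn_lift P.triple.adj.A p]
      with t h1 h2
    rw [hg, h1, Pi.smul_apply, h2, ← riesz_Astar, map_smul, dualMap_riesz, neg_add_cancel]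
  · set x := P.triple.adj.solver ν (reflect V 0, p₁) with hx
    have hS := P.triple.adj.isSolver_solver hν
    have h0 : p = reflect V x.1 := rfl
    refine ⟨fun t => x.2 (1 - t), (x.2.continuous.comp (by fun_prop)).continuousOn, ?_, ?_⟩
    · have h1 := hS.lift_emb (reflect V 0, p₁)
      rw [← hx] at h1
      have h4 : lift P.emb x.1 = bcfL2 H x.2 := h1
      have h2 : ∀ᵐ s ∂timeMeasure, x.2 s = P.emb (x.1 s) := by
        filter_upwards [coeFn_lift P.emb x.1, coeFn_bcfL2 x.2] with s h2 h3
        rw [← h2, ← h3, h4]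
      filter_upwards [measurePreserving_reflect.quasiMeasurePreserving.ae h2, coeFn_reflect x.1]
        with s h5 h6
      rw [h0, h5, h6]
    · simp only [sub_self]
      exact hS.apply_zero _ _

end ParabolicControl

end

/-! ### Parametrized minimal distance problems: derivative of the value and the Newton estimate -/

noncomputable section

namespace Parabolic

section Hilbert

variable {X : Type*} [NormedAddCommGroup X] [InnerProductSpace ℝ X]

/-- A decreasing sequence of nonempty closed convex bounded sets in a Hilbert space has a common
point. -/
theorem nonempty_iInter_of_convex [CompleteSpace X] {K : ℕ → Set X} (hanti : Antitone K)
    (hne : ∀ n, (K n).Nonempty) (hcl : ∀ n, IsClosed (K n)) (hconv : ∀ n, Convex ℝ (K n))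
    {R : ℝ} (hR : ∀ u ∈ K 0, ‖u‖ ≤ R) : (⋂ n, K n).Nonempty := by
  have hmin : ∀ n, ∃ v ∈ K n, ∀ w ∈ K n, ‖v‖ ≤ ‖w‖ := by
    intro n
    obtain ⟨v, hv, hvi⟩ := exists_norm_eq_iInf_of_complete_convex (hne n) (hcl n).isComplete
      (hconv n) 0
    refine ⟨v, hv, fun w hw => ?_⟩
    simp only [zero_sub, norm_neg] at hvi
    rw [hvi]
    exact ciInf_le ⟨0, by rintro _ ⟨x, rfl⟩; exact norm_nonneg _⟩ (⟨w, hw⟩ : K n)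
  choose v hvK hv using hmin
  -- The points `v n` of least norm form a Cauchy sequence: the midpoint of `v n` and `v m` lies in
  -- `K n`, so the parallelogram law bounds their distance by the increments of a bounded monotone
  -- sequence.
  have hpar : ∀ n m, n ≤ m → ‖v n - v m‖ ^ 2 ≤ 2 * (‖v m‖ ^ 2 - ‖v n‖ ^ 2) := by
    intro n m hnm
    have h1 : (1 / 2 : ℝ) • v n + (1 / 2 : ℝ) • v m ∈ K n :=
      hconv n (hvK n) (hanti hnm (hvK m)) (by norm_num) (by norm_num) (by norm_num)
    have h2 := hv n _ h1
    rw [← smul_add, norm_smul] at h2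
    norm_num at h2
    have h3 := parallelogram_law_with_norm ℝ (v n) (v m)
    nlinarith [norm_nonneg (v n), norm_nonneg (v n + v m)]
  have hmono : Monotone fun n => ‖v n‖ ^ 2 := by
    intro n m hnm
    have := hpar n m hnm
    simp only
    nlinarith [sq_nonneg ‖v n - v m‖]
  have hbdd : BddAbove (range fun n => ‖v n‖ ^ 2) := by
    refine ⟨R ^ 2, ?_⟩
    rintro _ ⟨n, rfl⟩
    have := hR _ (hanti (Nat.zero_le n) (hvK n))
    exact pow_le_pow_left₀ (norm_nonneg _) this 2
  have hconvg := tendsto_atTop_ciSup hmono hbdd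
  have hcau : CauchySeq v := by
    rw [Metric.cauchySeq_iff']
    intro ε hε
    obtain ⟨N, hN⟩ := (hconvg.eventually (lt_mem_nhds (show (⨆ n, ‖v n‖ ^ 2) - ε ^ 2 / 2 <
      ⨆ n, ‖v n‖ ^ 2 by have := pow_pos hε 2; linarith))).exists
    refine ⟨N, fun n hn => ?_⟩
    rw [dist_comm, dist_eq_norm]
    have h1 := hpar N n hn
    have h2 : ‖v n‖ ^ 2 ≤ ⨆ n, ‖v n‖ ^ 2 := le_ciSup hbdd n
    exact lt_of_pow_lt_pow_left₀ 2 hε.le (by linarith)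
  obtain ⟨x, hx⟩ := cauchySeq_tendsto_of_complete hcau
  refine ⟨x, mem_iInter.2 fun n => (hcl n).mem_of_tendsto hx ?_⟩
  filter_upwards [eventually_ge_atTop n] with m hm
  exact hanti hm (hvK m)

theorem norm_smul_inv_norm_le (x : X) : ‖‖x‖⁻¹ • x‖ ≤ 1 := by
  rcases eq_or_ne x 0 with rfl | hx
  · simp
  · rw [norm_smul, norm_inv, norm_norm, inv_mul_cancel₀ (norm_ne_zero_iff.2 hx)]

theorem norm_add_inner_le (x e : X) (hx : x ≠ 0) :
    ‖x‖ + inner ℝ (‖x‖⁻¹ • x) e ≤ ‖x + e‖ := by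
  have hx' : ‖x‖ ≠ 0 := norm_ne_zero_iff.2 hx
  have h1 : inner ℝ (‖x‖⁻¹ • x) (x + e) = ‖x‖ + inner ℝ (‖x‖⁻¹ • x) e := by
    rw [inner_add_right, real_inner_smul_left, real_inner_self_eq_norm_sq]
    field_simp
  rw [← h1]
  refine (real_inner_le_norm _ _).trans ?_
  exact mul_le_of_le_one_left (norm_nonneg _) (norm_smul_inv_norm_le x)

/-- From `2‖x‖‖x + e‖ ≤ ‖x‖² + ‖x + e‖²`. Together with the convexity bound `norm_add_inner_le`, it
gives the first order expansion of the norm away from `0`. -/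
theorem norm_add_le_inner (x e : X) (hx : x ≠ 0) :
    ‖x + e‖ ≤ ‖x‖ + inner ℝ (‖x‖⁻¹ • x) e + ‖e‖ ^ 2 / (2 * ‖x‖) := by
  have hx' : 0 < ‖x‖ := norm_pos_iff.2 hx
  have h1 : ‖x + e‖ ^ 2 = ‖x‖ ^ 2 + 2 * inner ℝ x e + ‖e‖ ^ 2 := norm_add_sq_real x e
  have h2 : ‖x + e‖ ≤ (‖x + e‖ ^ 2 + ‖x‖ ^ 2) / (2 * ‖x‖) := by
    rw [le_div_iff₀ (by positivity)]
    nlinarith [sq_nonneg (‖x + e‖ - ‖x‖)]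
  refine h2.trans (le_of_eq ?_)
  rw [h1, real_inner_smul_left]
  field_simp
  ring

/-- The underlying estimate is `‖x/‖x‖ - y/‖y‖‖ ≤ (2/m) ‖x - y‖`. All comparisons of derivative
expressions go through this lemma. -/
theorem abs_inner_normalize_sub_le {m C : ℝ} (hm : 0 < m) {x y z w : X} (hx : m ≤ ‖x‖)
    (hy : y ≠ 0) (hz : ‖z‖ ≤ C) :
    |inner ℝ (‖x‖⁻¹ • x) z - inner ℝ (‖y‖⁻¹ • y) w| ≤ 2 * C / m * ‖x - y‖ + ‖z - w‖ := by
  have hx0 : 0 < ‖x‖ := hm.trans_le hx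
  have hy0 : 0 < ‖y‖ := norm_pos_iff.2 hy
  have h1 : ‖‖x‖⁻¹ • x - ‖y‖⁻¹ • y‖ ≤ 2 / m * ‖x - y‖ := by
    have h2 : ‖x‖⁻¹ • x - ‖y‖⁻¹ • y = ‖x‖⁻¹ • (x - y) + (‖x‖⁻¹ - ‖y‖⁻¹) • y := by
      rw [smul_sub, sub_smul]; abel
    have h3 : |‖x‖⁻¹ - ‖y‖⁻¹| * ‖y‖ ≤ ‖x‖⁻¹ * ‖x - y‖ := by
      have h4 : ‖x‖⁻¹ - ‖y‖⁻¹ = ‖x‖⁻¹ * ((‖y‖ - ‖x‖) * ‖y‖⁻¹) := by field_simp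
      rw [h4, abs_mul, abs_mul, abs_of_pos (inv_pos.2 hx0), abs_of_pos (inv_pos.2 hy0), mul_assoc,
        mul_assoc, inv_mul_cancel₀ hy0.ne', mul_one]
      refine mul_le_mul_of_nonneg_left ?_ (inv_pos.2 hx0).le
      rw [norm_sub_rev]
      exact abs_norm_sub_norm_le y x
    rw [h2]
    refine (norm_add_le _ _).trans ?_
    rw [norm_smul, norm_smul, norm_inv, norm_norm, Real.norm_eq_abs]
    have h5 : ‖x‖⁻¹ ≤ m⁻¹ := inv_anti₀ hm hx
    have h6 := mul_le_mul_of_nonneg_right h5 (norm_nonneg (x - y))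
    calc _ ≤ ‖x‖⁻¹ * ‖x - y‖ + ‖x‖⁻¹ * ‖x - y‖ := by linarith
      _ ≤ m⁻¹ * ‖x - y‖ + m⁻¹ * ‖x - y‖ := by linarith
      _ = _ := by ring
  have h2 : inner ℝ (‖x‖⁻¹ • x) z - inner ℝ (‖y‖⁻¹ • y) w =
      inner ℝ (‖x‖⁻¹ • x - ‖y‖⁻¹ • y) z + inner ℝ (‖y‖⁻¹ • y) (z - w) := by
    rw [inner_sub_left, inner_sub_right]; ring
  rw [h2]
  refine (abs_add_le _ _).trans (add_le_add ?_ ?_)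
  · refine (abs_real_inner_le_norm _ _).trans ?_
    calc _ ≤ 2 / m * ‖x - y‖ * C := mul_le_mul h1 hz (norm_nonneg _) (by positivity)
      _ = _ := by ring
  · refine (abs_real_inner_le_norm _ _).trans ?_
    exact mul_le_of_le_one_left (norm_nonneg _) (norm_smul_inv_norm_le y)

/-- Used with `x` the distance between minimizers and `t` the parameter change: quadratic growth
against a perturbation of order `t x + t²` gives a linear bound. If it failed, then `t ≤ x`, and the
`t²` term could be absorbed. -/
theorem le_mul_of_quadratic_le {c a b x t : ℝ} (hc : 0 < c) (ha : 0 < a) (hb : 0 < b)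
    (ht : 0 ≤ t) (h : c * x ^ 2 ≤ t * (a * x) + 2 * b * t ^ 2) :
    x ≤ ((a + 2 * b) / c + 1) * t := by
  by_contra! hlt
  have h0 : 0 ≤ (a + 2 * b) / c := by positivity
  have htx : t ≤ x := by nlinarith
  have hxpos : 0 < x := lt_of_le_of_lt (by positivity) hlt
  have h1 : c * (((a + 2 * b) / c + 1) * t) = (a + 2 * b + c) * t := by field_simp
  have h2 : (a + 2 * b + c) * t * x < c * x * x := by
    rw [← h1]
    exact mul_lt_mul_of_pos_right (mul_lt_mul_of_pos_left hlt hc) hxpos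
  have h3 : b * (t * t) ≤ b * (t * x) :=
    mul_le_mul_of_nonneg_left (mul_le_mul_of_nonneg_left htx ht) hb.le
  have h4 : 0 ≤ c * (t * x) := by positivity
  linarith

end Hilbert

/-- A family of minimal distance problems `min ‖h(ν, u) - yd‖`, `u ∈ U`, depending on a parameter
`ν > 0`, where `z` is the derivative of `h` with respect to `ν`, and where `h` and `z` are
Lipschitz continuous with respect to a distance `gap` of controls. -/
structure DistanceProblem (X H : Type*)
    [NormedAddCommGroup X] [InnerProductSpace ℝ X]
    [NormedAddCommGroup H] [InnerProductSpace ℝ H] where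
  U : Set X
  nonempty : U.Nonempty
  closed : IsClosed U
  convex : Convex ℝ U
  bounded : ∃ R, ∀ u ∈ U, ‖u‖ ≤ R
  h : ℝ → X → H
  z : ℝ → X → H
  yd : H
  gap : X → X → ℝ
  gap_nonneg : ∀ u w, 0 ≤ gap u w
  h_affine : ∀ ν > 0, ∃ (L : X →L[ℝ] H) (c : H), ∀ u, h ν u = L u + c
  z_affine : ∀ ν > 0, ∃ (L : X →L[ℝ] H) (c : H), ∀ u, z ν u = L u + c
  bounds : ∀ a > 0, ∀ b, ∃ C > 0, ∀ μ ∈ Icc a b, ∀ ν ∈ Icc a b, ∀ u ∈ U,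
    ‖z ν u‖ ≤ C ∧ ‖h μ u - h ν u - (μ - ν) • z ν u‖ ≤ C * (μ - ν) ^ 2 ∧
      ‖z μ u - z ν u‖ ≤ C * |μ - ν|
  lipschitz : ∀ ν > 0, ∃ C > 0, ∀ u ∈ U, ∀ w ∈ U,
    ‖h ν u - h ν w‖ ≤ C * gap u w ∧ ‖z ν u - z ν w‖ ≤ C * gap u w

namespace DistanceProblem

variable {X H : Type*}
  [NormedAddCommGroup X] [InnerProductSpace ℝ X]
  [NormedAddCommGroup H] [InnerProductSpace ℝ H]

/-- The distance of the terminal state to the target. -/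
def F (Q : DistanceProblem X H) (ν : ℝ) (u : X) : ℝ := ‖Q.h ν u - Q.yd‖

/-- The derivative of `F` with respect to the parameter. -/
def D (Q : DistanceProblem X H) (ν : ℝ) (u : X) : ℝ :=
  inner ℝ (‖Q.h ν u - Q.yd‖⁻¹ • (Q.h ν u - Q.yd)) (Q.z ν u)

/-- The minimal distance. -/
def m (Q : DistanceProblem X H) (ν : ℝ) : ℝ := sInf (Q.F ν '' Q.U)

/-- `u` is a minimizer for the parameter `ν`. -/
def IsMin (Q : DistanceProblem X H) (ν : ℝ) (u : X) : Prop := u ∈ Q.U ∧ Q.F ν u = Q.m ν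

theorem m_le (Q : DistanceProblem X H) (ν : ℝ) {u : X} (hu : u ∈ Q.U) : Q.m ν ≤ Q.F ν u :=
  csInf_le ⟨0, by rintro _ ⟨u, _, rfl⟩; exact norm_nonneg _⟩ (mem_image_of_mem _ hu)

theorem m_nonneg (Q : DistanceProblem X H) (ν : ℝ) : 0 ≤ Q.m ν :=
  le_csInf (Q.nonempty.image _) (by rintro _ ⟨u, _, rfl⟩; exact norm_nonneg _)

theorem convex_sublevel (Q : DistanceProblem X H) {ν : ℝ} (hν : 0 < ν) (r : ℝ) :
    Convex ℝ {u | Q.F ν u ≤ r} ∧ IsClosed {u | Q.F ν u ≤ r} := by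
  obtain ⟨L, c, hL⟩ := Q.h_affine ν hν
  have : {u | Q.F ν u ≤ r} = L ⁻¹' Metric.closedBall (Q.yd - c) r := by
    ext u
    simp only [F, hL, mem_ofPred_eq, mem_preimage, Metric.mem_closedBall, dist_eq_norm]
    rw [show L u + c - Q.yd = L u - (Q.yd - c) by abel]
  rw [this]
  exact ⟨(convex_closedBall _ _).linear_preimage L.toLinearMap,
    Metric.isClosed_closedBall.preimage L.continuous⟩

theorem convex_halfspace (Q : DistanceProblem X H) {ν : ℝ} (hν : 0 < ν) (n : H) (r : ℝ) :
    Convex ℝ {u | r ≤ inner ℝ n (Q.z ν u)} ∧ IsClosed {u | r ≤ inner ℝ n (Q.z ν u)} := by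
  obtain ⟨L, c, hL⟩ := Q.z_affine ν hν
  have : {u | r ≤ inner ℝ n (Q.z ν u)} = ((innerSL ℝ n).comp L) ⁻¹' Ici (r - inner ℝ n c) := by
    ext u
    simp [hL, inner_add_right]
  rw [this]
  exact ⟨(convex_Ici _).linear_preimage ((innerSL ℝ n).comp L).toLinearMap,
    isClosed_Ici.preimage ((innerSL ℝ n).comp L).continuous⟩

/-- Stands in for weak compactness: the near-minimizers lying in `S` form a decreasing sequence of
nonempty bounded closed convex sets. -/
theorem exists_isMin_of_sets [CompleteSpace X] (Q : DistanceProblem X H) {ν : ℝ} (hν : 0 < ν)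
    {S : Set X} (hS : Convex ℝ S) (hSc : IsClosed S)
    (h : ∀ η > 0, ∃ u ∈ Q.U, Q.F ν u ≤ Q.m ν + η ∧ u ∈ S) : ∃ u ∈ S, Q.IsMin ν u := by
  obtain ⟨R, hR⟩ := Q.bounded
  set K : ℕ → Set X := fun n => Q.U ∩ ({u | Q.F ν u ≤ Q.m ν + 1 / ((n : ℝ) + 1)} ∩ S) with hK
  obtain ⟨u, hu⟩ := nonempty_iInter_of_convex (K := K) (R := R)
    (fun n k hnk u hu => ⟨hu.1, (show Q.F ν u ≤ _ from hu.2.1).trans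
      (add_le_add le_rfl (Nat.one_div_le_one_div (α := ℝ) hnk)), hu.2.2⟩)
    (fun n => by
      obtain ⟨u, h1, h2, h3⟩ := h (1 / ((n : ℝ) + 1)) Nat.one_div_pos_of_nat
      exact ⟨u, h1, h2, h3⟩)
    (fun n => Q.closed.inter ((Q.convex_sublevel hν _).2.inter hSc))
    (fun n => Q.convex.inter ((Q.convex_sublevel hν _).1.inter hS))
    (fun u hu => hR u hu.1)
  rw [mem_iInter] at hu
  refine ⟨u, (hu 0).2.2, (hu 0).1, le_antisymm ?_ (Q.m_le ν (hu 0).1)⟩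
  have h1 : Tendsto (fun n : ℕ => Q.m ν + 1 / ((n : ℝ) + 1)) atTop (𝓝 (Q.m ν + 0)) :=
    tendsto_const_nhds.add tendsto_one_div_add_atTop_nhds_zero_nat
  rw [add_zero] at h1
  exact ge_of_tendsto' h1 fun n => (hu n).2.1

theorem exists_isMin [CompleteSpace X] (Q : DistanceProblem X H) {ν : ℝ} (hν : 0 < ν) :
    ∃ u, Q.IsMin ν u := by
  obtain ⟨u, -, hu⟩ := Q.exists_isMin_of_sets hν convex_univ isClosed_univ fun η hη => by
    obtain ⟨_, ⟨u, hu, rfl⟩, h⟩ := exists_lt_of_csInf_lt (Q.nonempty.image (Q.F ν))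
      (show sInf (Q.F ν '' Q.U) < Q.m ν + η from lt_add_of_pos_right _ hη)
    exact ⟨u, hu, h.le, mem_univ u⟩
  exact ⟨u, hu⟩

/-- Strict convexity of the Hilbert norm at the midpoint: minimizing controls may differ, but their
terminal states cannot. -/
theorem h_eq_of_isMin (Q : DistanceProblem X H) {ν : ℝ} (hν : 0 < ν) {u w : X}
    (hu : Q.IsMin ν u) (hw : Q.IsMin ν w) : Q.h ν u = Q.h ν w := by
  obtain ⟨L, c, hL⟩ := Q.h_affine ν hν
  have h1 := Q.m_le ν (Q.convex hu.1 hw.1 (show (0 : ℝ) ≤ 1 / 2 by norm_num)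
    (show (0 : ℝ) ≤ 1 / 2 by norm_num) (by norm_num))
  set x := Q.h ν u - Q.yd with hx
  set y := Q.h ν w - Q.yd with hy
  have h2 : Q.F ν ((1 / 2 : ℝ) • u + (1 / 2 : ℝ) • w) = 1 / 2 * ‖x + y‖ := by
    have h3 : Q.h ν ((1 / 2 : ℝ) • u + (1 / 2 : ℝ) • w) - Q.yd = (1 / 2 : ℝ) • (x + y) := by
      rw [hx, hy, hL, hL, hL, map_add, map_smul, map_smul]
      module
    rw [F, h3, norm_smul]
    norm_num
  rw [h2] at h1
  have h3 := parallelogram_law_with_norm ℝ x y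
  have h4 : ‖x‖ = Q.m ν := hu.2
  have h5 : ‖y‖ = Q.m ν := hw.2
  have h6 := Q.m_nonneg ν
  have h7 : ‖x - y‖ ^ 2 ≤ 0 := by
    rw [h4, h5] at h3
    nlinarith [norm_nonneg (x + y)]
  have h8 : x - y = 0 := by
    rw [← norm_eq_zero]
    exact pow_eq_zero_iff two_ne_zero |>.1 (le_antisymm h7 (sq_nonneg _))
  have h9 : x - y = Q.h ν u - Q.h ν w := by rw [hx, hy]; abel
  rw [h9] at h8
  exact sub_eq_zero.1 h8

theorem abs_F_sub_le (Q : DistanceProblem X H) {a : ℝ} (ha : 0 < a) (b : ℝ) :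
    ∃ C > 0, ∀ μ ∈ Icc a b, ∀ ν ∈ Icc a b, ∀ u ∈ Q.U,
      |Q.F μ u - Q.F ν u| ≤ C * |μ - ν| ∧ ‖Q.h μ u - Q.h ν u‖ ≤ C * |μ - ν| := by
  obtain ⟨C, hC, hb⟩ := Q.bounds a ha b
  refine ⟨C + C * |b - a|, by positivity, fun μ hμ ν hν u hu => ?_⟩
  obtain ⟨h1, h2, -⟩ := hb μ hμ ν hν u hu
  have h3 : |μ - ν| ≤ |b - a| := by
    refine (abs_le_abs ?_ ?_) <;> linarith [hμ.1, hμ.2, hν.1, hν.2]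
  have h4 : ‖Q.h μ u - Q.h ν u‖ ≤ (C + C * |b - a|) * |μ - ν| := by
    calc ‖Q.h μ u - Q.h ν u‖ = ‖(Q.h μ u - Q.h ν u - (μ - ν) • Q.z ν u) + (μ - ν) • Q.z ν u‖ := by
          congr 1; abel
      _ ≤ C * (μ - ν) ^ 2 + |μ - ν| * C := by
          refine (norm_add_le _ _).trans (add_le_add h2 ?_)
          rw [norm_smul, Real.norm_eq_abs]
          exact mul_le_mul_of_nonneg_left h1 (abs_nonneg _)
      _ = C * (|μ - ν| * |μ - ν|) + |μ - ν| * C := by rw [← sq, sq_abs]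
      _ ≤ C * (|b - a| * |μ - ν|) + |μ - ν| * C := by
          have := mul_le_mul_of_nonneg_left (mul_le_mul_of_nonneg_right h3 (abs_nonneg (μ - ν)))
            hC.le
          linarith
      _ = _ := by ring
  refine ⟨?_, h4⟩
  refine le_trans ?_ h4
  have := abs_norm_sub_norm_le (Q.h μ u - Q.yd) (Q.h ν u - Q.yd)
  rwa [sub_sub_sub_cancel_right] at this

theorem abs_m_sub_le [CompleteSpace X] (Q : DistanceProblem X H) {a : ℝ} (ha : 0 < a) (b : ℝ) :
    ∃ C > 0, ∀ μ ∈ Icc a b, ∀ ν ∈ Icc a b, |Q.m μ - Q.m ν| ≤ C * |μ - ν| := by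
  obtain ⟨C, hC, hb⟩ := Q.abs_F_sub_le ha b
  refine ⟨C, hC, ?_⟩
  have key : ∀ μ ∈ Icc a b, ∀ ν ∈ Icc a b, Q.m μ - Q.m ν ≤ C * |μ - ν| := by
    intro μ hμ ν hν
    obtain ⟨u, hu⟩ := Q.exists_isMin (ha.trans_le hν.1)
    have h1 := (hb μ hμ ν hν u hu.1).1
    have h2 := Q.m_le μ hu.1
    have h3 := le_abs_self (Q.F μ u - Q.F ν u)
    linarith [hu.2]
  intro μ hμ ν hν
  rw [abs_le]
  have h1 := key μ hμ ν hν
  have h2 := key ν hν μ hμ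
  rw [abs_sub_comm] at h2
  constructor <;> linarith

/-- The expansion of `h` is combined with that of the norm, whose second order term is bounded
because `F ≥ m₀`. The constant does not depend on `u`. -/
theorem abs_F_expansion_le (Q : DistanceProblem X H) {a : ℝ} (ha : 0 < a) (b : ℝ) {m₀ : ℝ}
    (hm₀ : 0 < m₀) : ∃ C > 0, ∀ μ ∈ Icc a b, ∀ ν ∈ Icc a b, ∀ u ∈ Q.U, m₀ ≤ Q.F ν u →
      |Q.F μ u - Q.F ν u - (μ - ν) * Q.D ν u| ≤ C * (μ - ν) ^ 2 := by
  obtain ⟨C₁, hC₁, hb₁⟩ := Q.bounds a ha b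
  obtain ⟨C₂, hC₂, hb₂⟩ := Q.abs_F_sub_le ha b
  refine ⟨C₁ + C₂ ^ 2 / (2 * m₀), by positivity, fun μ hμ ν hν u hu hF => ?_⟩
  obtain ⟨-, h1, -⟩ := hb₁ μ hμ ν hν u hu
  obtain ⟨-, h2⟩ := hb₂ μ hμ ν hν u hu
  set x := Q.h ν u - Q.yd with hx
  set e := Q.h μ u - Q.h ν u with he
  have hx0 : x ≠ 0 := by
    intro h0
    have : Q.F ν u = 0 := by rw [F, ← hx, h0, norm_zero]
    linarith
  have hxe : Q.F μ u = ‖x + e‖ := by rw [F, hx, he]; congr 1; abel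
  have hFx : Q.F ν u = ‖x‖ := rfl
  have h3 := norm_add_inner_le x e hx0
  have h4 := norm_add_le_inner x e hx0
  have h5 : ‖e‖ ^ 2 / (2 * ‖x‖) ≤ C₂ ^ 2 / (2 * m₀) * (μ - ν) ^ 2 := by
    have h6 : ‖e‖ ^ 2 ≤ C₂ ^ 2 * (μ - ν) ^ 2 := by
      rw [← sq_abs (μ - ν), ← mul_pow]
      exact pow_le_pow_left₀ (norm_nonneg _) h2 2
    calc ‖e‖ ^ 2 / (2 * ‖x‖) ≤ (C₂ ^ 2 * (μ - ν) ^ 2) / (2 * m₀) :=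
          div_le_div₀ (by positivity) h6 (by positivity) (by rw [← hFx]; linarith)
      _ = _ := by ring
  have h6 : |inner ℝ (‖x‖⁻¹ • x) e - (μ - ν) * Q.D ν u| ≤ C₁ * (μ - ν) ^ 2 := by
    have h7 : inner ℝ (‖x‖⁻¹ • x) e - (μ - ν) * Q.D ν u =
        inner ℝ (‖x‖⁻¹ • x) (e - (μ - ν) • Q.z ν u) := by
      rw [inner_sub_right _ e, real_inner_smul_right]; rfl
    rw [h7]
    refine (abs_real_inner_le_norm _ _).trans (le_trans ?_ h1)
    exact mul_le_of_le_one_left (norm_nonneg _) (norm_smul_inv_norm_le x)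
  rw [abs_le] at h6 ⊢
  rw [hxe, hFx, add_mul]
  have h8 : 0 ≤ C₂ ^ 2 / (2 * m₀) * (μ - ν) ^ 2 := by positivity
  constructor <;> linarith [h6.1, h6.2]

/-- Near the minimal value, the derivative expression is close to its value at the minimizers. -/
theorem exists_abs_D_sub_le [CompleteSpace X] (Q : DistanceProblem X H) {ν : ℝ} (hν : 0 < ν)
    (hm : 0 < Q.m ν) {u₀ : X} (hu₀ : Q.IsMin ν u₀) (hind : ∀ u, Q.IsMin ν u → Q.D ν u = Q.D ν u₀)
    {ε : ℝ} (hε : 0 < ε) :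
    ∃ η > 0, ∀ u ∈ Q.U, Q.F ν u ≤ Q.m ν + η → |Q.D ν u - Q.D ν u₀| ≤ ε := by
  set x₀ := Q.h ν u₀ - Q.yd with hx₀
  set n := ‖x₀‖⁻¹ • x₀ with hn
  have hDmin : ∀ u, Q.IsMin ν u → inner ℝ n (Q.z ν u) = Q.D ν u₀ := by
    intro u hu
    rw [← hind u hu, D, Q.h_eq_of_isMin hν hu hu₀]
  -- Here the normal `n` is frozen at the minimizer, so the expression is affine in `u`. If
  -- near-minimizers stayed in the half-space where the bound fails, a minimizer would lie in it,
  -- contradicting the common value. The values `s = 1` and `s = -1` give the two sides.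
  have key : ∀ s : ℝ, ∃ η > 0, ∀ u ∈ Q.U, Q.F ν u ≤ Q.m ν + η →
      inner ℝ (s • n) (Q.z ν u) < s * Q.D ν u₀ + ε / 2 := by
    intro s
    by_contra! hcon
    obtain ⟨h1, h2⟩ := Q.convex_halfspace hν (s • n) (s * Q.D ν u₀ + ε / 2)
    obtain ⟨u, huS, hu⟩ := Q.exists_isMin_of_sets hν h1 h2 fun η hη => hcon η hη
    have h3 := hDmin u hu
    rw [mem_ofPred_eq, real_inner_smul_left, h3] at huS
    linarith
  obtain ⟨η₁, hη₁, hk₁⟩ := key 1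
  obtain ⟨η₂, hη₂, hk₂⟩ := key (-1)
  obtain ⟨C, hC, hb⟩ := Q.bounds ν hν ν
  obtain ⟨L, c, hL⟩ := Q.h_affine ν hν
  have hm0 := Q.m_nonneg ν
  set M := Q.m ν with hM
  have hηex : ∃ η₃ > 0, 2 * C / M * Real.sqrt (2 * (2 * M * η₃ + η₃ ^ 2)) ≤ ε / 2 := by
    have hcont : Continuous fun η : ℝ => 2 * C / M * Real.sqrt (2 * (2 * M * η + η ^ 2)) := by
      fun_prop
    have h1 := hcont.tendsto 0
    simp only [mul_zero, ne_eq, OfNat.ofNat_ne_zero, not_false_eq_true, zero_pow, add_zero,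
      Real.sqrt_zero] at h1
    have h2 := (h1.eventually (ge_mem_nhds (half_pos hε))).filter_mono
      (nhdsWithin_le_nhds (s := Ioi 0))
    obtain ⟨η, h3, h4⟩ := (h2.and self_mem_nhdsWithin).exists
    exact ⟨η, h4, h3⟩
  obtain ⟨η₃, hη₃, hk₃⟩ := hηex
  refine ⟨min η₁ (min η₂ η₃), lt_min hη₁ (lt_min hη₂ hη₃), fun u hu hF => ?_⟩
  have hF1 : Q.F ν u ≤ M + η₁ := hF.trans (by gcongr; exact min_le_left _ _)
  have hF2 : Q.F ν u ≤ M + η₂ :=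
    hF.trans (by gcongr; exact (min_le_right _ _).trans (min_le_left _ _))
  have hF3 : Q.F ν u ≤ M + η₃ :=
    hF.trans (by gcongr; exact (min_le_right _ _).trans (min_le_right _ _))
  have h1 := hk₁ u hu hF1
  have h2 := hk₂ u hu hF2
  rw [one_smul, one_mul] at h1
  rw [real_inner_smul_left] at h2
  set x := Q.h ν u - Q.yd with hx
  have hxF : ‖x‖ = Q.F ν u := rfl
  have hx₀F : ‖x₀‖ = M := hu₀.2
  -- Parallelogram law, with `‖x + x₀‖ ≥ 2M` from the midpoint control. It makes the normal at `u`
  -- close to the frozen one.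
  have hxx : ‖x - x₀‖ ≤ Real.sqrt (2 * (2 * M * η₃ + η₃ ^ 2)) := by
    refine Real.le_sqrt_of_sq_le ?_
    have h4 := Q.m_le ν (Q.convex hu hu₀.1 (show (0 : ℝ) ≤ 1 / 2 by norm_num)
      (show (0 : ℝ) ≤ 1 / 2 by norm_num) (by norm_num))
    have h5 : Q.F ν ((1 / 2 : ℝ) • u + (1 / 2 : ℝ) • u₀) = 1 / 2 * ‖x + x₀‖ := by
      have h3 : Q.h ν ((1 / 2 : ℝ) • u + (1 / 2 : ℝ) • u₀) - Q.yd = (1 / 2 : ℝ) • (x + x₀) := by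
        rw [hx, hx₀, hL, hL, hL, map_add, map_smul, map_smul]
        module
      rw [F, h3, norm_smul]
      norm_num
    rw [h5] at h4
    have h6 := parallelogram_law_with_norm ℝ x x₀
    rw [hx₀F] at h6
    have h7 : ‖x‖ ≤ M + η₃ := by rw [hxF]; exact hF3
    nlinarith [norm_nonneg (x + x₀), norm_nonneg x]
  have hx₀0 : x₀ ≠ 0 := by rw [← norm_pos_iff, hx₀F]; exact hm
  have h3 := abs_inner_normalize_sub_le (m := M) hm (x := x) (y := x₀) (z := Q.z ν u)
    (w := Q.z ν u) (C := C) (by rw [hxF]; exact Q.m_le ν hu) hx₀0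
    (hb ν ⟨le_rfl, le_rfl⟩ ν ⟨le_rfl, le_rfl⟩ u hu).1
  rw [sub_self, norm_zero, add_zero] at h3
  have h4 : |Q.D ν u - inner ℝ n (Q.z ν u)| ≤ ε / 2 := by
    refine h3.trans (le_trans ?_ hk₃)
    exact mul_le_mul_of_nonneg_left hxx (by positivity)
  rw [abs_le] at h4 ⊢
  constructor <;> linarith [h4.1, h4.2]

/-- Envelope argument: `m(μ) ≤ F(μ,u₀)` bounds `m(μ)` from above by the expansion at `u₀`. From
below, `m(μ) = F(μ,u)` is expanded about `ν` at a minimizer `u` of `μ`, using `F(ν,u) ≥ m(ν)`. -/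
theorem hasDerivAt_m [CompleteSpace X] (Q : DistanceProblem X H) {ν : ℝ} (hν : 0 < ν)
    (hm : 0 < Q.m ν) {u₀ : X} (hu₀ : Q.IsMin ν u₀)
    (hind : ∀ u, Q.IsMin ν u → Q.D ν u = Q.D ν u₀) : HasDerivAt Q.m (Q.D ν u₀) ν := by
  have ha : 0 < ν / 2 := half_pos hν
  obtain ⟨C₁, hC₁, hb₁⟩ := Q.abs_F_expansion_le ha (2 * ν) hm
  obtain ⟨C₂, hC₂, hb₂⟩ := Q.abs_F_sub_le ha (2 * ν)
  obtain ⟨C₃, hC₃, hb₃⟩ := Q.abs_m_sub_le ha (2 * ν)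
  have hνI : ν ∈ Icc (ν / 2) (2 * ν) := ⟨by linarith, by linarith⟩
  rw [hasDerivAt_iff_isLittleO, Asymptotics.isLittleO_iff]
  intro ε hε
  obtain ⟨η, hη, hD⟩ := Q.exists_abs_D_sub_le hν hm hu₀ hind (half_pos hε)
  have hnear : ∀ᶠ μ in 𝓝 ν, μ ∈ Icc (ν / 2) (2 * ν) :=
    Icc_mem_nhds (by linarith) (by linarith)
  have hcont : Continuous fun μ : ℝ => |μ - ν| := by fun_prop
  have h0 : Tendsto (fun μ : ℝ => |μ - ν|) (𝓝 ν) (𝓝 0) := by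
    have := hcont.tendsto ν
    simpa using this
  have hs1 : ∀ᶠ μ in 𝓝 ν, |μ - ν| < ε / (2 * C₁) := h0.eventually (gt_mem_nhds (by positivity))
  have hs2 : ∀ᶠ μ in 𝓝 ν, |μ - ν| < η / (C₂ + C₃) := h0.eventually (gt_mem_nhds (by positivity))
  filter_upwards [hnear, hs1, hs2] with μ hμ h1 h2
  rw [lt_div_iff₀ (by positivity)] at h1 h2
  rw [Real.norm_eq_abs, Real.norm_eq_abs, smul_eq_mul]
  have hsq : C₁ * (μ - ν) ^ 2 ≤ ε / 2 * |μ - ν| := by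
    rw [← sq_abs]
    nlinarith [abs_nonneg (μ - ν)]
  -- The minimizer for `μ` is a near-minimizer for `ν`, since `F(·,u)` and `m` are Lipschitz in the
  -- parameter.
  obtain ⟨u, hu⟩ := Q.exists_isMin (ha.trans_le hμ.1)
  have hF : Q.F ν u ≤ Q.m ν + η := by
    have h3 := (hb₂ μ hμ ν hνI u hu.1).1
    have h4 := hb₃ μ hμ ν hνI
    have h5 := hu.2
    rw [abs_le] at h3 h4
    linarith [h3.1, h4.2]
  have h3 := hD u hu.1 hF
  have h4 := hb₁ μ hμ ν hνI u hu.1 (Q.m_le ν hu.1)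
  have h5 := hb₁ μ hμ ν hνI u₀ hu₀.1 hu₀.2.ge
  have h6 := Q.m_le ν hu.1
  have h7 := Q.m_le μ hu₀.1
  have h8 : |(μ - ν) * Q.D ν u - (μ - ν) * Q.D ν u₀| ≤ |μ - ν| * (ε / 2) := by
    rw [← mul_sub, abs_mul]
    exact mul_le_mul_of_nonneg_left h3 (abs_nonneg _)
  rw [abs_le] at h4 h5 h8 ⊢
  have h9 := hu.2
  have h10 := hu₀.2
  have h11 : 0 ≤ ε * |μ - ν| := by positivity
  constructor <;> linarith [h4.1, h4.2, h5.1, h5.2, h8.1, h8.2]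

/-- Under quadratic growth at `ν₀`, the derivative expression is calm at `ν₀`, and a Newton step
for the value function reduces the error quadratically. -/
theorem exists_newton_estimate [CompleteSpace X] (Q : DistanceProblem X H) {ν₀ : ℝ}
    (hν₀ : 0 < ν₀) (hm : 0 < Q.m ν₀)
    (hind : ∀ ν > 0, 0 < Q.m ν → ∀ u w, Q.IsMin ν u → Q.IsMin ν w → Q.D ν u = Q.D ν w)
    {u₀ : X} (hu₀ : Q.IsMin ν₀ u₀) {c : ℝ} (hc : 0 < c)
    (hgrowth : ∀ u ∈ Q.U, c * Q.gap u u₀ ^ 2 ≤ Q.F ν₀ u - Q.F ν₀ u₀)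
    (hder : deriv Q.m ν₀ ≠ 0) :
    ∃ r > 0, ∃ C > 0, ∀ ν, |ν - ν₀| < r → 0 < ν ∧ 0 < Q.m ν ∧ ∀ u, Q.IsMin ν u →
      HasDerivAt Q.m (Q.D ν u) ν ∧ Q.D ν u ≠ 0 ∧
        |ν - (Q.m ν - Q.m ν₀) * (Q.D ν u)⁻¹ - ν₀| ≤ C * |ν - ν₀| ^ 2 := by
  have ha : 0 < ν₀ / 2 := half_pos hν₀
  have hm2 : 0 < Q.m ν₀ / 2 := half_pos hm
  obtain ⟨C₁, hC₁, hb₁⟩ := Q.abs_F_expansion_le ha (2 * ν₀) hm2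
  obtain ⟨C₂, hC₂, hb₂⟩ := Q.abs_F_sub_le ha (2 * ν₀)
  obtain ⟨C₃, hC₃, hb₃⟩ := Q.abs_m_sub_le ha (2 * ν₀)
  obtain ⟨C₄, hC₄, hb₄⟩ := Q.bounds (ν₀ / 2) ha (2 * ν₀)
  obtain ⟨C₅, hC₅, hb₅⟩ := Q.lipschitz ν₀ hν₀
  have hν₀I : ν₀ ∈ Icc (ν₀ / 2) (2 * ν₀) := ⟨by linarith, by linarith⟩
  set M := Q.m ν₀ / 2 with hM
  set D₀ := Q.D ν₀ u₀ with hD₀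
  have hD₀ne : D₀ ≠ 0 := by
    have h1 := Q.hasDerivAt_m hν₀ hm hu₀ fun u hu => hind ν₀ hν₀ hm u u₀ hu hu₀
    rwa [h1.deriv] at hder
  have hne : ∀ ν, M ≤ Q.m ν → ∀ u ∈ Q.U, Q.h ν u - Q.yd ≠ 0 := by
    intro ν hν u hu h0
    have h1 := Q.m_le ν hu
    rw [F, h0, norm_zero] at h1
    linarith
  have hDgap : ∀ u ∈ Q.U, |Q.D ν₀ u - D₀| ≤ (2 * C₄ / M * C₅ + C₅) * Q.gap u u₀ := by
    intro u hu
    obtain ⟨h1, h2⟩ := hb₅ u hu u₀ hu₀.1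
    have h3 := abs_inner_normalize_sub_le (m := M) hm2 (x := Q.h ν₀ u - Q.yd)
      (y := Q.h ν₀ u₀ - Q.yd) (z := Q.z ν₀ u) (w := Q.z ν₀ u₀) (C := C₄)
      (by have := Q.m_le ν₀ hu; rw [F] at this; linarith)
      (hne ν₀ (by linarith) u₀ hu₀.1) (hb₄ ν₀ hν₀I ν₀ hν₀I u hu).1
    rw [sub_sub_sub_cancel_right] at h3
    refine h3.trans ?_
    have h4 : 0 ≤ 2 * C₄ / M := by positivity
    have h5 := mul_le_mul_of_nonneg_left h1 h4
    linarith
  set C₆ := 2 * C₄ / M * C₅ + C₅ with hC₆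
  have hC₆0 : 0 < C₆ := by positivity
  set κ := (C₆ + 2 * C₁) / c + 1 with hκ
  have hκ1 : 1 ≤ κ := by
    have : 0 ≤ (C₆ + 2 * C₁) / c := by positivity
    linarith
  set C₇ := 2 * C₄ / M * C₂ + C₄ + C₆ * κ with hC₇
  have hC₇0 : 0 < C₇ := by positivity
  -- The three radii keep `ν` in the interval where the constants are valid, `m(ν)` above `m(ν₀)/2`,
  -- and the derivative expression above `|D₀|/2` in modulus.
  set r := min (ν₀ / 2) (min (M / C₃) (|D₀| / (2 * C₇))) with hr
  have hD₀pos : 0 < |D₀| := abs_pos.2 hD₀ne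
  have hr0 : 0 < r := lt_min ha (lt_min (by positivity) (by positivity))
  refine ⟨r, hr0, (C₁ + C₇) * (2 / |D₀|), by positivity, fun ν hν => ?_⟩
  have hr1 : |ν - ν₀| < ν₀ / 2 := hν.trans_le (min_le_left _ _)
  have hr2 : |ν - ν₀| < M / C₃ := hν.trans_le ((min_le_right _ _).trans (min_le_left _ _))
  have hr3 : |ν - ν₀| < |D₀| / (2 * C₇) := hν.trans_le ((min_le_right _ _).trans (min_le_right _ _))
  rw [lt_div_iff₀ (by positivity)] at hr2 hr3
  have hνI : ν ∈ Icc (ν₀ / 2) (2 * ν₀) := by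
    rw [abs_lt] at hr1
    exact ⟨by linarith [hr1.1], by linarith [hr1.2]⟩
  have hν0 : 0 < ν := ha.trans_le hνI.1
  have hmν : M ≤ Q.m ν := by
    have h1 := hb₃ ν hνI ν₀ hν₀I
    rw [abs_le] at h1
    linarith [h1.1]
  refine ⟨hν0, hm2.trans_le hmν, fun u hu => ?_⟩
  have hmν0 : 0 < Q.m ν := hm2.trans_le hmν
  set Δ := ν - ν₀ with hΔ
  set x := Q.gap u u₀ with hx
  have hx0 : 0 ≤ x := Q.gap_nonneg u u₀
  have hM2 : M ≤ Q.m ν₀ := by linarith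
  -- Expanding both sides of `F(ν,u) ≤ F(ν,u₀)` about `ν₀` bounds `F(ν₀,u) - F(ν₀,u₀)` by `C₆|Δ|x +
  -- 2C₁Δ²`, while growth bounds it below by `c x²`.
  have hgap : x ≤ κ * |Δ| := by
    have h1 := hgrowth u hu.1
    have h2 := hb₁ ν hνI ν₀ hν₀I u hu.1 (hM2.trans (Q.m_le ν₀ hu.1))
    have h3 := hb₁ ν hνI ν₀ hν₀I u₀ hu₀.1 (hM2.trans (Q.m_le ν₀ hu₀.1))
    have h4 : Q.F ν u ≤ Q.F ν u₀ := by rw [hu.2]; exact Q.m_le ν hu₀.1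
    have h5 : |Δ * (Q.D ν₀ u - D₀)| ≤ |Δ| * (C₆ * x) := by
      rw [abs_mul]
      exact mul_le_mul_of_nonneg_left (hDgap u hu.1) (abs_nonneg _)
    rw [abs_le] at h2 h3 h5
    refine le_mul_of_quadratic_le hc hC₆0 hC₁ (abs_nonneg Δ) ?_
    rw [sq_abs]
    linarith [h2.1, h3.2, h5.1, mul_sub Δ (Q.D ν₀ u) D₀]
  have hDcalm : |Q.D ν u - D₀| ≤ C₇ * |Δ| := by
    have h1 := abs_inner_normalize_sub_le (m := M) hm2 (x := Q.h ν u - Q.yd)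
      (y := Q.h ν₀ u - Q.yd) (z := Q.z ν u) (w := Q.z ν₀ u) (C := C₄)
      (by have := Q.m_le ν hu.1; rw [F] at this; linarith)
      (hne ν₀ hM2 u hu.1) (hb₄ ν hνI ν hνI u hu.1).1
    rw [sub_sub_sub_cancel_right] at h1
    have h2 := (hb₂ ν hνI ν₀ hν₀I u hu.1).2
    have h3 := (hb₄ ν hνI ν₀ hν₀I u hu.1).2.2
    have h4 := hDgap u hu.1
    have h5 : 0 ≤ 2 * C₄ / M := by positivity
    have h6 := mul_le_mul_of_nonneg_left h2 h5
    have h7 := mul_le_mul_of_nonneg_left hgap hC₆0.le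
    have h8 : |Q.D ν u - D₀| ≤ |Q.D ν u - Q.D ν₀ u| + |Q.D ν₀ u - D₀| := abs_sub_le _ _ _
    have h9 : |Q.D ν u - Q.D ν₀ u| ≤ 2 * C₄ / M * ‖Q.h ν u - Q.h ν₀ u‖ + ‖Q.z ν u - Q.z ν₀ u‖ := h1
    have h10 : C₇ * |Δ| = 2 * C₄ / M * (C₂ * |Δ|) + C₄ * |Δ| + C₆ * (κ * |Δ|) := by
      rw [hC₇]; ring
    rw [h10]
    linarith
  have hDlow : |D₀| / 2 ≤ |Q.D ν u| := by
    have h1 : |D₀| - |Q.D ν u| ≤ |D₀ - Q.D ν u| := abs_sub_abs_le_abs_sub _ _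
    rw [abs_sub_comm] at h1
    linarith
  have hDne : Q.D ν u ≠ 0 := by
    rw [← abs_pos]
    linarith
  refine ⟨Q.hasDerivAt_m hν0 hmν0 hu fun w hw => hind ν hν0 hmν0 w u hw hu, hDne, ?_⟩
  -- The lower bound uses `m(ν₀) ≤ F(ν₀,u)` expanded about `ν`. The upper bound uses `m(ν) ≤
  -- F(ν,u₀)` expanded about `ν₀`, where calmness replaces `D₀` by `D(ν,u)`.
  have hquad : |Q.m ν - Q.m ν₀ - Δ * Q.D ν u| ≤ (C₁ + C₇) * |Δ| ^ 2 := by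
    have h1 := hb₁ ν hνI ν₀ hν₀I u₀ hu₀.1 (hM2.trans (Q.m_le ν₀ hu₀.1))
    have h2 := hb₁ ν₀ hν₀I ν hνI u hu.1 (hmν.trans (Q.m_le ν hu.1))
    have h3 := Q.m_le ν hu₀.1
    have h4 := Q.m_le ν₀ hu.1
    have h5 : |Δ * (Q.D ν u - D₀)| ≤ C₇ * |Δ| ^ 2 := by
      rw [abs_mul]
      calc |Δ| * |Q.D ν u - D₀| ≤ |Δ| * (C₇ * |Δ|) :=
            mul_le_mul_of_nonneg_left hDcalm (abs_nonneg _)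
        _ = _ := by ring
    have h6 : (ν₀ - ν) = -Δ := by rw [hΔ]; ring
    rw [h6] at h2
    have h7 := hu.2
    have h8 := hu₀.2
    rw [abs_le] at h1 h2 h5 ⊢
    rw [sq_abs] at h5 ⊢
    have h9 : 0 ≤ C₇ * Δ ^ 2 := by positivity
    have h10 := mul_sub Δ (Q.D ν u) D₀
    rw [neg_sq] at h2
    constructor <;> linarith [h1.1, h1.2, h2.1, h2.2, h5.1, h5.2]
  have hid : ν - (Q.m ν - Q.m ν₀) * (Q.D ν u)⁻¹ - ν₀ =
      -((Q.m ν - Q.m ν₀ - Δ * Q.D ν u) * (Q.D ν u)⁻¹) := by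
    rw [hΔ]; field_simp; ring
  rw [hid, abs_neg, abs_mul, abs_inv]
  have hinv : |Q.D ν u|⁻¹ ≤ 2 / |D₀| := by
    rw [← inv_div]
    exact inv_anti₀ (by positivity) hDlow
  calc _ ≤ (C₁ + C₇) * |Δ| ^ 2 * (2 / |D₀|) :=
        mul_le_mul hquad hinv (by positivity) (by positivity)
    _ = _ := by ring

end DistanceProblem

/-- A step relation that reduces the error quadratically generates sequences that converge
quadratically. -/
theorem exists_local_quadratic_convergence {R : ℝ → ℝ → Prop} {ν₀ r C : ℝ} (hr : 0 < r)
    (hC : 0 < C) (hex : ∀ ν, |ν - ν₀| < r → ∃ ν', R ν ν')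
    (hR : ∀ ν ν', |ν - ν₀| < r → R ν ν' → |ν' - ν₀| ≤ C * |ν - ν₀| ^ 2) :
    ∃ r' > 0, r' ≤ r ∧ ∀ x₀, |x₀ - ν₀| < r' →
      (∃ x : ℕ → ℝ, x 0 = x₀ ∧ ∀ n, R (x n) (x (n + 1))) ∧
      ∀ x : ℕ → ℝ, (x 0 = x₀ ∧ ∀ n, R (x n) (x (n + 1))) →
        (∀ n, |x n - ν₀| < r') ∧ Tendsto x atTop (𝓝 ν₀) ∧
          ∀ n, |x (n + 1) - ν₀| ≤ C * |x n - ν₀| ^ 2 := by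
  -- With `C r' ≤ 1/2` the quadratic bound also halves the error. Hence every step stays in the ball
  -- and the errors tend to zero geometrically.
  set r' := min r (1 / (2 * C)) with hr'
  have hr'0 : 0 < r' := lt_min hr (by positivity)
  have hr'r : r' ≤ r := min_le_left _ _
  have hhalf : ∀ ν ν', |ν - ν₀| < r' → R ν ν' → |ν' - ν₀| ≤ 1 / 2 * |ν - ν₀| := by
    intro ν ν' hν hRν
    refine (hR ν ν' (hν.trans_le hr'r) hRν).trans ?_
    have h1 : |ν - ν₀| ≤ 1 / (2 * C) := hν.le.trans (min_le_right _ _)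
    rw [le_div_iff₀ (by positivity)] at h1
    nlinarith [abs_nonneg (ν - ν₀)]
  have hstay : ∀ ν ν', |ν - ν₀| < r' → R ν ν' → |ν' - ν₀| < r' := by
    intro ν ν' hν hRν
    have h1 := hhalf ν ν' hν hRν
    have h2 := abs_nonneg (ν - ν₀)
    linarith
  refine ⟨r', hr'0, hr'r, fun x₀ hx₀ => ⟨?_, ?_⟩⟩
  · have hex' : ∀ ν : {ν : ℝ // |ν - ν₀| < r'}, ∃ ν' : {ν : ℝ // |ν - ν₀| < r'}, R ν ν' := by
      rintro ⟨ν, hν⟩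
      obtain ⟨ν', hν'⟩ := hex ν (hν.trans_le hr'r)
      exact ⟨⟨ν', hstay ν ν' hν hν'⟩, hν'⟩
    choose f hf using hex'
    refine ⟨fun n => (f^[n] ⟨x₀, hx₀⟩ : {ν : ℝ // |ν - ν₀| < r'}), rfl, fun n => ?_⟩
    simp only [Function.iterate_succ_apply']
    exact hf _
  · rintro x ⟨hx0, hx⟩
    have hin : ∀ n, |x n - ν₀| < r' := by
      intro n
      induction n with
      | zero => rwa [hx0]
      | succ k ih => exact hstay _ _ ih (hx k)
    refine ⟨hin, ?_, fun n => hR _ _ ((hin n).trans_le hr'r) (hx n)⟩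
    have hgeo : ∀ n, |x n - ν₀| ≤ (1 / 2 : ℝ) ^ n * r' := by
      intro n
      induction n with
      | zero => simpa using (hin 0).le
      | succ k ih =>
        refine (hhalf _ _ (hin k) (hx k)).trans ?_
        rw [pow_succ]
        linarith
    rw [tendsto_iff_norm_sub_tendsto_zero]
    refine squeeze_zero (fun n => norm_nonneg _) hgeo ?_
    have := (tendsto_pow_atTop_nhds_zero_of_lt_one (r := (1 / 2 : ℝ)) (by norm_num)
      (by norm_num)).mul_const r'
    simpa using this

end Parabolic

end

/-! ### Box-constrained controls: bang-bang structure and quadratic growth in `L¹` -/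

noncomputable section

namespace Parabolic

/-- Supplies the ordered module structure that makes the control box, an order interval in the
Bochner space, convex by `convex_Icc`. -/
instance {α E : Type*} {m : MeasurableSpace α} {μ : Measure α} {p : ℝ≥0∞} [NormedAddCommGroup E]
    [PartialOrder E] [NormedSpace ℝ E] [PosSMulMono ℝ E] : PosSMulMono ℝ (Lp E p μ) where
  smul_le_smul_of_nonneg_left c hc f g hfg := by
    change c • f ≤ c • g
    rw [← Lp.coeFn_le] at hfg ⊢
    filter_upwards [hfg, Lp.coeFn_smul c f, Lp.coeFn_smul c g] with x h1 h2 h3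
    rw [h2, h3]
    exact smul_le_smul_of_nonneg_left h1 hc

section Control

variable {Ω : Type*} [MeasurableSpace Ω] {ϱ : Measure Ω}

/-- The inclusion of `L²` into `L¹` on a finite measure space. -/
def lpIncl (ϱ : Measure Ω) [IsFiniteMeasure ϱ] : Lp ℝ 2 ϱ →L[ℝ] Lp ℝ 1 ϱ :=
  LinearMap.mkContinuous
    { toFun := fun w => ((Lp.memLp w).mono_exponent one_le_two).toLp w
      map_add' := fun u w => by
        refine Lp.ext ?_
        filter_upwards [((Lp.memLp (u + w)).mono_exponent (p := 1) one_le_two).coeFn_toLp,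
          ((Lp.memLp u).mono_exponent (p := 1) one_le_two).coeFn_toLp,
          ((Lp.memLp w).mono_exponent (p := 1) one_le_two).coeFn_toLp, Lp.coeFn_add u w,
          Lp.coeFn_add (((Lp.memLp u).mono_exponent (p := 1) one_le_two).toLp u)
            (((Lp.memLp w).mono_exponent (p := 1) one_le_two).toLp w)] with x h1 h2 h3 h4 h5
        rw [h1, h5, Pi.add_apply, h2, h3, h4, Pi.add_apply]
      map_smul' := fun c w => by
        refine Lp.ext ?_
        filter_upwards [((Lp.memLp (c • w)).mono_exponent (p := 1) one_le_two).coeFn_toLp,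
          ((Lp.memLp w).mono_exponent (p := 1) one_le_two).coeFn_toLp, Lp.coeFn_smul c w,
          Lp.coeFn_smul c (((Lp.memLp w).mono_exponent (p := 1) one_le_two).toLp w)]
          with x h1 h2 h3 h4
        rw [h1, RingHom.id_apply, h4, Pi.smul_apply, h2, h3, Pi.smul_apply] }
    ((ϱ univ) ^ (1 / (1 : ℝ≥0∞).toReal - 1 / (2 : ℝ≥0∞).toReal)).toReal (fun w => by
      simp only [LinearMap.coe_mk, AddHom.coe_mk, Lp.norm_toLp]
      rw [Lp.norm_def, ← ENNReal.toReal_mul, mul_comm]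
      refine ENNReal.toReal_mono (ENNReal.mul_ne_top (Lp.eLpNorm_ne_top w) ?_)
        (eLpNorm_le_eLpNorm_mul_rpow_measure_univ one_le_two (Lp.aestronglyMeasurable w))
      refine ENNReal.rpow_ne_top_of_nonneg ?_ (measure_ne_top _ _)
      norm_num)

theorem coeFn_lpIncl [IsFiniteMeasure ϱ] (w : Lp ℝ 2 ϱ) : lpIncl ϱ w =ᵐ[ϱ] w :=
  ((Lp.memLp w).mono_exponent one_le_two).coeFn_toLp

theorem norm_lpIncl [IsFiniteMeasure ϱ] (w : Lp ℝ 2 ϱ) : ‖lpIncl ϱ w‖ = ∫ x, |w x| ∂ϱ := by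
  rw [L1.norm_eq_integral_norm]
  refine integral_congr_ae ?_
  filter_upwards [coeFn_lpIncl w] with x hx
  rw [hx, Real.norm_eq_abs]

/-- The distance of two controls in `L¹((0,1) × Ω)`. -/
def controlGap [IsFiniteMeasure ϱ] (u w : TimeL2 (Lp ℝ 2 ϱ)) : ℝ :=
  ∫ t, ‖lpIncl ϱ ((u - w) t)‖ ∂timeMeasure

theorem controlGap_nonneg [IsFiniteMeasure ϱ] (u w : TimeL2 (Lp ℝ 2 ϱ)) : 0 ≤ controlGap u w :=
  integral_nonneg fun _ => norm_nonneg _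

theorem integrable_lpIncl [IsFiniteMeasure ϱ] (u : TimeL2 (Lp ℝ 2 ϱ)) :
    Integrable (fun t => lpIncl ϱ (u t)) timeMeasure :=
  (lpIncl ϱ).integrable_comp (integrable_timeL2 u)

/-- The set of controls between two bounds. -/
def controlBox (lo hi : Lp ℝ 2 ϱ) : Set (TimeL2 (Lp ℝ 2 ϱ)) :=
  Icc (constT _ lo) (constT _ hi)

theorem mem_controlBox_iff (lo hi : Lp ℝ 2 ϱ) (u : TimeL2 (Lp ℝ 2 ϱ)) :
    u ∈ controlBox lo hi ↔ ∀ᵐ t ∂timeMeasure, lo ≤ u t ∧ u t ≤ hi := by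
  rw [controlBox, mem_Icc, ← Lp.coeFn_le, ← Lp.coeFn_le, eventually_and]
  refine and_congr ?_ ?_
  · constructor <;> intro h <;> filter_upwards [h, coeFn_constT lo] with t h1 h2
    · rwa [h2] at h1
    · rwa [h2]
  · constructor <;> intro h <;> filter_upwards [h, coeFn_constT hi] with t h1 h2
    · rwa [h2] at h1
    · rwa [h2]

theorem convex_controlBox (lo hi : Lp ℝ 2 ϱ) : Convex ℝ (controlBox lo hi) := convex_Icc _ _

theorem isClosed_controlBox (lo hi : Lp ℝ 2 ϱ) : IsClosed (controlBox lo hi) := isClosed_Icc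

theorem norm_le_of_mem_controlBox (lo hi : Lp ℝ 2 ϱ) :
    ∃ R, ∀ u ∈ controlBox lo hi, ‖u‖ ≤ R := by
  refine ⟨‖constT _ hi - constT _ lo‖ + ‖constT _ lo‖, fun u hu => ?_⟩
  have h1 : ‖u - constT _ lo‖ ≤ ‖constT _ hi - constT _ lo‖ := by
    refine norm_le_norm_of_abs_le_abs ?_
    have h2 : 0 ≤ u - constT _ lo := sub_nonneg.2 hu.1
    have h3 : u - constT _ lo ≤ constT _ hi - constT _ lo := sub_le_sub_right hu.2 _
    rw [abs_of_nonneg h2, abs_of_nonneg (h2.trans h3)]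
    exact h3
  calc ‖u‖ = ‖(u - constT _ lo) + constT _ lo‖ := by rw [sub_add_cancel]
    _ ≤ _ := (norm_add_le _ _).trans (by linarith)

theorem nonempty_controlBox {lo hi : Lp ℝ 2 ϱ} (h : lo ≤ hi) : (controlBox lo hi).Nonempty := by
  refine ⟨constT _ lo, (mem_controlBox_iff _ _ _).2 ?_⟩
  filter_upwards [coeFn_constT lo] with t ht
  rw [ht]
  exact ⟨le_rfl, h⟩

theorem inner_Lp_eq (f g : Lp ℝ 2 ϱ) : inner ℝ f g = ∫ x, f x * g x ∂ϱ := by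
  rw [L2.inner_def]
  simp [mul_comm]

theorem integrable_mul_Lp (f g : Lp ℝ 2 ϱ) : Integrable (fun x => f x * g x) ϱ :=
  (Lp.memLp f).integrable_mul (Lp.memLp g)

/-- The bang-bang principle: a control satisfying the first order optimality condition in a box
lies at the bounds wherever the switching function does not vanish. -/
theorem bang_bang {lo hi : Lp ℝ 2 ϱ} {q u₀ : TimeL2 (Lp ℝ 2 ϱ)} (hle : lo ≤ hi)
    (hu₀ : u₀ ∈ controlBox lo hi)
    (hopt : ∀ u ∈ controlBox lo hi, 0 ≤ inner ℝ q (u - u₀)) {u : TimeL2 (Lp ℝ 2 ϱ)}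
    (hu : u ∈ controlBox lo hi) :
    ∀ᵐ t ∂timeMeasure, ∀ᵐ x ∂ϱ, q t x * (u - u₀) t x = |q t x| * |(u - u₀) t x| := by
  set L := constT _ lo
  set R := constT _ hi
  have hLR : L ≤ R := hu₀.1.trans hu₀.2
  -- The competitor is the projection of `u₀ - q` onto the box, formed with lattice operations so
  -- that measurability is automatic. Pointwise `q (w - u₀) ≤ 0`, while optimality makes its
  -- integral nonnegative, so the product vanishes almost everywhere.
  set w : TimeL2 (Lp ℝ 2 ϱ) := ((u₀ - q) ⊔ L) ⊓ R with hw
  have hwbox : w ∈ controlBox lo hi := ⟨le_inf le_sup_right hLR, inf_le_right⟩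
  have hwt : ∀ᵐ t ∂timeMeasure, ∀ᵐ x ∂ϱ, (w - u₀) t x =
      min (max (u₀ t x - q t x) (lo x)) (hi x) - u₀ t x := by
    filter_upwards [Lp.coeFn_inf ((u₀ - q) ⊔ L) R, Lp.coeFn_sup (u₀ - q) L, Lp.coeFn_sub u₀ q,
      coeFn_constT lo, coeFn_constT hi, Lp.coeFn_sub w u₀] with t h1 h2 h3 h4 h5 h6
    have h7 : (w - u₀) t = (((u₀ t - q t) ⊔ lo) ⊓ hi) - u₀ t := by
      rw [h6, Pi.sub_apply, h1, Pi.inf_apply, h2, Pi.sup_apply, h3, Pi.sub_apply, h4, h5]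
    rw [h7]
    filter_upwards [Lp.coeFn_sub (((u₀ t - q t) ⊔ lo) ⊓ hi) (u₀ t),
      Lp.coeFn_inf ((u₀ t - q t) ⊔ lo) hi, Lp.coeFn_sup (u₀ t - q t) lo,
      Lp.coeFn_sub (u₀ t) (q t)] with x g1 g2 g3 g4
    rw [g1, Pi.sub_apply, g2, Pi.inf_apply, g3, Pi.sup_apply, g4, Pi.sub_apply]
  have hbox : ∀ v ∈ controlBox lo hi, ∀ᵐ t ∂timeMeasure, ∀ᵐ x ∂ϱ, lo x ≤ v t x ∧ v t x ≤ hi x := by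
    intro v hv
    filter_upwards [(mem_controlBox_iff lo hi v).1 hv] with t ht
    exact ((Lp.coeFn_le _ _).2 ht.1).and ((Lp.coeFn_le _ _).2 ht.2)
  have hneg : ∀ᵐ t ∂timeMeasure, ∀ᵐ x ∂ϱ, q t x * (w - u₀) t x ≤ 0 := by
    filter_upwards [hwt, hbox u₀ hu₀] with t h1 h2
    filter_upwards [h1, h2] with x h3 h4
    rw [h3]
    rcases le_total 0 (q t x) with h0 | h0
    · refine mul_nonpos_of_nonneg_of_nonpos h0 (sub_nonpos.2 ((min_le_left _ _).trans
        (max_le (by linarith) h4.1)))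
    · refine mul_nonpos_of_nonpos_of_nonneg h0 (sub_nonneg.2 (le_min
        (le_max_of_le_left (by linarith)) h4.2))
  have hinner : ∀ᵐ t ∂timeMeasure, inner ℝ (q t) ((w - u₀) t) ≤ 0 := by
    filter_upwards [hneg] with t ht
    rw [inner_Lp_eq]
    exact integral_nonpos_of_ae ht
  have hzero : ∀ᵐ t ∂timeMeasure, inner ℝ (q t) ((w - u₀) t) = 0 := by
    have h1 := hopt w hwbox
    rw [inner_timeL2] at h1
    have h2 : ∫ t, -inner ℝ (q t) ((w - u₀) t) ∂timeMeasure = 0 := by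
      refine le_antisymm ?_ (integral_nonneg_of_ae ?_)
      · rw [integral_neg]; linarith
      · filter_upwards [hinner] with t ht
        simpa using ht
    have h3 : Integrable (fun t => -inner ℝ (q t) ((w - u₀) t)) timeMeasure :=
      (L2.integrable_inner (𝕜 := ℝ) _ _).neg
    have h4 : 0 ≤ᵐ[timeMeasure] fun t => -inner ℝ (q t) ((w - u₀) t) := by
      filter_upwards [hinner] with t ht
      simpa using ht
    filter_upwards [(integral_eq_zero_iff_of_nonneg_ae h4 h3).1 h2] with t ht
    simpa using ht
  filter_upwards [hzero, hneg, hwt, hbox u₀ hu₀, hbox u hu, Lp.coeFn_sub u u₀]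
    with t h1 h2 h3 h4 h5 h6
  have h7 : ∀ᵐ x ∂ϱ, q t x * (w - u₀) t x = 0 := by
    rw [inner_Lp_eq] at h1
    have h8 : ∫ x, -(q t x * (w - u₀) t x) ∂ϱ = 0 := by rw [integral_neg, h1, neg_zero]
    have h9 : Integrable (fun x => -(q t x * (w - u₀) t x)) ϱ := (integrable_mul_Lp _ _).neg
    have h10 : 0 ≤ᵐ[ϱ] fun x => -(q t x * (w - u₀) t x) := by
      filter_upwards [h2] with x hx
      simpa using hx
    filter_upwards [(integral_eq_zero_iff_of_nonneg_ae h10 h9).1 h8] with x hx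
    simpa using hx
  rw [h6, Pi.sub_apply]
  filter_upwards [h7, h3, h4, h5, Lp.coeFn_sub (u t) (u₀ t), (Lp.coeFn_le _ _).2 hle]
    with x g1 g2 g3 g4 g5 g6
  rw [g5, Pi.sub_apply]
  rw [g2] at g1
  -- Where `q ≠ 0` the projection does not move `u₀`, so `u₀` sits at the upper bound if `q < 0` and
  -- at the lower bound if `q > 0`. This fixes the sign of `u - u₀`.
  rcases lt_trichotomy (q t x) 0 with h0 | h0 | h0
  · have g7 : min (max (u₀ t x - q t x) (lo x)) (hi x) - u₀ t x = 0 :=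
      (mul_eq_zero.1 g1).resolve_left h0.ne
    have g8 : hi x ≤ u₀ t x := by
      by_contra! hlt
      have : u₀ t x < min (max (u₀ t x - q t x) (lo x)) (hi x) :=
        lt_min (lt_max_of_lt_left (by linarith)) hlt
      linarith
    rw [abs_of_neg h0, abs_of_nonpos (by linarith [g4.2])]
    ring
  · simp [h0]
  · have g7 : min (max (u₀ t x - q t x) (lo x)) (hi x) - u₀ t x = 0 :=
      (mul_eq_zero.1 g1).resolve_left h0.ne'
    have g8 : u₀ t x ≤ lo x := by
      by_contra! hlt
      have : min (max (u₀ t x - q t x) (lo x)) (hi x) < u₀ t x :=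
        (min_le_left _ _).trans_lt (max_lt (by linarith) hlt)
      linarith
    rw [abs_of_pos h0, abs_of_nonneg (by linarith [g4.1])]

/-- Quadratic growth in `L¹` of the linearized functional under the structural assumption on the
switching function. -/
theorem exists_quadratic_growth [IsFiniteMeasure ϱ] {lo hi : Lp ℝ 2 ϱ}
    {q u₀ : TimeL2 (Lp ℝ 2 ϱ)} (hle : lo ≤ hi) (hu₀ : u₀ ∈ controlBox lo hi)
    (hopt : ∀ u ∈ controlBox lo hi, 0 ≤ inner ℝ q (u - u₀)) {M : ℝ} (hM : 0 < M)
    (hbd : ∀ᵐ x ∂ϱ, hi x - lo x ≤ M) {C : ℝ} (hC : 0 < C)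
    (hstruct : ∀ ε > 0, ∫⁻ t, ϱ {x | -ε ≤ q t x ∧ q t x ≤ ε} ∂timeMeasure ≤
      ENNReal.ofReal (C * ε)) :
    ∃ c > 0, ∀ u ∈ controlBox lo hi, c * controlGap u u₀ ^ 2 ≤ inner ℝ q (u - u₀) := by
  refine ⟨1 / (4 * (M * C)), by positivity, fun u hu => ?_⟩
  set v := u - u₀ with hv
  have hG0 : 0 ≤ inner ℝ q v := hopt u hu
  have hbang := bang_bang hle hu₀ hopt hu
  have hvM : ∀ᵐ t ∂timeMeasure, ∀ᵐ x ∂ϱ, |v t x| ≤ M := by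
    filter_upwards [(mem_controlBox_iff lo hi u).1 hu, (mem_controlBox_iff lo hi u₀).1 hu₀,
      Lp.coeFn_sub u u₀] with t h1 h2 h3
    rw [hv, h3, Pi.sub_apply]
    filter_upwards [(Lp.coeFn_le _ _).2 h1.1, (Lp.coeFn_le _ _).2 h1.2, (Lp.coeFn_le _ _).2 h2.1,
      (Lp.coeFn_le _ _).2 h2.2, Lp.coeFn_sub (u t) (u₀ t), hbd] with x g1 g2 g3 g4 g5 g6
    rw [g5, Pi.sub_apply, abs_le]
    constructor <;> linarith
  -- Split at the level `|q| = ε`: above it `|v| ≤ |q||v|/ε = q v/ε` by the bang-bang principle;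
  -- below it `|v| ≤ M` on a set of measure at most `C ε`.
  have key : ∀ ε > 0, controlGap u u₀ ≤ inner ℝ q v / ε + M * (C * ε) := by
    intro ε hε
    set S : ℝ → Set Ω := fun t => {x | -ε ≤ q t x ∧ q t x ≤ ε} with hS
    have hSm : ∀ t, MeasurableSet (S t) := fun t =>
      (measurableSet_le measurable_const (Lp.stronglyMeasurable (q t)).measurable).inter
        (measurableSet_le (Lp.stronglyMeasurable (q t)).measurable measurable_const)
    have hpt : ∀ᵐ t ∂timeMeasure, ‖lpIncl ϱ (v t)‖ ≤
        inner ℝ (q t) (v t) / ε + M * ϱ.real (S t) := by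
      filter_upwards [hbang, hvM] with t h1 h2
      rw [norm_lpIncl, inner_Lp_eq, ← integral_div]
      have i1 : Integrable (fun x => q t x * v t x / ε) ϱ := (integrable_mul_Lp _ _).div_const _
      have i2 : Integrable ((S t).indicator fun _ => M) ϱ :=
        (integrable_const M).indicator (hSm t)
      have h3 : M * ϱ.real (S t) = ∫ x, (S t).indicator (fun _ => M) x ∂ϱ := by
        rw [integral_indicator_const _ (hSm t), smul_eq_mul, mul_comm]
      rw [h3, ← integral_add i1 i2]
      refine integral_mono_ae ((Lp.memLp (v t)).integrable one_le_two).abs (i1.add i2) ?_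
      filter_upwards [h1, h2] with x g1 g2
      have g3 : q t x * v t x / ε = |q t x| * |v t x| / ε := by rw [g1]
      rw [g3]
      by_cases hx : x ∈ S t
      · rw [indicator_of_mem hx]
        have : 0 ≤ |q t x| * |v t x| / ε := by positivity
        linarith
      · rw [indicator_of_notMem hx, add_zero, le_div_iff₀ hε]
        have : ε ≤ |q t x| := by
          by_contra! hlt
          exact hx (abs_le.1 hlt.le)
        rw [mul_comm]
        exact mul_le_mul_of_nonneg_right this (abs_nonneg _)
    have hgnn : ∀ᵐ t ∂timeMeasure, 0 ≤ inner ℝ (q t) (v t) / ε := by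
      filter_upwards [hbang] with t h1
      refine div_nonneg ?_ hε.le
      rw [inner_Lp_eq]
      refine integral_nonneg_of_ae ?_
      filter_upwards [h1] with x hx
      rw [hx]
      positivity
    have hint : Integrable (fun t => inner ℝ (q t) (v t) / ε) timeMeasure :=
      (L2.integrable_inner (𝕜 := ℝ) _ _).div_const _
    -- Working with lower integrals avoids having to show that `t ↦ ϱ (S t)` is measurable: only the
    -- first summand has to be.
    have hlin : ENNReal.ofReal (controlGap u u₀) ≤
        ENNReal.ofReal (inner ℝ q v / ε) + ENNReal.ofReal M * ENNReal.ofReal (C * ε) := by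
      rw [controlGap, ofReal_integral_eq_lintegral_ofReal (integrable_lpIncl v).norm
        (Eventually.of_forall fun _ => norm_nonneg _), inner_timeL2, ← integral_div,
        ofReal_integral_eq_lintegral_ofReal hint hgnn]
      calc ∫⁻ t, ENNReal.ofReal ‖lpIncl ϱ (v t)‖ ∂timeMeasure
          ≤ ∫⁻ t, (ENNReal.ofReal (inner ℝ (q t) (v t) / ε) +
              ENNReal.ofReal M * ϱ (S t)) ∂timeMeasure := by
            refine lintegral_mono_ae ?_
            filter_upwards [hpt, hgnn] with t h1 h2
            refine (ENNReal.ofReal_le_ofReal h1).trans (le_of_eq ?_)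
            rw [ENNReal.ofReal_add h2 (by positivity), ENNReal.ofReal_mul hM.le,
              Measure.real, ENNReal.ofReal_toReal (measure_ne_top _ _)]
        _ = ∫⁻ t, ENNReal.ofReal (inner ℝ (q t) (v t) / ε) ∂timeMeasure +
              ∫⁻ t, ENNReal.ofReal M * ϱ (S t) ∂timeMeasure :=
            lintegral_add_left' hint.aestronglyMeasurable.aemeasurable.ennreal_ofReal _
        _ ≤ _ := by
            refine add_le_add le_rfl ?_
            rw [lintegral_const_mul' _ _ ENNReal.ofReal_ne_top]
            exact mul_le_mul_right (hstruct ε hε) _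
    rw [← ENNReal.ofReal_mul hM.le, ← ENNReal.ofReal_add (by positivity) (by positivity)] at hlin
    exact (ENNReal.ofReal_le_ofReal_iff (by positivity)).1 hlin
  have hgap0 := controlGap_nonneg u u₀
  set g := controlGap u u₀
  rcases hgap0.eq_or_lt with h0 | h0
  · rw [← h0]; simpa using hG0
  -- This `ε` makes the second term equal to `g/2`, which is absorbed on the left; the constant
  -- `1/(4MC)` results.
  · have h1 := key (g / (2 * (M * C))) (by positivity)
    have h2 : M * (C * (g / (2 * (M * C)))) = g / 2 := by field_simp
    have h3 : inner ℝ q v / (g / (2 * (M * C))) = inner ℝ q v * (2 * (M * C)) / g := by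
      rw [div_div_eq_mul_div]
    rw [h2, h3] at h1
    have h4 : g / 2 ≤ inner ℝ q v * (2 * (M * C)) / g := by linarith
    rw [le_div_iff₀ h0] at h4
    rw [div_mul_eq_mul_div, one_mul, div_le_iff₀ (by positivity)]
    nlinarith

end Control

end Parabolic

end

/-! ### Dependence of the state on the parameter, and the control problem as a distance problem -/

noncomputable section

namespace Parabolic

namespace GardingTriple

variable {V H : Type*}
  [NormedAddCommGroup V] [InnerProductSpace ℝ V] [CompleteSpace V]
  [NormedAddCommGroup H] [InnerProductSpace ℝ H] [CompleteSpace H]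

/-- The map from the data of the evolution equation to the solution. -/
def sol (T : GardingTriple V H) (ν : ℝ) : TimeL2 V × H →L[ℝ] TimeL2 V :=
  (ContinuousLinearMap.fst ℝ _ _).comp (T.solver ν)

/-- The map from the data of the evolution equation to the terminal value of the solution. -/
def terminal (T : GardingTriple V H) (ν : ℝ) : TimeL2 V × H →L[ℝ] H :=
  (BoundedContinuousFunction.evalCLM ℝ (1 : ℝ)).comp
    ((ContinuousLinearMap.snd ℝ _ _).comp (T.solver ν))

theorem norm_sol_le (T : GardingTriple V H) {ν κ : ℝ} (hκ : T.Dominates ν κ)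
    (x : TimeL2 V × H) : ‖T.sol ν x‖ ≤ 4 * κ * ‖x‖ :=
  (norm_fst_le _).trans ((T.isSolver_solver hκ.pos).norm_le κ hκ x)

theorem norm_terminal_le (T : GardingTriple V H) {ν κ : ℝ} (hκ : T.Dominates ν κ)
    (x : TimeL2 V × H) : ‖T.terminal ν x‖ ≤ 4 * κ * ‖x‖ :=
  (((T.solver ν x).2.norm_coe_le_norm 1).trans (norm_snd_le _)).trans
    ((T.isSolver_solver hκ.pos).norm_le κ hκ x)

theorem norm_mk_zero (f : TimeL2 V) : ‖((f, 0) : TimeL2 V × H)‖ = ‖f‖ := by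
  rw [Prod.norm_def, norm_zero, max_eq_left (norm_nonneg _)]

theorem norm_sol_mk_zero_le (T : GardingTriple V H) {ν κ : ℝ} (hκ : T.Dominates ν κ)
    (f : TimeL2 V) : ‖T.sol ν (f, 0)‖ ≤ 4 * κ * ‖f‖ := by
  simpa only [norm_mk_zero] using T.norm_sol_le hκ (f, 0)

theorem norm_terminal_mk_zero_le (T : GardingTriple V H) {ν κ : ℝ} (hκ : T.Dominates ν κ)
    (f : TimeL2 V) : ‖T.terminal ν (f, 0)‖ ≤ 4 * κ * ‖f‖ := by
  simpa only [norm_mk_zero] using T.norm_terminal_le hκ (f, 0)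

theorem sol_eq (T : GardingTriple V H) {μ ν : ℝ} (hμ : 0 < μ) (hν : 0 < ν)
    (f : TimeL2 V) (c : H) :
    T.sol μ (f, c) = T.sol ν (f, c) - (μ - ν) • T.sol μ (lift T.A (T.sol ν (f, c)), 0) :=
  (T.solver_sub_solver hμ hν f c).1

theorem terminal_eq (T : GardingTriple V H) {μ ν : ℝ} (hμ : 0 < μ) (hν : 0 < ν)
    (f : TimeL2 V) (c : H) :
    T.terminal μ (f, c) =
      T.terminal ν (f, c) - (μ - ν) • T.terminal μ (lift T.A (T.sol ν (f, c)), 0) :=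
  (T.solver_sub_solver hμ hν f c).2

/-- The right hand side of the equation for the derivative of the state with respect to the
parameter. -/
def residual (T : GardingTriple V H) (ν : ℝ) (f : TimeL2 V) (c : H) : TimeL2 V :=
  f - lift T.A (T.sol ν (ν • f, c))

theorem smul_mk_decomp (μ ν : ℝ) (f : TimeL2 V) (c : H) :
    ((μ • f, c) : TimeL2 V × H) = (ν • f, c) + (μ - ν) • (f, 0) := by
  ext1
  · simp [sub_smul]
  · simp

theorem mk_zero_sub (f g : TimeL2 V) :
    ((f - g, 0) : TimeL2 V × H) = (f, 0) - (g, 0) := by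
  simp

/-- An exact difference formula: the difference of the two states solves the `μ`-equation with
source `(μ - ν)(f - A y_ν)`. Replacing the solution operator for `μ` by that for `ν` gives the
derivative. -/
theorem sol_smul_sub (T : GardingTriple V H) {μ ν : ℝ} (hμ : 0 < μ) (hν : 0 < ν)
    (f : TimeL2 V) (c : H) :
    T.sol μ (μ • f, c) - T.sol ν (ν • f, c) = (μ - ν) • T.sol μ (T.residual ν f c, 0) := by
  rw [smul_mk_decomp μ ν, map_add, map_smul, T.sol_eq hμ hν (ν • f) c, residual, mk_zero_sub,
    map_sub, smul_sub]
  abel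

theorem terminal_smul_sub (T : GardingTriple V H) {μ ν : ℝ} (hμ : 0 < μ) (hν : 0 < ν)
    (f : TimeL2 V) (c : H) :
    T.terminal μ (μ • f, c) - T.terminal ν (ν • f, c) =
      (μ - ν) • T.terminal μ (T.residual ν f c, 0) := by
  rw [smul_mk_decomp μ ν, map_add, map_smul, T.terminal_eq hμ hν (ν • f) c, residual, mk_zero_sub,
    map_sub, smul_sub]
  abel

theorem residual_sub (T : GardingTriple V H) {μ ν : ℝ} (hμ : 0 < μ) (hν : 0 < ν)
    (f : TimeL2 V) (c : H) :
    T.residual μ f c - T.residual ν f c =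
      -((μ - ν) • lift T.A (T.sol μ (T.residual ν f c, 0))) := by
  rw [← map_smul, ← T.sol_smul_sub hμ hν, map_sub, residual, residual]
  abel

theorem norm_residual_le (T : GardingTriple V H) {ν κ b F : ℝ} (hκ : T.Dominates ν κ)
    (hν : ν ≤ b) {f : TimeL2 V} (hf : ‖f‖ ≤ F) (c : H) :
    ‖T.residual ν f c‖ ≤ F + ‖T.A‖ * (4 * κ * (|b| * F + ‖c‖)) := by
  have hκ0 : 0 ≤ κ := zero_le_one.trans hκ.one_le
  have hF : 0 ≤ F := (norm_nonneg _).trans hf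
  have h1 : ‖((ν • f, c) : TimeL2 V × H)‖ ≤ |b| * F + ‖c‖ := by
    have h2 : ‖ν • f‖ ≤ |b| * F := by
      rw [norm_smul, Real.norm_eq_abs]
      exact mul_le_mul (abs_le_abs_of_nonneg hκ.pos.le hν) hf (norm_nonneg _) (abs_nonneg _)
    rw [Prod.norm_def]
    exact max_le (h2.trans (le_add_of_nonneg_right (norm_nonneg _)))
      (le_add_of_nonneg_left (by positivity))
  refine (norm_sub_le _ _).trans (add_le_add hf ((norm_lift_le _ _).trans ?_))
  refine mul_le_mul_of_nonneg_left ((T.norm_sol_le hκ _).trans ?_) (norm_nonneg _)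
  exact mul_le_mul_of_nonneg_left h1 (by positivity)

/-- By the exact difference formula, the second order remainder is `(μ - ν)` times the change of the
solution operator on a fixed residual, and the resolvent identity makes that change `O(|μ - ν|)`.
The constants depend on `f` only through `F`. -/
theorem exists_expansion_bounds (T : GardingTriple V H) {a : ℝ} (ha : 0 < a) (b F : ℝ) (c : H) :
    ∃ C > 0, ∀ μ ∈ Icc a b, ∀ ν ∈ Icc a b, ∀ f : TimeL2 V, ‖f‖ ≤ F →
      ‖T.terminal ν (T.residual ν f c, 0)‖ ≤ C ∧
      ‖T.terminal μ (μ • f, c) - T.terminal ν (ν • f, c) -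
        (μ - ν) • T.terminal ν (T.residual ν f c, 0)‖ ≤ C * (μ - ν) ^ 2 ∧
      ‖T.terminal μ (T.residual μ f c, 0) - T.terminal ν (T.residual ν f c, 0)‖ ≤
        C * |μ - ν| := by
  obtain ⟨κ, hκ⟩ := T.exists_dominates (b := b) ha
  set K := |F| + ‖T.A‖ * (4 * |κ| * (|b| * |F| + ‖c‖)) with hK
  have hK0 : 0 ≤ K := by positivity
  set M := 4 * |κ| * (‖T.A‖ * (4 * |κ| * K)) with hM
  have hM0 : 0 ≤ M := by positivity
  refine ⟨1 + 4 * |κ| * K + 2 * M, by positivity, fun μ hμ ν hν f hf => ?_⟩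
  have hdμ := hκ μ hμ
  have hdν := hκ ν hν
  have hκ0 : |κ| = κ := abs_of_nonneg (zero_le_one.trans hdν.one_le)
  set g := T.residual ν f c with hg
  have hgK : ‖g‖ ≤ K := by
    have := T.norm_residual_le hdν hν.2 (hf.trans (le_abs_self F)) c
    rwa [← hκ0] at this
  have hA : ∀ (w : TimeL2 V) {R : ℝ}, ‖w‖ ≤ R → ‖lift T.A w‖ ≤ ‖T.A‖ * R := fun w R hw =>
    (norm_lift_le _ _).trans (mul_le_mul_of_nonneg_left hw (norm_nonneg _))
  have hE : ∀ {x : ℝ}, T.Dominates x κ → ∀ (w : TimeL2 V) {R : ℝ}, ‖w‖ ≤ R →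
      ‖T.terminal x (w, 0)‖ ≤ 4 * |κ| * R := fun hx w R hw => by
    rw [hκ0] at *
    exact (T.norm_terminal_mk_zero_le hx w).trans
      (mul_le_mul_of_nonneg_left hw (by linarith [hx.one_le]))
  have hS : ∀ {x : ℝ}, T.Dominates x κ → ∀ (w : TimeL2 V) {R : ℝ}, ‖w‖ ≤ R →
      ‖T.sol x (w, 0)‖ ≤ 4 * |κ| * R := fun hx w R hw => by
    rw [hκ0] at *
    exact (T.norm_sol_mk_zero_le hx w).trans
      (mul_le_mul_of_nonneg_left hw (by linarith [hx.one_le]))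
  have h1 : ‖T.terminal μ (g, 0) - T.terminal ν (g, 0)‖ ≤ M * |μ - ν| := by
    rw [T.terminal_eq hdμ.pos hdν.pos g 0, sub_sub_cancel_left, norm_neg, norm_smul,
      Real.norm_eq_abs, mul_comm]
    exact mul_le_mul_of_nonneg_right (hE hdμ _ (hA _ (hS hdν _ hgK))) (abs_nonneg _)
  refine ⟨(hE hdν _ hgK).trans (by linarith), ?_, ?_⟩
  · rw [T.terminal_smul_sub hdμ.pos hdν.pos, ← smul_sub, norm_smul, Real.norm_eq_abs]
    calc |μ - ν| * ‖T.terminal μ (g, 0) - T.terminal ν (g, 0)‖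
        ≤ |μ - ν| * (M * |μ - ν|) := mul_le_mul_of_nonneg_left h1 (abs_nonneg _)
      _ = M * (μ - ν) ^ 2 := by rw [← sq_abs (μ - ν)]; ring
      _ ≤ _ := mul_le_mul_of_nonneg_right (by linarith [show 0 ≤ 4 * |κ| * K by positivity])
        (sq_nonneg _)
  · have h2 : ‖T.terminal μ (T.residual μ f c - g, 0)‖ ≤ M * |μ - ν| := by
      rw [hg, T.residual_sub hdμ.pos hdν.pos, ← hg, ← smul_neg,
        show (((μ - ν) • -lift T.A (T.sol μ (g, 0)), 0) : TimeL2 V × H) =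
          (μ - ν) • (-lift T.A (T.sol μ (g, 0)), 0) by simp, map_smul, norm_smul,
        Real.norm_eq_abs, mul_comm]
      refine mul_le_mul_of_nonneg_right (hE hdμ _ ?_) (abs_nonneg _)
      rw [norm_neg]
      exact hA _ (hS hdμ _ hgK)
    have h3 : T.terminal μ (T.residual μ f c, 0) - T.terminal ν (g, 0) =
        T.terminal μ (T.residual μ f c - g, 0) +
          (T.terminal μ (g, 0) - T.terminal ν (g, 0)) := by
      rw [mk_zero_sub, map_sub]; abel
    rw [h3]
    calc _ ≤ M * |μ - ν| + M * |μ - ν| := (norm_add_le _ _).trans (add_le_add h2 h1)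
      _ = (2 * M) * |μ - ν| := by ring
      _ ≤ _ := mul_le_mul_of_nonneg_right (by linarith [show 0 ≤ 4 * |κ| * K by positivity])
        (abs_nonneg _)

section Control

variable {Ω : Type*} [MeasurableSpace Ω] {ϱ : Measure Ω} [IsFiniteMeasure ϱ]

/-- The control problem as a parametrized minimal distance problem. -/
def distanceProblem (T : GardingTriple V H) (K : Lp ℝ 2 ϱ →L[ℝ] V) (K₁ : Lp ℝ 1 ϱ →L[ℝ] H)
    (hK : ∀ w, K w = T.embAdj (K₁ (lpIncl ϱ w))) (c yd : H) (lo hi : Lp ℝ 2 ϱ) (hle : lo ≤ hi) :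
    DistanceProblem (TimeL2 (Lp ℝ 2 ϱ)) H where
  U := controlBox lo hi
  nonempty := nonempty_controlBox hle
  closed := isClosed_controlBox lo hi
  convex := convex_controlBox lo hi
  bounded := norm_le_of_mem_controlBox lo hi
  h ν u := T.terminal ν (ν • lift K u, c)
  z ν u := T.terminal ν (T.residual ν (lift K u) c, 0)
  yd := yd
  gap := controlGap
  gap_nonneg := controlGap_nonneg
  h_affine ν _ := by
    refine ⟨(T.terminal ν).comp ((ContinuousLinearMap.inl ℝ _ _).comp (ν • lift K)),
      T.terminal ν (0, c), fun u => ?_⟩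
    simp only [ContinuousLinearMap.comp_apply, ContinuousLinearMap.inl_apply, ← map_add]
    simp
  z_affine ν _ := by
    refine ⟨(T.terminal ν).comp ((ContinuousLinearMap.inl ℝ _ _).comp
        (lift K - (lift T.A).comp ((T.sol ν).comp
          ((ContinuousLinearMap.inl ℝ _ _).comp (ν • lift K))))),
      T.terminal ν (-lift T.A (T.sol ν (0, c)), 0), fun u => ?_⟩
    have h1 : T.sol ν (ν • lift K u, c) = T.sol ν (ν • lift K u, 0) + T.sol ν (0, c) := by
      rw [← map_add]; simp
    have h2 : ((T.residual ν (lift K u) c, 0) : TimeL2 V × H) =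
        (lift K u - lift T.A (T.sol ν (ν • lift K u, 0)), 0) +
          (-lift T.A (T.sol ν (0, c)), 0) := by
      rw [residual, h1, map_add, Prod.mk_add_mk, add_zero]
      congr 1
      abel
    rw [h2, map_add]
    rfl
  bounds a ha b := by
    obtain ⟨R, hR⟩ := norm_le_of_mem_controlBox lo hi
    obtain ⟨C, hC, h⟩ := T.exists_expansion_bounds ha b (‖K‖ * R) c
    exact ⟨C, hC, fun μ hμ ν hν u hu => h μ hμ ν hν _ ((norm_lift_le _ _).trans
      (mul_le_mul_of_nonneg_left (hR u hu) (norm_nonneg _)))⟩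
  lipschitz ν hν := by
    obtain ⟨κ, hκ⟩ := T.exists_dominates (b := ν) hν
    have hd := hκ ν ⟨le_rfl, le_rfl⟩
    have hκ0 : 0 ≤ κ := zero_le_one.trans hd.one_le
    set β := ‖K₁‖ with hβ
    refine ⟨1 + ν * (4 * κ * β) + (4 * κ * β + 4 * κ * (‖T.A‖ * (ν * (4 * κ * β)))),
      by positivity, fun u _ w _ => ?_⟩
    have hgap := controlGap_nonneg u w
    -- The factorization of `K` through `L¹(Ω)` and `H` turns the difference of sources into an
    -- `H`-valued function whose `L¹(0,1;H)` norm is at most `‖K₁‖` times the gap; the duality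
    -- estimates then apply.
    set h := lift (K₁.comp (lpIncl ϱ)) (u - w) with hh
    have hint : ∫ t, ‖h t‖ ∂timeMeasure ≤ β * controlGap u w := by
      rw [controlGap, ← integral_const_mul]
      refine integral_mono_ae (integrable_timeL2 h).norm ((integrable_lpIncl _).norm.const_mul _) ?_
      filter_upwards [coeFn_lift (K₁.comp (lpIncl ϱ)) (u - w)] with t ht
      rw [hh, ht]
      exact K₁.le_opNorm _
    have hlift : lift K u - lift K w = lift T.embAdj h := by
      rw [← map_sub]
      refine Lp.ext ?_
      filter_upwards [coeFn_lift K (u - w), coeFn_lift T.embAdj h,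
        coeFn_lift (K₁.comp (lpIncl ϱ)) (u - w)] with t h1 h2 h3
      rw [h1, h2, h3, hK]
      rfl
    have hE : ‖T.terminal ν (lift T.embAdj h, 0)‖ ≤ 4 * κ * β * controlGap u w := by
      refine (T.norm_solver_embAdj_terminal_le hd h).trans ?_
      rw [mul_assoc (4 * κ)]
      exact mul_le_mul_of_nonneg_left hint (by positivity)
    have hS : ‖T.sol ν (lift T.embAdj h, 0)‖ ≤ 4 * κ * β * controlGap u w := by
      refine (T.norm_solver_embAdj_fst_le hd h).trans ?_
      rw [mul_assoc (4 * κ)]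
      exact mul_le_mul_of_nonneg_left hint (by positivity)
    have hpair : ((ν • lift K u, c) : TimeL2 V × H) - (ν • lift K w, c) =
        ν • (lift T.embAdj h, 0) := by
      rw [← hlift]
      ext1
      · simp [smul_sub]
      · simp
    have e1 : 0 ≤ ν * (4 * κ * β) * controlGap u w := by positivity
    have e2 : 0 ≤ 4 * κ * β * controlGap u w := by positivity
    have e3 : 0 ≤ 4 * κ * (‖T.A‖ * (ν * (4 * κ * β))) * controlGap u w := by positivity
    constructor
    · rw [← map_sub, hpair, map_smul, norm_smul, Real.norm_eq_abs, abs_of_pos hν]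
      have := mul_le_mul_of_nonneg_left hE hν.le
      linarith
    · have h1 : T.residual ν (lift K u) c - T.residual ν (lift K w) c =
          lift T.embAdj h - ν • lift T.A (T.sol ν (lift T.embAdj h, 0)) := by
        rw [residual, residual, sub_sub_sub_comm, hlift, ← map_sub, ← map_sub, hpair, map_smul,
          map_smul]
      rw [← map_sub, ← mk_zero_sub, h1, mk_zero_sub, map_sub]
      refine (norm_sub_le _ _).trans ?_
      have h2 : ‖T.terminal ν (ν • lift T.A (T.sol ν (lift T.embAdj h, 0)), 0)‖ ≤
          4 * κ * (‖T.A‖ * (ν * (4 * κ * β))) * controlGap u w := by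
        refine (T.norm_terminal_mk_zero_le hd _).trans ?_
        rw [norm_smul, Real.norm_eq_abs, abs_of_pos hν]
        calc 4 * κ * (ν * ‖lift T.A (T.sol ν (lift T.embAdj h, 0))‖)
            ≤ 4 * κ * (ν * (‖T.A‖ * (4 * κ * β * controlGap u w))) := by
              gcongr
              exact (norm_lift_le _ _).trans (mul_le_mul_of_nonneg_left hS (norm_nonneg _))
          _ = _ := by ring
      linarith

end Control

end GardingTriple

end Parabolic

end

/-! ### Identification of minimizers, value function and derivative expression; growth at the root
-/

noncomputable section

namespace Parabolic

/-- The first order necessary condition: insert the second order upper bound for the norm, divide by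
`t` and let `t` tend to zero. -/
theorem inner_nonneg_of_norm_le_norm_add_smul {X : Type*} [NormedAddCommGroup X]
    [InnerProductSpace ℝ X] {x e : X} (hx : x ≠ 0)
    (h : ∀ t : ℝ, 0 < t → t ≤ 1 → ‖x‖ ≤ ‖x + t • e‖) : 0 ≤ inner ℝ (‖x‖⁻¹ • x) e := by
  set i := inner ℝ (‖x‖⁻¹ • x) e with hi
  set c := ‖e‖ ^ 2 / (2 * ‖x‖) with hc
  have hc0 : 0 ≤ c := by positivity
  have key : ∀ t : ℝ, 0 < t → t ≤ 1 → 0 ≤ i + t * c := by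
    intro t h0 h1
    have h2 := (h t h0 h1).trans (norm_add_le_inner x (t • e) hx)
    rw [inner_smul_right, norm_smul, Real.norm_eq_abs, mul_pow, sq_abs, mul_div_assoc,
      ← hi, ← hc] at h2
    have h3 : 0 ≤ t * (i + t * c) := by linarith
    exact nonneg_of_mul_nonneg_right h3 h0
  have h1 : Tendsto (fun t : ℝ => i + t * c) (𝓝[>] 0) (𝓝 (i + 0 * c)) :=
    (Continuous.tendsto (by fun_prop) 0).mono_left nhdsWithin_le_nhds
  rw [zero_mul, add_zero] at h1
  refine ge_of_tendsto h1 ?_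
  filter_upwards [Ioc_mem_nhdsGT (zero_lt_one' ℝ)] with t ht
  exact key t ht.1 ht.2

end Parabolic

namespace ParabolicControl

open Parabolic

variable {V H Ω : Type*}
  [NormedAddCommGroup V] [InnerProductSpace ℝ V] [CompleteSpace V]
  [NormedAddCommGroup H] [InnerProductSpace ℝ H] [CompleteSpace H]
  [MeasurableSpace Ω] {ϱ : Measure Ω}

/-- An `L²` function exceeds `1` in modulus only on a set of finite measure. If `ϱ` were infinite,
every slice for `ε = 1` would thus have infinite measure. Finiteness gives `L² ⊆ L¹` and places the
bounds `uₐ`, `u_b` in `L²`. -/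
theorem StructuralAssumption.isFiniteMeasure {P : ParabolicControl V H Ω ϱ} {ν : ℝ}
    (h : P.StructuralAssumption ν) : IsFiniteMeasure ϱ := by
  obtain ⟨u, y, p, -, C, -, hC⟩ := h
  by_contra hfin
  have htop : ϱ univ = ⊤ := by
    by_contra h
    exact hfin ⟨lt_top_iff_ne_top.2 h⟩
  have hslice : ∀ f : Lp ℝ 2 ϱ, ϱ {x | -1 ≤ f x ∧ f x ≤ 1} = ⊤ := by
    intro f
    have h1 := (Lp.memLp f).meas_ge_lt_top two_ne_zero ENNReal.ofNat_ne_top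
      (one_ne_zero : (1 : NNReal) ≠ 0)
    have h2 : (univ : Set Ω) ⊆ {x | -1 ≤ f x ∧ f x ≤ 1} ∪ {x | (1 : NNReal) ≤ ‖f x‖₊} := by
      intro x _
      by_cases hx : -1 ≤ f x ∧ f x ≤ 1
      · exact Or.inl hx
      · refine Or.inr ?_
        rw [← abs_le, not_le] at hx
        exact NNReal.coe_le_coe.1 (by simpa using hx.le)
    by_contra h3
    have h4 := (measure_mono h2).trans (measure_union_le (μ := ϱ) _ _)
    rw [htop, top_le_iff, ENNReal.add_eq_top] at h4
    exact h4.elim h3 h1.ne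
  have h5 := hC 1 one_pos
  simp_rw [hslice] at h5
  rw [lintegral_const] at h5
  simp at h5

section Bounds

variable [IsFiniteMeasure ϱ]

/-- The lower control bound in `L²`. -/
def lower (P : ParabolicControl V H Ω ϱ) : Lp ℝ 2 ϱ :=
  (P.ua_memLp.mono_exponent le_top).toLp P.ua

/-- The upper control bound in `L²`. -/
def upper (P : ParabolicControl V H Ω ϱ) : Lp ℝ 2 ϱ :=
  (P.ub_memLp.mono_exponent le_top).toLp P.ub

theorem coeFn_lower (P : ParabolicControl V H Ω ϱ) : P.lower =ᵐ[ϱ] P.ua := MemLp.coeFn_toLp _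

theorem coeFn_upper (P : ParabolicControl V H Ω ϱ) : P.upper =ᵐ[ϱ] P.ub := MemLp.coeFn_toLp _

theorem lower_le_upper (P : ParabolicControl V H Ω ϱ) : P.lower ≤ P.upper := by
  rw [← Lp.coeFn_le]
  filter_upwards [P.coeFn_lower, P.coeFn_upper, P.ua_lt_ub] with x h1 h2 h3
  rw [h1, h2]
  exact h3.le

theorem exists_upper_sub_lower_le (P : ParabolicControl V H Ω ϱ) :
    ∃ M > 0, ∀ᵐ x ∂ϱ, P.upper x - P.lower x ≤ M := by
  have key : ∀ f : Ω → ℝ, MemLp f ∞ ϱ → ∀ᵐ x ∂ϱ, |f x| ≤ (eLpNormEssSup f ϱ).toReal := by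
    intro f hf
    have h1 : eLpNormEssSup f ϱ ≠ ⊤ := by
      rw [← eLpNorm_exponent_top]; exact hf.eLpNorm_ne_top
    filter_upwards [ae_le_eLpNormEssSup (f := f) (μ := ϱ)] with x hx
    have h2 := ENNReal.toReal_mono h1 hx
    simpa using h2
  refine ⟨1 + (eLpNormEssSup P.ua ϱ).toReal + (eLpNormEssSup P.ub ϱ).toReal, by positivity, ?_⟩
  filter_upwards [P.coeFn_lower, P.coeFn_upper, key _ P.ua_memLp, key _ P.ub_memLp]
    with x h1 h2 h3 h4
  rw [h1, h2]
  linarith [(abs_le.1 h3).1, (abs_le.1 h4).2]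

theorem mem_Uad_iff (P : ParabolicControl V H Ω ϱ) {u : ℝ → Lp ℝ 2 ϱ}
    (hu : MemLp u 2 timeMeasure) :
    u ∈ P.Uad ↔ hu.toLp u ∈ controlBox P.lower P.upper := by
  rw [mem_controlBox_iff]
  refine (and_iff_right hu).trans ?_
  have key : ∀ f : Lp ℝ 2 ϱ, (∀ᵐ x ∂ϱ, P.ua x ≤ f x ∧ f x ≤ P.ub x) ↔
      P.lower ≤ f ∧ f ≤ P.upper := by
    intro f
    rw [← Lp.coeFn_le, ← Lp.coeFn_le, eventually_and]
    refine and_congr (eventually_congr ?_) (eventually_congr ?_)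
    · filter_upwards [P.coeFn_lower] with x hx
      rw [hx]
    · filter_upwards [P.coeFn_upper] with x hx
      rw [hx]
  refine eventually_congr ?_
  filter_upwards [hu.coeFn_toLp] with t ht
  rw [ht, key]

theorem controlOp_eq (P : ParabolicControl V H Ω ϱ) {B₁ : Lp ℝ 1 ϱ →L[ℝ] H}
    (hB : ∀ (w₁ : Lp ℝ 1 ϱ) (w₂ : Lp ℝ 2 ϱ),
      (w₁ : Ω → ℝ) =ᵐ[ϱ] (w₂ : Ω → ℝ) → P.B w₂ = P.toDualV (B₁ w₁)) (w : Lp ℝ 2 ϱ) :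
    P.controlOp w = P.triple.embAdj (B₁ (lpIncl ϱ w)) := by
  rw [← riesz_toDualV, ← hB _ _ (coeFn_lpIncl w)]
  rfl

/-- The minimal distance problem belonging to the control problem. -/
def problem (P : ParabolicControl V H Ω ϱ) (B₁ : Lp ℝ 1 ϱ →L[ℝ] H)
    (hB : ∀ w, P.controlOp w = P.triple.embAdj (B₁ (lpIncl ϱ w))) :
    DistanceProblem (TimeL2 (Lp ℝ 2 ϱ)) H :=
  P.triple.distanceProblem P.controlOp B₁ hB P.y₀ P.yd P.lower P.upper P.lower_le_upper

variable {P : ParabolicControl V H Ω ϱ} {B₁ : Lp ℝ 1 ϱ →L[ℝ] H}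
  {hB : ∀ w, P.controlOp w = P.triple.embAdj (B₁ (lpIncl ϱ w))}

theorem isTerminal_iff_h {ν : ℝ} (hν : 0 < ν) {u : ℝ → Lp ℝ 2 ϱ}
    (hu : MemLp u 2 timeMeasure) (h : H) :
    P.IsTerminal ν u h ↔ h = (P.problem B₁ hB).h ν (hu.toLp u) :=
  P.isTerminal_iff hν hu h

theorem mem_Uad_coeFn {u : TimeL2 (Lp ℝ 2 ϱ)} (hu : u ∈ (P.problem B₁ hB).U) :
    (u : ℝ → Lp ℝ 2 ϱ) ∈ P.Uad := by
  rw [P.mem_Uad_iff (Lp.memLp u), Lp.toLp_coeFn]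
  exact hu

theorem isMinimizer_iff {ν : ℝ} (hν : 0 < ν) {u : ℝ → Lp ℝ 2 ϱ}
    (hu : MemLp u 2 timeMeasure) :
    P.IsMinimizer ν u ↔ (P.problem B₁ hB).IsMin ν (hu.toLp u) := by
  set Q := P.problem B₁ hB with hQ
  have hterm : ∀ {w : ℝ → Lp ℝ 2 ϱ} (hw : MemLp w 2 timeMeasure) (h : H),
      P.IsTerminal ν w h ↔ h = Q.h ν (hw.toLp w) := fun hw h => isTerminal_iff_h hν hw h
  constructor
  · rintro ⟨huU, h, h1, h2⟩
    rw [hterm hu] at h1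
    obtain ⟨w, hw, hmin⟩ := Q.exists_isMin hν
    have h3 := h2 w (mem_Uad_coeFn hw) (Q.h ν w)
      ((hterm (Lp.memLp w) _).2 (by rw [Lp.toLp_coeFn]))
    rw [h1] at h3
    have h4 := (P.mem_Uad_iff hu).1 huU
    exact ⟨h4, le_antisymm (h3.trans_eq hmin) (Q.m_le ν h4)⟩
  · rintro ⟨h0, h⟩
    refine ⟨(P.mem_Uad_iff hu).2 h0, _, (hterm hu _).2 rfl, fun w hw h' hh' => ?_⟩
    rw [hterm hw.1] at hh'
    rw [hh']
    exact h.trans_le (Q.m_le ν ((P.mem_Uad_iff hw.1).1 hw))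

theorem delta_eq {ν : ℝ} (hν : 0 < ν) : P.delta ν = (P.problem B₁ hB).m ν - P.δ₀ := by
  set Q := P.problem B₁ hB with hQ
  refine IsLeast.csInf_eq ⟨?_, ?_⟩
  · obtain ⟨w, hw, hmin⟩ := Q.exists_isMin hν
    refine ⟨w, mem_Uad_coeFn hw, Q.h ν w,
      (isTerminal_iff_h (B₁ := B₁) (hB := hB) hν (Lp.memLp w) _).2 (by rw [Lp.toLp_coeFn]), ?_⟩
    rw [← hmin]
    rfl
  · rintro _ ⟨u, hu, h, hh, rfl⟩
    rw [isTerminal_iff_h (B₁ := B₁) (hB := hB) hν hu.1] at hh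
    rw [hh]
    exact sub_le_sub_right (Q.m_le ν ((P.mem_Uad_iff hu.1).1 hu)) _

theorem IsMinimizer.exists_isOptimalTriple {P : ParabolicControl V H Ω ϱ} {ν : ℝ} (hν : 0 < ν)
    {u : ℝ → Lp ℝ 2 ϱ} (hu : P.IsMinimizer ν u) : ∃ y p, P.IsOptimalTriple ν u y p := by
  have huL := hu.1.1
  obtain ⟨dp, h1, h2, h3⟩ := P.exists_isW_adjSol hν
    (‖(P.stateSol ν (huL.toLp u)).2 1 - P.yd‖⁻¹ • ((P.stateSol ν (huL.toLp u)).2 1 - P.yd))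
  exact ⟨_, _, hu, P.isState_stateSol hν huL, dp, h1, h2, _, P.hasTrace_stateSol hν _ 1, h3⟩

/-- The normalized terminal residual. -/
def unitResidual (P : ParabolicControl V H Ω ϱ) (ν : ℝ) (u : TimeL2 (Lp ℝ 2 ϱ)) : H :=
  ‖(P.stateSol ν u).2 1 - P.yd‖⁻¹ • ((P.stateSol ν u).2 1 - P.yd)

theorem IsOptimalTriple.adjoint_eq {P : ParabolicControl V H Ω ϱ} {ν : ℝ} (hν : 0 < ν)
    {u : ℝ → Lp ℝ 2 ϱ} {y p : ℝ → V} (h : P.IsOptimalTriple ν u y p)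
    (hu : MemLp u 2 timeMeasure) :
    p =ᵐ[timeMeasure] P.triple.adjSol ν 0 (P.unitResidual ν (hu.toLp u)) := by
  obtain ⟨dp, h1, h2, c, h3, h4⟩ := h.adjoint
  rw [h.state.terminal_eq hν hu h3] at h4
  exact ParabolicControl.adjoint_eq hν h1 h2 h4

theorem inner_adjSol {ν : ℝ} (hν : 0 < ν) (f : TimeL2 V) (n : H) :
    inner ℝ f (P.triple.adjSol ν 0 n) = inner ℝ n (P.triple.terminal ν (f, 0)) := by
  rw [← P.triple.duality hν f 0 n, inner_zero_left, add_zero, real_inner_comm]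
  rfl

/-- Duality: pairing the unit terminal residual with the derivative of the terminal state equals
pairing the adjoint state with the source `B u - A y` of the linearized equation. -/
theorem IsOptimalTriple.derivExpr_eq {ν : ℝ} (hν : 0 < ν)
    {u : ℝ → Lp ℝ 2 ϱ} {y p : ℝ → V} (h : P.IsOptimalTriple ν u y p)
    (hu : MemLp u 2 timeMeasure) :
    P.derivExpr u y p = (P.problem B₁ hB).D ν (hu.toLp u) := by
  have h1 : (P.problem B₁ hB).D ν (hu.toLp u) = inner ℝ (P.unitResidual ν (hu.toLp u))
      (P.triple.terminal ν
        (P.triple.residual ν (lift P.controlOp (hu.toLp u)) P.y₀, 0)) := rfl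
  rw [h1, ← inner_adjSol hν, inner_timeL2, derivExpr]
  refine integral_congr_ae ?_
  filter_upwards [h.adjoint_eq hν hu, h.state.toLp_eq hν hu, hu.coeFn_toLp,
    Lp.coeFn_sub (lift P.controlOp (hu.toLp u))
      (lift P.triple.A (P.triple.sol ν (ν • lift P.controlOp (hu.toLp u), P.y₀))),
    coeFn_lift P.controlOp (hu.toLp u),
    coeFn_lift P.triple.A (P.triple.sol ν (ν • lift P.controlOp (hu.toLp u), P.y₀))]
    with t g1 g2 g3 g4 g5 g6
  have g7 : P.triple.residual ν (lift P.controlOp (hu.toLp u)) P.y₀ t =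
      riesz V (P.B (u t) - P.A (y t)) := by
    rw [GardingTriple.residual, g4, Pi.sub_apply, g5, g6, map_sub, riesz_A, g2, g3]
    rfl
  rw [g7, inner_riesz, g1]

/-- Every minimizer has a state and an adjoint state, so the independence assumption applies; `m(ν)
> 0` is the same as `δ(ν) > -δ₀`. -/
theorem D_eq_of_isMin (hindep : P.MinimizerIndependent) {ν : ℝ} (hν : 0 < ν)
    (hm : 0 < (P.problem B₁ hB).m ν) {u w : TimeL2 (Lp ℝ 2 ϱ)}
    (hu : (P.problem B₁ hB).IsMin ν u) (hw : (P.problem B₁ hB).IsMin ν w) :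
    (P.problem B₁ hB).D ν u = (P.problem B₁ hB).D ν w := by
  have key : ∀ v : TimeL2 (Lp ℝ 2 ϱ), (P.problem B₁ hB).IsMin ν v →
      ∃ y p, P.IsOptimalTriple ν v y p ∧ P.derivExpr v y p = (P.problem B₁ hB).D ν v := by
    intro v hv
    have h1 : P.IsMinimizer ν v := (isMinimizer_iff hν (Lp.memLp v)).2 (by rwa [Lp.toLp_coeFn])
    obtain ⟨y, p, h2⟩ := h1.exists_isOptimalTriple hν
    refine ⟨y, p, h2, ?_⟩
    rw [h2.derivExpr_eq (B₁ := B₁) (hB := hB) hν (Lp.memLp v), Lp.toLp_coeFn]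
  obtain ⟨y₁, p₁, h1, e1⟩ := key u hu
  obtain ⟨y₂, p₂, h2, e2⟩ := key w hw
  rw [← e1, ← e2]
  refine hindep ν hν ?_ _ _ _ _ _ _ h1 h2
  rw [delta_eq (B₁ := B₁) (hB := hB) hν]
  linarith

theorem Bstar_eq (P : ParabolicControl V H Ω ϱ) (v : V) :
    P.Bstar v = ContinuousLinearMap.adjoint P.controlOp v := by
  refine ext_inner_right ℝ fun w => ?_
  rw [Bstar, InnerProductSpace.toDual_symm_apply, ContinuousLinearMap.adjoint_inner_left,
    real_inner_comm]
  exact (inner_riesz (P.B w) v).symm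

/-- Quadratic growth of the distance functional under the structural assumption. -/
theorem exists_growth {ν : ℝ} (hν : 0 < ν) (hm : 0 < (P.problem B₁ hB).m ν)
    (hstruct : P.StructuralAssumption ν) :
    ∃ u₀, (P.problem B₁ hB).IsMin ν u₀ ∧ ∃ c > 0, ∀ u ∈ (P.problem B₁ hB).U,
      c * (P.problem B₁ hB).gap u u₀ ^ 2 ≤
        (P.problem B₁ hB).F ν u - (P.problem B₁ hB).F ν u₀ := by
  set Q := P.problem B₁ hB with hQ
  obtain ⟨u, y, p, htriple, C, hC, hstr⟩ := hstruct
  have hu := htriple.minimizer.1.1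
  have hmin : Q.IsMin ν (hu.toLp u) := (isMinimizer_iff hν hu).1 htriple.minimizer
  set u₀ := hu.toLp u with hu₀
  set x := Q.h ν u₀ - Q.yd with hx
  have hxF : ‖x‖ = Q.F ν u₀ := rfl
  have hx0 : x ≠ 0 := norm_pos_iff.1 (by rw [hxF, hmin.2]; exact hm)
  set n := ‖x‖⁻¹ • x with hn
  -- This is the switching function `B* p`. By duality, `ν q` is the gradient of `F(ν,·)` at `u₀`.
  set q := lift (ContinuousLinearMap.adjoint P.controlOp) (P.triple.adjSol ν 0 n) with hq
  have hdiff : ∀ w, Q.h ν w - Q.h ν u₀ =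
      ν • P.triple.terminal ν (lift P.controlOp (w - u₀), 0) := by
    intro w
    have h1 : ((ν • lift P.controlOp w, P.y₀) : TimeL2 V × H) -
        (ν • lift P.controlOp u₀, P.y₀) = ν • (lift P.controlOp (w - u₀), 0) := by
      ext1
      · simp [smul_sub]
      · simp
    rw [← map_smul, ← h1, map_sub]
    rfl
  have hinner : ∀ w, inner ℝ n (Q.h ν w - Q.h ν u₀) = ν * inner ℝ q (w - u₀) := by
    intro w
    rw [hdiff, inner_smul_right, ← inner_adjSol hν, inner_lift, real_inner_comm]
  have hopt : ∀ w ∈ Q.U, 0 ≤ inner ℝ q (w - u₀) := by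
    intro w hw
    have h1 : 0 ≤ inner ℝ n (Q.h ν w - Q.h ν u₀) := by
      refine inner_nonneg_of_norm_le_norm_add_smul hx0 fun t h0 h1 => ?_
      have h2 : u₀ + t • (w - u₀) ∈ Q.U := Q.convex.add_smul_sub_mem hmin.1 hw ⟨h0.le, h1⟩
      have h3 := Q.m_le ν h2
      rw [← hmin.2] at h3
      have h4 : x + t • (Q.h ν w - Q.h ν u₀) = Q.h ν (u₀ + t • (w - u₀)) - Q.yd := by
        have h5 : Q.h ν (u₀ + t • (w - u₀)) - Q.h ν u₀ = t • (Q.h ν w - Q.h ν u₀) := by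
          rw [hdiff, hdiff, add_sub_cancel_left, map_smul,
            show ((t • lift P.controlOp (w - u₀), 0) : TimeL2 V × H) =
              t • (lift P.controlOp (w - u₀), 0) by simp, map_smul, smul_comm]
        rw [← h5, hx]
        abel
      rw [h4]
      exact h3
    rw [hinner] at h1
    exact nonneg_of_mul_nonneg_right h1 hν
  obtain ⟨M, hM, hbd⟩ := P.exists_upper_sub_lower_le
  have hstr' : ∀ ε > 0, ∫⁻ t, ϱ {x | -ε ≤ q t x ∧ q t x ≤ ε} ∂timeMeasure ≤
      ENNReal.ofReal (C * ε) := by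
    intro ε hε
    refine le_trans (le_of_eq (lintegral_congr_ae ?_)) (hstr ε hε)
    filter_upwards [htriple.adjoint_eq hν hu,
      coeFn_lift (ContinuousLinearMap.adjoint P.controlOp) (P.triple.adjSol ν 0 n)] with t h1 h2
    rw [hq, h2, ← Bstar_eq, h1]
    rfl
  obtain ⟨c, hc, hgr⟩ := exists_quadratic_growth P.lower_le_upper hmin.1 hopt hM hbd hC hstr'
  refine ⟨u₀, hmin, ν * c, by positivity, fun w hw => ?_⟩
  -- The norm lies above its linearization at `x`, so growth of the linearized functional passes to
  -- `F`, with the factor `ν`.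
  have h1 := norm_add_inner_le x (Q.h ν w - Q.h ν u₀) hx0
  have h2 : x + (Q.h ν w - Q.h ν u₀) = Q.h ν w - Q.yd := by rw [hx]; abel
  rw [h2, ← hn, hinner] at h1
  have h3 := mul_le_mul_of_nonneg_left (hgr w hw) hν.le
  have h4 : Q.F ν w = ‖Q.h ν w - Q.yd‖ := rfl
  have h5 : Q.gap w u₀ = controlGap w u₀ := rfl
  rw [h4, ← hxF, h5]
  linarith

end Bounds

end ParabolicControl

end

/-! ### Local quadratic convergence of the Newton method -/

theorem mainTheorem12 {V H Ω : Type*}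
    [NormedAddCommGroup V] [InnerProductSpace ℝ V] [CompleteSpace V]
    [NormedAddCommGroup H] [InnerProductSpace ℝ H] [CompleteSpace H]
    [MeasurableSpace Ω] {ϱ : Measure Ω}
    (P : ParabolicControl V H Ω ϱ) (νbar : ℝ) (hνbar : 0 < νbar)
    (hroot : P.delta νbar = 0)
    (hindep : P.MinimizerIndependent)
    (hstruct : P.StructuralAssumption νbar)
    (hB : P.BoundedL1H)
    (hderiv : deriv P.delta νbar ≠ 0) :
    ∃ r > 0, ∃ C > 0,
      (∀ ν : ℝ, |ν - νbar| < r → 0 < ν ∧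
        ∀ (u : ℝ → Lp ℝ 2 ϱ) (y p : ℝ → V), P.IsOptimalTriple ν u y p →
          HasDerivAt P.delta (P.derivExpr u y p) ν ∧ P.derivExpr u y p ≠ 0) ∧
      ∀ ν₀ : ℝ, |ν₀ - νbar| < r →
        (∃ ν : ℕ → ℝ, P.IsNewtonSequence ν₀ ν) ∧
        ∀ ν : ℕ → ℝ, P.IsNewtonSequence ν₀ ν →
          (∀ n, |ν n - νbar| < r) ∧
          Tendsto ν atTop (𝓝 νbar) ∧
          ∀ n, |ν (n + 1) - νbar| ≤ C * |ν n - νbar| ^ 2 := by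
  have := hstruct.isFiniteMeasure
  obtain ⟨B₁, hB₁⟩ := hB
  set Q := P.problem B₁ (P.controlOp_eq hB₁) with hQ
  have hdelta : ∀ ν, 0 < ν → P.delta ν = Q.m ν - P.δ₀ := fun ν hν => ParabolicControl.delta_eq hν
  have hev : ∀ ν, 0 < ν → P.delta =ᶠ[𝓝 ν] fun ν => Q.m ν - P.δ₀ := fun ν hν => by
    filter_upwards [Ioi_mem_nhds hν] with μ hμ using hdelta μ hμ
  -- Hence `δ(ν) = m(ν) - m(νbar)` for `ν > 0`, and the Newton step for `δ` is the one estimated for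
  -- `m`.
  have hmbar : Q.m νbar = P.δ₀ := by linarith [hdelta νbar hνbar]
  have hmpos : 0 < Q.m νbar := hmbar ▸ P.δ₀_pos
  obtain ⟨u₀, hu₀, c, hc, hgrowth⟩ := ParabolicControl.exists_growth hνbar hmpos hstruct
  obtain ⟨r, hr, C, hC, hest⟩ := Q.exists_newton_estimate hνbar hmpos
    (fun ν hν hm u w hu hw => ParabolicControl.D_eq_of_isMin hindep hν hm hu hw) hu₀ hc hgrowth
    (by rwa [(hev νbar hνbar).deriv_eq, deriv_sub_const] at hderiv)
  have htriple : ∀ ν, |ν - νbar| < r → ∀ (u : ℝ → Lp ℝ 2 ϱ) (y p : ℝ → V),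
      P.IsOptimalTriple ν u y p → HasDerivAt P.delta (P.derivExpr u y p) ν ∧
        P.derivExpr u y p ≠ 0 ∧
        |ν - P.delta ν * (P.derivExpr u y p)⁻¹ - νbar| ≤ C * |ν - νbar| ^ 2 := by
    intro ν hν u y p h
    obtain ⟨hpos, -, h1⟩ := hest ν hν
    have hu := h.minimizer.1.1
    obtain ⟨h2, h3, h4⟩ := h1 _ ((ParabolicControl.isMinimizer_iff hpos hu).1 h.minimizer)
    rw [h.derivExpr_eq (B₁ := B₁) (hB := P.controlOp_eq hB₁) hpos hu]
    refine ⟨(h2.sub_const _).congr_of_eventuallyEq (hev ν hpos), h3, ?_⟩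
    rwa [hmbar, ← hdelta ν hpos] at h4
  -- A Newton step is a relation, since it depends on the chosen minimizer. The error bound holds
  -- for every choice, and a step exists because a minimizer with its adjoint state exists and the
  -- derivative expression is nonzero.
  obtain ⟨r', hr', hr'r, hconv⟩ := Parabolic.exists_local_quadratic_convergence (R := P.NewtonStep) hr hC
    (fun ν hν => by
      obtain ⟨hpos, -, -⟩ := hest ν hν
      obtain ⟨w, hw⟩ := Q.exists_isMin hpos
      have h1 : P.IsMinimizer ν w :=
        (ParabolicControl.isMinimizer_iff hpos (Lp.memLp w)).2 (by rwa [Lp.toLp_coeFn])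
      obtain ⟨y, p, h2⟩ := h1.exists_isOptimalTriple hpos
      exact ⟨_, hpos, w, y, p, h2, (htriple ν hν _ _ _ h2).2.1, rfl⟩)
    (fun ν ν' hν h => by
      obtain ⟨-, u, y, p, h1, -, rfl⟩ := h
      exact (htriple ν hν u y p h1).2.2)
  refine ⟨r', hr', C, hC, fun ν hν => ⟨(hest ν (hν.trans_le hr'r)).1, fun u y p h => ?_⟩, hconv⟩
  obtain ⟨h1, h2, -⟩ := htriple ν (hν.trans_le hr'r) u y p h
  exact ⟨h1, h2⟩
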